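/- **Setting.** For $I:[-1,1]\to\mathbb R$ integrable write $\langle I\rangle_k=\int_{-1}^1\mu^kI(\mu)\,d\mu$, and let $$\Omega_R=\{U=(E_0,E_1,E_2)^T:\ \exists\, I>0 \text{ on } [-1,1] \text{ integrable with } \langle I\rangle_k=E_k,\ k=0,1,2\}.$$ For $U\in\Omega_R$ put $$\alpha=-\frac{3E_1/E_0}{2+\sqrt{4-3(E_1/E_0)^2}},\qquad \omega(\mu)=\frac{3(1-\alpha^2)^3}{2(3+\alpha^2)}\,\frac1{(1+\alpha\mu)^4},\qquad \mathcal E_k=\langle\omega\rangle_k,$$ $$\beta=\frac{\mathcal E_3-\mathcal E_2\mathcal E_1}{\mathcal E_2-\mathcal E_1^2},\qquad \phi_2(\mu)=\mu^2-\mathcal E_2-\beta(\mu-\mathcal E_1),\qquad f_2=\frac{E_2-E_0\mathcal E_2}{\mathcal E_4-\mathcal E_2^2-\beta(\mathcal E_3-\mathcal E_1\mathcal E_2)}.$$ The $M_1$-$P_2$ model closes the moment system with $E_3(U)=\langle\hat I\rangle_3$, where $\hat I=\omega\,(E_0+f_2\phi_2)$. Its flux is $F(U)=(E_1,E_2,E_3(U))^T$,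 and its Riemann problem is $$\frac1c\,\partial_tU+\partial_zF(U)=0,\qquad U(z,0)=U^L\ (z<0),\quad U(z,0)=U^R\ (z>0).$$ Let $\lambda_1(U)\le\lambda_2(U)\le\lambda_3(U)$ be the eigenvalues of the Jacobian $J(U)=\partial F/\partial U$, and let $r_k=(1,\lambda_k,\lambda_k^2)^T$. Put $u=E_1/E_0$ and $p=E_2-E_1^2/E_0$. Speeds are measured in units of $c$. States $U^L,U^R$ are *connected by a $k$-rarefaction wave* if there are a $\zeta_*\in\mathbb R$, a differentiable curve $\tilde U$ in $\Omega_R$, defined on the closed interval between $0$ and $\zeta_*$, with $\tilde U(0)=U^L$ and $\tilde U(\zeta_*)=U^R$, and a nowhere vanishing scalar function $C$ of fixed sign with $\tilde U'(\zeta)=C(\zeta)\,r_k(\tilde U(\zeta))$, and if moreover $\lambda_k(U^L)<\lambda_k(U^R)$. States $U^L,U^R\in\Omega_R$ are *connected by a $k$-shock* if for some $s\in\mathbb R$ the Rankine–Hugoniot condition $F(U^R)-F(U^L)=s\,(U^R-U^L)$ and the entropy condition $\lambda_k(U^L)>s>\lambda_k(U^R)$ hold. **Theorem.** For every $U\in\Omega_R$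 the flux $F$ is differentiable at $U$, and $J(U)$ has three distinct real eigenvalues $\lambda_1(U)<\lambda_2(U)<\lambda_3(U)$ with eigenvectors $r_k(U)$, so that the notions above are well defined. Moreover: * if $U^L,U^R$ are connected by a $1$-rarefaction wave, then $E_0^L>E_0^R$, $u^L<u^R$ and $p^L>p^R$; * if $U^L,U^R$ are connected by a $3$-rarefaction wave, then $E_0^L<E_0^R$, $u^L<u^R$ and $p^L<p^R$; * if $U^L,U^R$ are connected by a $1$-shock, then $E_0^L<E_0^R$, $u^L>u^R$ and $p^L<p^R$; * if $U^L,U^R$ are connected by a $3$-shock, then $E_0^L>E_0^R$, $u^L>u^R$ and $p^L>p^R$. -/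

import Mathlib

namespace M1P2

noncomputable section

/-- The `k`-th moment `⟨I⟩_k = ∫_{-1}^1 μ^k I(μ) dμ`. -/
def moment (I : ℝ → ℝ) (k : ℕ) : ℝ := ∫ μ in (-1 : ℝ)..1, μ ^ k * I μ

/-- A state `U = (E₀, E₁, E₂)`, with `E_k = U k`. -/
abbrev State : Type := Fin 3 → ℝ

/-- The realizable domain: the triples of moments of order `0, 1, 2` of positive intensities. -/
def realizable : Set State :=
  {U | ∃ I : ℝ → ℝ, MeasureTheory.IntegrableOn I (Set.Icc (-1) 1) ∧
    (∀ μ ∈ Set.Icc (-1 : ℝ) 1, 0 < I μ) ∧ ∀ k : Fin 3, moment I k = U k}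

/-- The parameter `α` of the `M₁` weight, as a function of `(E₀, E₁)`. -/
def alpha (U : State) : ℝ :=
  -(3 * (U 1 / U 0)) / (2 + √(4 - 3 * (U 1 / U 0) ^ 2))

/-- The `M₁` weight `ε / (1 + α μ)⁴` on `[-1, 1]`, normalised to have integral `1`. -/
def weight (a μ : ℝ) : ℝ :=
  3 * (1 - a ^ 2) ^ 3 / (2 * (3 + a ^ 2)) / (1 + a * μ) ^ 4

/-- The moments of the weight with parameter `a`. -/
def wm (a : ℝ) (k : ℕ) : ℝ := moment (weight a) k

/-- The coefficient `β` of the second orthogonal polynomial. -/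
def beta (a : ℝ) : ℝ := (wm a 3 - wm a 2 * wm a 1) / (wm a 2 - wm a 1 ^ 2)

/-- The monic polynomial of degree two orthogonal to `1` and `μ` with respect to the weight. -/
def phi2 (a μ : ℝ) : ℝ := μ ^ 2 - wm a 2 - beta a * (μ - wm a 1)

/-- The expansion coefficient `f₂`. (The coefficients of lower order are `f₀ = E₀` and
`f₁ = 0`.) -/
def f2 (U : State) : ℝ :=
  (U 2 - U 0 * wm (alpha U) 2) /
    (wm (alpha U) 4 - wm (alpha U) 2 ^ 2 -
      beta (alpha U) * (wm (alpha U) 3 - wm (alpha U) 1 * wm (alpha U) 2))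

/-- The ansatz of the `M₁`-`P₂` model. -/
def ansatz (U : State) (μ : ℝ) : ℝ :=
  weight (alpha U) μ * (U 0 + f2 U * phi2 (alpha U) μ)

/-- The closed moment `E₃ = ⟨Î⟩_3`. -/
def E3 (U : State) : ℝ := moment (ansatz U) 3

/-- The flux `F(U) = (E₁, E₂, E₃(U))`. -/
def flux (U : State) : State := ![U 1, U 2, E3 U]

/-- The Jacobian matrix `∂F/∂U`. -/
def jacobian (U : State) : Matrix (Fin 3) (Fin 3) ℝ :=
  Matrix.of fun i j => fderiv ℝ flux U (Pi.single j 1) i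

/-- The characteristic speeds: the real zeros of the characteristic polynomial of the Jacobian
in increasing order. The indices `0, 1, 2` stand for the `1`-, `2`- and `3`-field. -/
def charSpeed (k : Fin 3) (U : State) : ℝ :=
  ((jacobian U).charpoly.roots.sort (· ≤ ·)).getD k 0

/-- The eigenvector `r_k = (1, λ_k, λ_k²)`. -/
def eigvec (k : Fin 3) (U : State) : State := ![1, charSpeed k U, charSpeed k U ^ 2]

/-- The left state `UL` and the right state `UR` are connected by a rarefaction wave of the
`k`-field: they lie on an integral curve of `r_k` in the realizable domain, and the
characteristic speed is larger on the right. The parameter of `UR` may have either sign. -/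
def IsRarefaction (k : Fin 3) (UL UR : State) : Prop :=
  (∃ (z : ℝ) (V : ℝ → State) (C : ℝ → ℝ), V 0 = UL ∧ V z = UR ∧
    (∀ t ∈ Set.uIcc 0 z, V t ∈ realizable) ∧
    (∀ t ∈ Set.uIcc 0 z,
      HasDerivWithinAt V (C t • eigvec k (V t)) (Set.uIcc 0 z) t) ∧
    ((∀ t ∈ Set.uIcc 0 z, 0 < C t) ∨ (∀ t ∈ Set.uIcc 0 z, C t < 0))) ∧
  charSpeed k UL < charSpeed k UR

/-- The left state `UL` and the right state `UR` in the realizable domain are connected by a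
shock of the `k`-field: the Rankine-Hugoniot condition and the entropy condition hold for some
shock speed `s`. -/
def IsShock (k : Fin 3) (UL UR : State) : Prop :=
  UL ∈ realizable ∧ UR ∈ realizable ∧
  ∃ s : ℝ, flux UR - flux UL = s • (UR - UL) ∧
    charSpeed k UR < s ∧ s < charSpeed k UL

/-- `u = E₁ / E₀`. -/
def vel (U : State) : ℝ := U 1 / U 0

/-- `p = E₂ - E₁² / E₀`. -/
def press (U : State) : ℝ := U 2 - U 1 ^ 2 / U 0

end

end M1P2

/-!
Write `x = E₁ / E₀` for the velocity and `Y = E₂ / E₀ - x²` for the spread. The closure has the form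
`E₃ = E₀ (x³ + m(x) + c(x) Y)`, and in the variable `δ = λ - x` the characteristic polynomial of the
Jacobian is the cubic

  `P(δ) = δ³ + (3 x - c) δ² - (m' + c' Y) δ - m`.

The theorem rests on two facts, proved on the whole set `0 < Y < 1 - x²` (`exists_separators`).
First, `P` is positive somewhere on the left of `δ = 0` and negative somewhere on the right; hence
there are three distinct real zeros, and the velocity lies strictly between the first and the last
characteristic speed. Second, the derivative of the characteristic polynomial at a fixed `λ` along
the direction `(1, λ, λ²)` is `-δ N(δ) / E₀` with

  `N(δ) = 2 c' δ² + (2 (3 x - c) + m'' + c'' Y) δ - 2 c' Y`,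

and `N` is positive at the first and at the last zero of `P`: these two fields are genuinely
nonlinear.

The waves follow. Along an integral curve `U' = C (1, λ, λ²)` one has `E₀' = C`,
`x' = C (λ - x) / E₀` and `p' = C (λ - x)²`, and for the first field `λ` decreases where `C > 0`;
this gives the signs in a rarefaction (`integralCurve`). For a shock of speed `s` the
Rankine-Hugoniot condition says `Uᴿ - Uᴸ = k (1, s, s²)`. On the segment between the two states the
first speed can cross the value `s` only downwards in the direction of increasing `E₀`, so the
entropy condition forces `k > 0`, and the inequalities are read off (`shock_of_sub_eq_smul`). The
reflection `E₁ ↦ -E₁` exchanges the first and the third field.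

It remains to prove the inequalities for `P` and `N`. The velocity is parametrised by
`x = 8 τ (1 + τ²) / ((3 + τ²) (1 + 3 τ²))`, which makes the moments of the weight rational in `τ`
and `artanh τ`. Replacing `artanh τ` by a tail `V` of its continued fraction (`tail`), which is
bounded and satisfies a Riccati equation, turns `m`, `c` and their derivatives into rational
functions of `τ` and `V`. By the reflection one may assume `τ ≥ 0`. For `δ > 0`, eliminating `Y`
between `P = 0` and `N` leaves a polynomial in `τ`, `V`, `δ`; for `δ < 0`, `P > 0` and `N ≥ 0` hold
at an explicit point, and `N` stays positive on its left. The polynomial inequalities so obtained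
hold on boxes in `(τ, V, δ)`; after a Möbius substitution that maps a box to the positive octant,
all coefficients are nonnegative, which is checked by reading them off from one large integer, a
Kronecker substitution. Only `c'' ≥ 0` needs more than the bounds on `V`: near `τ = 1` it uses that
`(1 - τ²) artanh³ τ` is bounded.
-/

/-! ### Certifying the sign of polynomials on boxes -/

namespace M1P2

open Polynomial

/-- Polynomial expressions with integer coefficients in three variables. -/
inductive Expr3
  | const (z : ℤ)
  | var (i : Fin 3)
  | add (e f : Expr3)
  | mul (e f : Expr3)

namespace Expr3

instance : Add Expr3 := ⟨add⟩
instance : Mul Expr3 := ⟨mul⟩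
instance : Sub Expr3 := ⟨fun e f => add e (mul (const (-1)) f)⟩
instance (n : ℕ) : OfNat Expr3 n := ⟨const n⟩

/-- Iterated product. -/
def pow (e : Expr3) : ℕ → Expr3
  | 0 => const 1
  | 1 => e
  | n + 2 => mul (pow e (n + 1)) e

instance : Pow Expr3 ℕ := ⟨pow⟩

/-- The value of an expression at a real point. -/
def ev (x : Fin 3 → ℝ) : Expr3 → ℝ
  | const z => z
  | var i => x i
  | add e f => ev x e + ev x f
  | mul e f => ev x e * ev x f

@[simp] theorem ev_add (x : Fin 3 → ℝ) (e f : Expr3) : ev x (e + f) = ev x e + ev x f := rfl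
@[simp] theorem ev_mul (x : Fin 3 → ℝ) (e f : Expr3) : ev x (e * f) = ev x e * ev x f := rfl
@[simp] theorem ev_var (x : Fin 3 → ℝ) (i : Fin 3) : ev x (var i) = x i := rfl

@[simp] theorem ev_sub (x : Fin 3 → ℝ) (e f : Expr3) : ev x (e - f) = ev x e - ev x f := by
  change ev x e + ((-1 : ℤ) : ℝ) * ev x f = _
  push_cast
  ring

@[simp] theorem ev_ofNat (x : Fin 3 → ℝ) (n : ℕ) [n.AtLeastTwo] :
    ev x (ofNat(n) : Expr3) = ofNat(n) := by
  change (((n : ℕ) : ℤ) : ℝ) = _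
  rw [Int.cast_natCast]
  rfl

@[simp] theorem ev_zero (x : Fin 3 → ℝ) : ev x (0 : Expr3) = 0 := by
  change (((0 : ℕ) : ℤ) : ℝ) = _
  simp

@[simp] theorem ev_one (x : Fin 3 → ℝ) : ev x (1 : Expr3) = 1 := by
  change (((1 : ℕ) : ℤ) : ℝ) = _
  simp

@[simp] theorem ev_pow (x : Fin 3 → ℝ) (e : Expr3) : ∀ n : ℕ, ev x (e ^ n) = ev x e ^ n
  | 0 => by
    change ((1 : ℤ) : ℝ) = _
    simp
  | 1 => by
    change ev x e = _
    simp
  | n + 2 => by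
    change ev x (e ^ (n + 1)) * ev x e = _
    rw [ev_pow x e (n + 1)]
    ring

/-- A bound for the degree in the variable `i`. -/
def deg (i : Fin 3) : Expr3 → ℕ
  | const _ => 0
  | var j => if j = i then 1 else 0
  | add e f => max (deg i e) (deg i f)
  | mul e f => deg i e + deg i f

/-- The product of the `d i ^ (k i - deg i e)`, where `k i` is the degree of `e + f`. -/
def lift {R : Type} [CommSemiring R] (d : Fin 3 → R) (e f : Expr3) : R :=
  d 0 ^ (deg 0 f - deg 0 e) * d 1 ^ (deg 1 f - deg 1 e) * d 2 ^ (deg 2 f - deg 2 e)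

/-- The homogenised value: the value at the point with coordinates `n i / d i`, multiplied
by `∏ i, d i ^ deg i e`. The integer constants are interpreted by `κ`. -/
def hom {R : Type} [CommSemiring R] (κ : ℤ → R) (n d : Fin 3 → R) : Expr3 → R
  | const z => κ z
  | var i => n i
  | add e f => hom κ n d e * lift d e f + hom κ n d f * lift d f e
  | mul e f => hom κ n d e * hom κ n d f

theorem hom_eq_ev (n d : Fin 3 → ℝ) (hd : ∀ i, d i ≠ 0) (e : Expr3) :
    hom (fun z => (z : ℝ)) n d e =
      ev (fun i => n i / d i) e * (d 0 ^ deg 0 e * d 1 ^ deg 1 e * d 2 ^ deg 2 e) := by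
  have key : ∀ (x : ℝ) (a b : ℕ), x ^ a * x ^ (b - a) = x ^ max a b := by
    intro x a b
    rw [← pow_add]
    congr 1
    omega
  induction e with
  | const z => simp [hom, ev, deg]
  | var i => fin_cases i <;> simp [hom, ev, deg, hd]
  | add e f he hf =>
    simp only [hom, ev, deg, lift, he, hf]
    rw [add_mul, ← key (d 0) (deg 0 e), ← key (d 1) (deg 1 e), ← key (d 2) (deg 2 e)]
    congr 1
    · ring
    · rw [key, key, key, max_comm (deg 0 e), max_comm (deg 1 e), max_comm (deg 2 e), ← key, ← key,
        ← key]
      ring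
  | mul e f he hf =>
    simp only [hom, ev, deg, he, hf]
    ring

theorem map_hom {R S : Type} [CommSemiring R] [CommSemiring S] (φ : R →+* S) (κ : ℤ → R)
    (n d : Fin 3 → R) (e : Expr3) :
    φ (hom κ n d e) = hom (fun z => φ (κ z)) (fun i => φ (n i)) (fun i => φ (d i)) e := by
  induction e with
  | const z => rfl
  | var i => rfl
  | add e f he hf => simp [hom, lift, he, hf]
  | mul e f he hf => simp [hom, he, hf]

end Expr3

/-- A relation compatible with the semiring operations. -/
structure SemiringRel {R S : Type} [CommSemiring R] [CommSemiring S] (ρ : R → S → Prop) :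
    Prop where
  zero : ρ 0 0
  one : ρ 1 1
  add : ∀ {a a' b b'}, ρ a b → ρ a' b' → ρ (a + a') (b + b')
  mul : ∀ {a a' b b'}, ρ a b → ρ a' b' → ρ (a * a') (b * b')

namespace SemiringRel

variable {R S : Type} [CommSemiring R] [CommSemiring S] {ρ : R → S → Prop}

theorem pow (h : SemiringRel ρ) {a : R} {b : S} (hab : ρ a b) (n : ℕ) : ρ (a ^ n) (b ^ n) := by
  induction n with
  | zero => simpa using h.one
  | succ n ih => simpa [pow_succ] using h.mul ih hab

theorem sum (h : SemiringRel ρ) {ι : Type} (s : Finset ι) {f : ι → R} {g : ι → S}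
    (hfg : ∀ i ∈ s, ρ (f i) (g i)) : ρ (∑ i ∈ s, f i) (∑ i ∈ s, g i) := by
  classical
  induction s using Finset.induction_on with
  | empty => simpa using h.zero
  | insert a s ha ih =>
    rw [Finset.sum_insert ha, Finset.sum_insert ha]
    exact h.add (hfg a (by simp)) (ih fun i hi => hfg i (by simp [hi]))

theorem hom (h : SemiringRel ρ) {κ : ℤ → R} {κ' : ℤ → S} {n d : Fin 3 → R} {n' d' : Fin 3 → S}
    (hκ : ∀ z, ρ (κ z) (κ' z)) (hn : ∀ i, ρ (n i) (n' i)) (hd : ∀ i, ρ (d i) (d' i))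
    (e : Expr3) : ρ (e.hom κ n d) (e.hom κ' n' d') := by
  induction e with
  | const z => exact hκ z
  | var i => exact hn i
  | add e f he hf =>
    refine h.add (h.mul he ?_) (h.mul hf ?_) <;>
    exact h.mul (h.mul (h.pow (hd 0) _) (h.pow (hd 1) _)) (h.pow (hd 2) _)
  | mul e f he hf => exact h.mul he hf

/-- The coefficientwise extension of a relation to polynomials. -/
def coeffwise (ρ : R → S → Prop) (p : R[X]) (q : S[X]) : Prop := ∀ i, ρ (p.coeff i) (q.coeff i)

theorem polynomial (h : SemiringRel ρ) : SemiringRel (coeffwise ρ) where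
  zero i := by simpa using h.zero
  one i := by
    rw [coeff_one, coeff_one]
    split_ifs
    exacts [h.one, h.zero]
  add ha hb i := by simpa using h.add (ha i) (hb i)
  mul ha hb i := by
    rw [coeff_mul, coeff_mul]
    exact h.sum _ fun x _ => h.mul (ha x.1) (hb x.2)

theorem coeffwise_C (h : SemiringRel ρ) {a : R} {b : S} (hab : ρ a b) :
    coeffwise ρ (C a) (C b) := by
  intro i
  rw [coeff_C, coeff_C]
  split_ifs
  exacts [hab, h.zero]

theorem coeffwise_X (h : SemiringRel ρ) : coeffwise ρ X X := by
  intro i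
  rw [coeff_X, coeff_X]
  split_ifs
  exacts [h.one, h.zero]

end SemiringRel

/-- Majorisation of values passes from coefficients to polynomials. -/
theorem abs_eval₂_le {R S : Type} [CommRing R] [CommSemiring S] {ρ : R → S → Prop}
    (φ : R →+* ℤ) (ψ : S →+* ℕ) (h : ∀ a b, ρ a b → |φ a| ≤ ψ b) (B : ℕ) {p : R[X]} {q : S[X]}
    (hpq : SemiringRel.coeffwise ρ p q) : |eval₂ φ (B : ℤ) p| ≤ (eval₂ ψ B q : ℕ) := by
  rw [eval₂_eq_sum_range' φ (lt_of_le_of_lt (le_max_left p.natDegree q.natDegree)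
      (Nat.lt_succ_self _)), eval₂_eq_sum_range' ψ (lt_of_le_of_lt
      (le_max_right p.natDegree q.natDegree) (Nat.lt_succ_self _))]
  refine (Finset.abs_sum_le_sum_abs _ _).trans ?_
  push_cast
  refine Finset.sum_le_sum fun i _ => ?_
  rw [abs_mul, abs_of_nonneg (pow_nonneg (Int.natCast_nonneg B) i)]
  exact mul_le_mul_of_nonneg_right (h _ _ (hpq i)) (by positivity)

theorem map_coeff_le_eval₂_one {S : Type} [CommSemiring S] (ψ : S →+* ℕ) (q : S[X]) (i : ℕ) :
    ψ (q.coeff i) ≤ eval₂ ψ 1 q := by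
  rw [eval₂_eq_sum_range' ψ (n := max q.natDegree i + 1) (by omega)]
  simp only [one_pow, mul_one]
  exact Finset.single_le_sum (f := fun i => ψ (q.coeff i)) (fun _ _ => Nat.zero_le _)
    (Finset.mem_range.2 (by omega))

/-- All base-`B` digits of `n` are smaller than `B / 2` and pass the test `t`, and there are at
most `k` of them. -/
def digitsTest (B : ℕ) (t : ℕ → Bool) : ℕ → ℕ → Bool
  | 0, n => n == 0
  | k + 1, n => Nat.blt (2 * (n % B)) B && (t (n % B) && digitsTest B t k (n / B))

theorem digitsTest_zero {B : ℕ} {t : ℕ → Bool} (hB : 0 < B) (ht : t 0 = true) (k : ℕ) :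
    digitsTest B t k 0 = true := by
  induction k with
  | zero => rfl
  | succ k ih => simp [digitsTest, ht, ih, Nat.blt]; omega

theorem eq_of_modEq_of_small {B : ℕ} {a b n m : ℤ} (h : a + B * n = b + B * m)
    (ha : 2 * |a| < B) (hb : 2 * |b| < B) : a = b ∧ n = m := by
  have hB : (0 : ℤ) < B := lt_of_le_of_lt (by positivity) ha
  have h1 : a - b = B * (m - n) := by linarith
  have h2 : |a - b| < B := by
    have := abs_sub a b
    linarith
  have h3 : m - n = 0 := by
    rw [h1, abs_mul, abs_of_pos hB] at h2
    by_contra h0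
    have := Int.one_le_abs h0
    nlinarith
  rw [h3] at h1
  constructor <;> linarith

/-- Kronecker substitution: if the coefficients of `p` are small compared with `B`, they can be
read off from the base-`B` digits of the value of `p` at `B`. -/
theorem coeff_of_digitsTest {R : Type} [CommRing R] (φ : R →+* ℤ) {B : ℕ} {t : ℕ → Bool}
    (ht : t 0 = true) {bd pos : R → Prop} (hbd : ∀ r, bd r → 2 * |φ r| < B) (h0 : bd 0)
    (hpos : ∀ r, bd r → ∀ n : ℕ, φ r = n → t n = true → pos r) (k n : ℕ) (p : R[X])
    (hp : ∀ i, bd (p.coeff i)) (hn : eval₂ φ (B : ℤ) p = n) (hk : digitsTest B t k n = true) :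
    ∀ i, pos (p.coeff i) := by
  have hB : 0 < B := by
    have := hbd 0 h0
    simp at this
    omega
  obtain ⟨m, hm⟩ : ∃ m, p.natDegree < m := ⟨_, Nat.lt_succ_self _⟩
  induction m generalizing p k n with
  | zero => omega
  | succ m ih =>
    -- split off the constant coefficient of `p` and the last digit of `n`
    have hq : eval₂ φ (B : ℤ) p = φ (p.coeff 0) + B * eval₂ φ (B : ℤ) p.divX := by
      conv_lhs => rw [← divX_mul_X_add p]
      rw [eval₂_add, eval₂_mul, eval₂_X, eval₂_C]
      ring
    obtain ⟨k', d, n', hd, hdn, hd1, hd2, hd3⟩ : ∃ k' d n' : ℕ, t d = true ∧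
        n = d + B * n' ∧ 2 * d < B ∧ digitsTest B t k' n' = true ∧ True := by
      cases k with
      | zero =>
        have : n = 0 := by simpa [digitsTest] using hk
        exact ⟨0, 0, 0, ht, by simp [this], by omega, digitsTest_zero hB ht 0, trivial⟩
      | succ k =>
        simp only [digitsTest, Bool.and_eq_true, Nat.blt_eq] at hk
        exact ⟨k, n % B, n / B, hk.2.1, (Nat.mod_add_div n B).symm, hk.1, hk.2.2, trivial⟩
    have hsplit := eq_of_modEq_of_small (B := B) (a := φ (p.coeff 0)) (b := d)
      (n := eval₂ φ (B : ℤ) p.divX) (m := n') (by rw [← hq, hn, hdn]; push_cast; ring)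
      (hbd _ (hp 0)) (by rw [abs_of_nonneg (Int.natCast_nonneg d)]; exact_mod_cast hd1)
    intro i
    cases i with
    | zero => exact hpos _ (hp 0) d hsplit.1 hd
    | succ i =>
      rw [← coeff_divX]
      by_cases hdeg : p.natDegree = 0
      · have : p.divX = 0 := by rw [divX_eq_zero_iff]; exact eq_C_of_natDegree_eq_zero hdeg
        have h1 := hpos 0 h0 0 (by simp) ht
        simpa [this] using h1
      · exact ih k' n' p.divX (fun i => by rw [coeff_divX]; exact hp _) hsplit.2 hd2
          (by rw [natDegree_divX_eq_natDegree_tsub_one]; omega) i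

/-- A half-open interval: `[num₀ / den₀, num₁ / den₁)`, with `num₁ / den₁ = ∞` when `den₁ = 0`. -/
structure Axis where
  num₀ : ℤ
  den₀ : ℕ
  num₁ : ℤ
  den₁ : ℕ

namespace Axis

/-- Membership in the interval. -/
def Mem (a : Axis) (x : ℝ) : Prop := a.num₀ ≤ a.den₀ * x ∧ a.den₁ * x < a.num₁

/-- The interval is the image of `[0, ∞)` under `u ↦ (num₀ + num₁ u) / (den₀ + den₁ u)`. -/
theorem Mem.exists_param {a : Axis} (ha : 0 < a.den₀) {x : ℝ} (hx : a.Mem x) :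
    ∃ u : ℝ, 0 ≤ u ∧ 0 < a.den₀ + a.den₁ * u ∧
      x = (a.num₀ + a.num₁ * u) / (a.den₀ + a.den₁ * u) := by
  obtain ⟨h1, h2⟩ := hx
  have h3 : 0 < a.num₁ - a.den₁ * x := by linarith
  have h4 : (0 : ℝ) < a.den₀ := by exact_mod_cast ha
  have hu : 0 ≤ (a.den₀ * x - a.num₀) / (a.num₁ - a.den₁ * x) := div_nonneg (by linarith) h3.le
  have h5 := div_mul_cancel₀ (a.den₀ * x - a.num₀) h3.ne'
  set u := (a.den₀ * x - a.num₀) / (a.num₁ - a.den₁ * x)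
  have h6 : 0 < a.den₀ + a.den₁ * u := by positivity
  refine ⟨u, hu, h6, ?_⟩
  rw [eq_div_iff h6.ne']
  linear_combination -h5

end Axis

/-- A product of three intervals. -/
structure Box where
  (x y z : Axis)

namespace Box

/-- The side in the direction `i`. -/
def side (b : Box) (i : Fin 3) : Axis := match i with
  | 0 => b.x
  | 1 => b.y
  | 2 => b.z

/-- Membership in the box. -/
def Mem (b : Box) (x : Fin 3 → ℝ) : Prop := ∀ i, (b.side i).Mem (x i)

/-- The point with coordinates `u`, `v`, `w`. -/
def point {α : Type} (u v w : α) (i : Fin 3) : α := match i with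
  | 0 => u
  | 1 => v
  | 2 => w

/-- The integer value at `u` of the polynomial that `e` becomes in the parameters of the box. -/
def value (b : Box) (e : Expr3) (u : Fin 3 → ℕ) : ℤ :=
  e.hom id (fun i => (b.side i).num₀ + (b.side i).num₁ * (u i : ℤ))
    (fun i => ((b.side i).den₀ : ℤ) + ((b.side i).den₁ : ℤ) * (u i : ℤ))

/-- The value of a polynomial that majorises `Box.value` coefficientwise. -/
def bound (b : Box) (e : Expr3) (u : Fin 3 → ℕ) : ℕ :=
  e.hom Int.natAbs (fun i => (b.side i).num₀.natAbs + (b.side i).num₁.natAbs * u i)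
    (fun i => (b.side i).den₀ + (b.side i).den₁ * u i)

/-- The digit test for nonnegativity of the coefficients, given the bases. -/
def testAt (b : Box) (e : Expr3) (B₀ B₁ B₂ : ℕ) : Bool :=
  Nat.blt (2 * b.bound e (point 1 1 1)) B₀ && (Nat.blt (2 * b.bound e (point B₀ 1 1)) B₁ &&
    (Nat.blt (2 * b.bound e (point B₀ B₁ 1)) B₂ &&
      match b.value e (point B₀ B₁ B₂) with
      | Int.ofNat n => digitsTest B₂ (digitsTest B₁ (digitsTest B₀ (fun _ => true)
          (e.deg 0 + 1)) (e.deg 1 + 1)) (e.deg 2 + 1) n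
      | Int.negSucc _ => false))

/-- A sufficient condition for `e` to be nonnegative on the box: all coefficients of the
polynomial that `e` becomes in the parameters `u` of the three intervals are nonnegative. The
coefficients are read off from the value at powers of `2 ^ k`. -/
def test (b : Box) (k : ℕ) (e : Expr3) : Bool :=
  Nat.blt 0 b.x.den₀ && (Nat.blt 0 b.y.den₀ && (Nat.blt 0 b.z.den₀ &&
    b.testAt e (2 ^ k) ((2 ^ k) ^ (e.deg 0 + 1)) (((2 ^ k) ^ (e.deg 0 + 1)) ^ (e.deg 1 + 1))))

/-- The test for strict positivity: in addition, the lower corner has a positive value. -/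
def testPos (b : Box) (k : ℕ) (e : Expr3) : Bool :=
  b.test k e && match b.value e (point 0 0 0) with
    | Int.ofNat (_ + 1) => true
    | _ => false

noncomputable section

/-- The tower of polynomial rings in the parameters of a box. -/
abbrev Tower (R : Type) [CommSemiring R] : Type := R[X][X][X]

/-- The parameters as elements of the tower. -/
def param (R : Type) [CommSemiring R] (i : Fin 3) : Tower R := match i with
  | 0 => C (C X)
  | 1 => C X
  | 2 => X

/-- Constants of the tower. -/
def towerC (R : Type) [CommSemiring R] : R →+* Tower R := C.comp (C.comp C)

/-- Evaluation of the tower. -/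
def towerEval {R S : Type} [CommSemiring R] [CommSemiring S] (φ : R →+* S) (u : Fin 3 → S) :
    Tower R →+* S :=
  eval₂RingHom (eval₂RingHom (eval₂RingHom φ (u 0)) (u 1)) (u 2)

theorem towerEval_param {R S : Type} [CommSemiring R] [CommSemiring S] (φ : R →+* S)
    (u : Fin 3 → S) (i : Fin 3) : towerEval φ u (param R i) = u i := by
  fin_cases i <;> simp [towerEval, param]

theorem towerEval_towerC {R S : Type} [CommSemiring R] [CommSemiring S] (φ : R →+* S)
    (u : Fin 3 → S) (r : R) : towerEval φ u (towerC R r) = φ r := by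
  simp [towerEval, towerC]

/-- The polynomial that `e` becomes in the parameters of the box. -/
def poly (b : Box) (e : Expr3) : Tower ℤ :=
  e.hom (fun z => towerC ℤ z)
    (fun i => towerC ℤ (b.side i).num₀ + towerC ℤ (b.side i).num₁ * param ℤ i)
    (fun i => towerC ℤ ((b.side i).den₀ : ℤ) + towerC ℤ ((b.side i).den₁ : ℤ) * param ℤ i)

/-- A coefficientwise majorant of `Box.poly`. -/
def majorant (b : Box) (e : Expr3) : Tower ℕ :=
  e.hom (fun z => towerC ℕ z.natAbs)
    (fun i => towerC ℕ (b.side i).num₀.natAbs + towerC ℕ (b.side i).num₁.natAbs * param ℕ i)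
    (fun i => towerC ℕ (b.side i).den₀ + towerC ℕ (b.side i).den₁ * param ℕ i)

theorem towerEval_poly (b : Box) (e : Expr3) (u : Fin 3 → ℕ) :
    towerEval (RingHom.id ℤ) (fun i => (u i : ℤ)) (b.poly e) = b.value e u := by
  refine (Expr3.map_hom (R := Tower ℤ) (S := ℤ) (towerEval (RingHom.id ℤ) _) _ _ _ e).trans ?_
  simp only [value, map_add, map_mul, towerEval_towerC, towerEval_param]
  rfl

theorem towerEval_majorant (b : Box) (e : Expr3) (u : Fin 3 → ℕ) :
    towerEval (RingHom.id ℕ) u (b.majorant e) = b.bound e u := by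
  refine (Expr3.map_hom (R := Tower ℕ) (S := ℕ) (towerEval (RingHom.id ℕ) _) _ _ _ e).trans ?_
  simp only [bound, map_add, map_mul, towerEval_towerC, towerEval_param]
  rfl

/-- Majorisation of an integer by a natural number. -/
def absLe (z : ℤ) (n : ℕ) : Prop := |z| ≤ n

theorem semiringRel_absLe : SemiringRel absLe where
  zero := by simp [absLe]
  one := by simp [absLe]
  add ha hb := by
    simp only [absLe] at *
    push_cast
    exact (abs_add_le _ _).trans (add_le_add ha hb)
  mul ha hb := by
    simp only [absLe] at *
    rw [abs_mul]
    push_cast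
    exact mul_le_mul ha hb (abs_nonneg _) (by positivity)

theorem poly_majorised (b : Box) (e : Expr3) :
    SemiringRel.coeffwise (SemiringRel.coeffwise (SemiringRel.coeffwise absLe))
      (b.poly e) (b.majorant e) := by
  have h1 := semiringRel_absLe.polynomial
  have h2 := h1.polynomial
  have h3 := h2.polynomial
  have hC : ∀ z : ℤ, ∀ n : ℕ, absLe z n →
      SemiringRel.coeffwise (SemiringRel.coeffwise (SemiringRel.coeffwise absLe))
        (towerC ℤ z) (towerC ℕ n) := fun z n h =>
    h2.coeffwise_C (h1.coeffwise_C (semiringRel_absLe.coeffwise_C h))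
  have hX : ∀ i, SemiringRel.coeffwise (SemiringRel.coeffwise (SemiringRel.coeffwise absLe))
        (param ℤ i) (param ℕ i) := by
    intro i
    fin_cases i
    · exact h2.coeffwise_C (h1.coeffwise_C semiringRel_absLe.coeffwise_X)
    · exact h2.coeffwise_C h1.coeffwise_X
    · exact h2.coeffwise_X
  have hZ : ∀ z : ℤ, absLe z z.natAbs := fun z => by simp [absLe]
  have hN : ∀ n : ℕ, absLe n n := fun n => by simp [absLe]
  exact h3.hom (fun z => hC _ _ (hZ z))
    (fun i => h3.add (hC _ _ (hZ _)) (h3.mul (hC _ _ (hZ _)) (hX i)))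
    (fun i => h3.add (hC _ _ (hN _)) (h3.mul (hC _ _ (hN _)) (hX i))) e

/-- The digit test proves that all coefficients are nonnegative. -/
theorem coeff_nonneg_of_testAt {b : Box} {e : Expr3} {B₀ B₁ B₂ : ℕ}
    (h : b.testAt e B₀ B₁ B₂ = true) (i j k : ℕ) :
    0 ≤ (((b.poly e).coeff i).coeff j).coeff k := by
  simp only [testAt, Bool.and_eq_true, Nat.blt_eq] at h
  obtain ⟨h0, h1, h2, h3⟩ := h
  have hmaj := b.poly_majorised e
  rw [← towerEval_majorant] at h0 h1 h2
  set G := b.majorant e with hG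
  -- evaluations of the inner levels of the tower
  let φ₁ : ℤ[X] →+* ℤ := eval₂RingHom (RingHom.id ℤ) (B₀ : ℤ)
  let φ₂ : ℤ[X][X] →+* ℤ := eval₂RingHom φ₁ (B₁ : ℤ)
  have hval : eval₂ φ₂ (B₂ : ℤ) (b.poly e) = b.value e (point B₀ B₁ B₂) := by
    rw [← towerEval_poly]
    rfl
  let ψ₁ (u : ℕ) : ℕ[X] →+* ℕ := eval₂RingHom (RingHom.id ℕ) u
  let ψ₂ (u v : ℕ) : ℕ[X][X] →+* ℕ := eval₂RingHom (ψ₁ u) v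
  change 2 * eval₂ (ψ₂ 1 1) 1 G < _ at h0
  change 2 * eval₂ (ψ₂ B₀ 1) 1 G < _ at h1
  change 2 * eval₂ (ψ₂ B₀ B₁) 1 G < _ at h2
  have b0 : ∀ i j k, 2 * |(((b.poly e).coeff i).coeff j).coeff k| < B₀ := by
    intro i j k
    have e1 : (((G.coeff i).coeff j).coeff k) ≤ eval₂ (ψ₂ 1 1) 1 G :=
      ((map_coeff_le_eval₂_one (RingHom.id ℕ) _ k).trans
        (map_coeff_le_eval₂_one (ψ₁ 1) _ j)).trans
        (map_coeff_le_eval₂_one (S := ℕ[X][X]) (ψ₂ 1 1) G i)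
    have e2 : |(((b.poly e).coeff i).coeff j).coeff k| ≤ (((G.coeff i).coeff j).coeff k : ℕ) :=
      hmaj i j k
    omega
  have b1 : ∀ i j, 2 * |φ₁ (((b.poly e).coeff i).coeff j)| < B₁ := by
    intro i j
    have e1 : ψ₁ B₀ ((G.coeff i).coeff j) ≤ eval₂ (ψ₂ B₀ 1) 1 G :=
      (map_coeff_le_eval₂_one (ψ₁ B₀) _ j).trans
        (map_coeff_le_eval₂_one (S := ℕ[X][X]) (ψ₂ B₀ 1) G i)
    have e2 : |φ₁ (((b.poly e).coeff i).coeff j)| ≤ (ψ₁ B₀ ((G.coeff i).coeff j) : ℕ) :=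
      abs_eval₂_le (RingHom.id ℤ) (RingHom.id ℕ) (fun _ _ h => h) B₀ (hmaj i j)
    omega
  have b2 : ∀ i, 2 * |φ₂ ((b.poly e).coeff i)| < B₂ := by
    intro i
    have e1 : ψ₂ B₀ B₁ (G.coeff i) ≤ eval₂ (ψ₂ B₀ B₁) 1 G :=
      map_coeff_le_eval₂_one (S := ℕ[X][X]) (ψ₂ B₀ B₁) G i
    have e2 : |φ₂ ((b.poly e).coeff i)| ≤ (ψ₂ B₀ B₁ (G.coeff i) : ℕ) :=
      abs_eval₂_le φ₁ (ψ₁ B₀) (fun p q h => abs_eval₂_le (RingHom.id ℤ) (RingHom.id ℕ)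
        (fun _ _ h => h) B₀ h) B₁ (hmaj i)
    omega
  have p0 : 0 < B₀ := by omega
  have p1 : 0 < B₁ := by omega
  generalize hv : b.value e (point B₀ B₁ B₂) = N at h3 hval
  match N, h3 with
  | Int.ofNat n, h3 =>
    let t₀ : ℕ → Bool := fun _ => true
    let t₁ := digitsTest B₀ t₀ (e.deg 0 + 1)
    let t₂ := digitsTest B₁ t₁ (e.deg 1 + 1)
    have ht₁ : t₁ 0 = true := digitsTest_zero p0 rfl _
    have ht₂ : t₂ 0 = true := digitsTest_zero p1 ht₁ _
    let bd₀ : ℤ → Prop := fun r => 2 * |r| < B₀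
    let bd₁ : ℤ[X] → Prop := fun p => (∀ k, bd₀ (p.coeff k)) ∧ 2 * |φ₁ p| < B₁
    let bd₂ : ℤ[X][X] → Prop := fun q => (∀ j, bd₁ (q.coeff j)) ∧ 2 * |φ₂ q| < B₂
    have z0 : bd₀ 0 := by simpa [bd₀] using p0
    have z1 : bd₁ 0 := ⟨fun k => by simpa using z0, by simpa using p1⟩
    have z2 : bd₂ 0 := ⟨fun k => by simpa using z1, by simp; omega⟩
    have s1 : ∀ p, bd₁ p → ∀ n : ℕ, φ₁ p = n → t₁ n = true → ∀ k, 0 ≤ p.coeff k := by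
      intro p hp n hn ht
      exact coeff_of_digitsTest (RingHom.id ℤ) (t := t₀) rfl (bd := bd₀) (pos := fun r => 0 ≤ r)
        (fun r hr => hr) z0 (fun r _ n hn _ => by simp at hn; omega) _ n p hp.1 hn ht
    have s2 : ∀ q, bd₂ q → ∀ n : ℕ, φ₂ q = n → t₂ n = true → ∀ j k, 0 ≤ (q.coeff j).coeff k := by
      intro q hq n hn ht
      exact coeff_of_digitsTest φ₁ ht₁ (bd := bd₁) (pos := fun p => ∀ k, 0 ≤ p.coeff k)
        (fun r hr => hr.2) z1 s1 _ n q hq.1 hn ht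
    exact coeff_of_digitsTest φ₂ ht₂ (bd := bd₂) (pos := fun q => ∀ j k, 0 ≤ (q.coeff j).coeff k)
      (fun r hr => hr.2) z2 s2 _ n (b.poly e)
      (fun i => ⟨fun j => ⟨fun k => b0 i j k, b1 i j⟩, b2 i⟩) hval h3 i j k

theorem coeff_zero_le_eval₂ {R : Type} [CommRing R] (φ : R →+* ℝ) {p : R[X]} {x : ℝ}
    (hx : 0 ≤ x) (hp : ∀ i, 0 ≤ φ (p.coeff i)) : φ (p.coeff 0) ≤ eval₂ φ x p := by
  rw [eval₂_eq_sum_range]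
  refine le_trans (le_of_eq ?_) (Finset.single_le_sum (f := fun i => φ (p.coeff i) * x ^ i)
    (fun i _ => mul_nonneg (hp i) (by positivity)) (Finset.mem_range.2 (Nat.succ_pos _)))
  simp

theorem coeff_zero_le_towerEval {p : Tower ℤ} (hp : ∀ i j k, 0 ≤ ((p.coeff i).coeff j).coeff k)
    {u : Fin 3 → ℝ} (hu : ∀ i, 0 ≤ u i) :
    ((((p.coeff 0).coeff 0).coeff 0 : ℤ) : ℝ) ≤ towerEval (Int.castRingHom ℝ) u p := by
  have h1 : ∀ i j, ((((p.coeff i).coeff j).coeff 0 : ℤ) : ℝ) ≤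
      eval₂ (Int.castRingHom ℝ) (u 0) ((p.coeff i).coeff j) := fun i j =>
    coeff_zero_le_eval₂ (Int.castRingHom ℝ) (hu 0) (fun k => by simpa using hp i j k)
  have n1 : ∀ i j, 0 ≤ eval₂RingHom (Int.castRingHom ℝ) (u 0) ((p.coeff i).coeff j) := fun i j =>
    le_trans (by exact_mod_cast hp i j 0) (h1 i j)
  have h2 := fun i => coeff_zero_le_eval₂ _ (hu 1) (n1 i)
  have n2 := fun i => le_trans (n1 i 0) (h2 i)
  have h3 := coeff_zero_le_eval₂ (R := ℤ[X][X])
    (eval₂RingHom (eval₂RingHom (Int.castRingHom ℝ) (u 0)) (u 1)) (hu 2) n2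
  exact ((h1 0 0).trans (h2 0)).trans h3

/-- The two tests reduced to one inequality: up to a positive factor, the value of `e` at a point
of the box is at least its value at the lower corner. -/
theorem value_le_of_test {b : Box} {k : ℕ} {e : Expr3} (h : b.test k e = true) {x : Fin 3 → ℝ}
    (hx : b.Mem x) : ∃ D : ℝ, 0 < D ∧ 0 ≤ b.value e (point 0 0 0) ∧
      (b.value e (point 0 0 0) : ℝ) ≤ Expr3.ev x e * D := by
  simp only [test, Bool.and_eq_true, Nat.blt_eq] at h
  obtain ⟨h0, h1, h2, h3⟩ := h
  have hden : ∀ i, 0 < (b.side i).den₀ := by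
    intro i
    fin_cases i
    exacts [h0, h1, h2]
  choose u hu0 hud hux using fun i => (hx i).exists_param (hden i)
  have hnn := coeff_nonneg_of_testAt h3
  have hcorner : ((((b.poly e).coeff 0).coeff 0).coeff 0) = b.value e (point 0 0 0) := by
    have hpt : (fun i => ((point 0 0 0 i : ℕ) : ℤ)) = fun _ => 0 := by
      funext i
      fin_cases i <;> rfl
    rw [← towerEval_poly, hpt]
    simp [towerEval, coeff_zero_eq_eval_zero, eval₂_at_zero, eval₂RingHom]
  have hle := coeff_zero_le_towerEval hnn hu0
  rw [hcorner] at hle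
  have hev : towerEval (Int.castRingHom ℝ) u (b.poly e) = Expr3.hom (fun z => (z : ℝ))
      (fun i => (b.side i).num₀ + (b.side i).num₁ * u i)
      (fun i => (b.side i).den₀ + (b.side i).den₁ * u i) e := by
    refine (Expr3.map_hom (R := Tower ℤ) (S := ℝ) (towerEval (Int.castRingHom ℝ) _) _ _ _
      e).trans ?_
    simp only [map_add, map_mul, towerEval_towerC, towerEval_param]
    simp
  rw [hev, Expr3.hom_eq_ev _ _ (fun i => (hud i).ne')] at hle
  have hxe : x = fun i => ((b.side i).num₀ + (b.side i).num₁ * u i) /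
      ((b.side i).den₀ + (b.side i).den₁ * u i) := funext hux
  refine ⟨_, ?_, hcorner ▸ hnn 0 0 0, hxe ▸ hle⟩
  have := hud 0
  have := hud 1
  have := hud 2
  positivity

theorem nonneg_of_test {b : Box} {k : ℕ} {e : Expr3} (h : b.test k e = true) {x : Fin 3 → ℝ}
    (hx : b.Mem x) : 0 ≤ Expr3.ev x e := by
  obtain ⟨D, hD, h1, h2⟩ := value_le_of_test h hx
  have h3 : (0 : ℝ) ≤ b.value e (point 0 0 0) := by exact_mod_cast h1
  exact nonneg_of_mul_nonneg_left (h3.trans h2) hD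

theorem pos_of_testPos {b : Box} {k : ℕ} {e : Expr3} (h : b.testPos k e = true) {x : Fin 3 → ℝ}
    (hx : b.Mem x) : 0 < Expr3.ev x e := by
  simp only [testPos, Bool.and_eq_true] at h
  obtain ⟨D, hD, h1, h2⟩ := value_le_of_test h.1 hx
  have h3 : 0 < b.value e (point 0 0 0) := by
    rcases h1.lt_or_eq with h1 | h1
    · exact h1
    · have := h.2
      rw [← h1] at this
      cases this
  have h4 : (0 : ℝ) < b.value e (point 0 0 0) := by exact_mod_cast h3
  exact pos_of_mul_pos_left (h4.trans_le h2) hD.le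

end

end Box

end M1P2

/-! ### The polynomials of the closure -/

namespace M1P2

namespace Expr3

/-- Substitution of expressions for the variables. -/
def subst (f : Fin 3 → Expr3) : Expr3 → Expr3
  | const z => const z
  | var i => f i
  | add e g => add (subst f e) (subst f g)
  | mul e g => mul (subst f e) (subst f g)

theorem ev_subst (x : Fin 3 → ℝ) (f : Fin 3 → Expr3) (e : Expr3) :
    ev x (subst f e) = ev (fun i => ev x (f i)) e := by
  induction e with
  | const z => rfl
  | var i => rfl
  | add e g he hg => simp [subst, ev, he, hg]
  | mul e g he hg => simp [subst, ev, he, hg]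

/-- The derivation of the ring of polynomials with prescribed values on the variables. -/
def deriv (f : Fin 3 → Expr3) : Expr3 → Expr3
  | const _ => const 0
  | var i => f i
  | add e g => add (deriv f e) (deriv f g)
  | mul e g => add (mul (deriv f e) g) (mul e (deriv f g))

/-- The derivative of `e` at the point `x` in the direction `g`. -/
def dir (x g : Fin 3 → ℝ) : Expr3 → ℝ
  | const _ => 0
  | var i => g i
  | add e h => dir x g e + dir x g h
  | mul e h => dir x g e * ev x h + ev x e * dir x g h

theorem hasDerivAt_ev {x : ℝ → Fin 3 → ℝ} {g : Fin 3 → ℝ} {t : ℝ}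
    (hx : ∀ i, HasDerivAt (fun t => x t i) (g i) t) (e : Expr3) :
    HasDerivAt (fun t => ev (x t) e) (dir (x t) g e) t := by
  induction e with
  | const z => exact hasDerivAt_const t (z : ℝ)
  | var i => exact hx i
  | add e h he hh => exact he.add hh
  | mul e h he hh => exact he.mul hh

theorem ev_deriv {x g : Fin 3 → ℝ} {f : Fin 3 → Expr3} {k : ℝ}
    (h : ∀ i, ev x (f i) = k * g i) (e : Expr3) : ev x (deriv f e) = k * dir x g e := by
  induction e with
  | const z => simp [deriv, ev, dir]
  | var i => exact h i
  | add e l he hl => simp only [deriv, ev, dir, he, hl]; ring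
  | mul e l he hl => simp only [deriv, ev, dir, he, hl]; ring

theorem dir_zero (x : Fin 3 → ℝ) (e : Expr3) : dir x 0 e = 0 := by
  induction e with
  | const z => rfl
  | var i => rfl
  | add e l he hl => simp [dir, he, hl]
  | mul e l he hl => simp [dir, he, hl]

/-- Whether the variable `i` does not occur. -/
def free (i : Fin 3) : Expr3 → Bool
  | const _ => true
  | var j => j ≠ i
  | add e g => free i e && free i g
  | mul e g => free i e && free i g

theorem ev_eq_of_free {i : Fin 3} {e : Expr3} (he : free i e = true) {x y : Fin 3 → ℝ}
    (h : ∀ j, j ≠ i → x j = y j) : ev x e = ev y e := by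
  induction e with
  | const z => rfl
  | var j => exact h j (by simpa [free] using he)
  | add e g ihe ihg =>
    simp only [free, Bool.and_eq_true] at he
    simp only [ev, ihe he.1, ihg he.2]
  | mul e g ihe ihg =>
    simp only [free, Bool.and_eq_true] at he
    simp only [ev, ihe he.1, ihg he.2]

end Expr3

namespace Poly

open Expr3

/-- The variable `s`, the square of the parameter `τ`. -/
abbrev s : Expr3 := var 0
/-- The variable `v`, the tail `V` of the continued fraction of `artanh`. -/
abbrev v : Expr3 := var 1
/-- The third variable: a rescaling of `δ`, or of the spread `Y`. -/
abbrev w : Expr3 := var 2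

/-- The factor `1 - τ²`. -/
abbrev r : Expr3 := 1 - s

/-- The denominator of the velocity `x = 8 τ (1 + s) / dx`. -/
def dx : Expr3 := (3 + s) * (1 + 3 * s)

/-- The numerator of the derivative `dx/dτ = 8 r qx / dx²` of the velocity. -/
def qx : Expr3 := 3 + 2 * s + 3 * s ^ 2

/-- The numerator of `1 - x² = r² qy / dx²`. -/
def qy : Expr3 := 2 * dx + 3 * r ^ 2

/-- The denominator of `artanh τ / τ` as a rational function of `s` and `v`. -/
def dn : Expr3 := 105 - 90 * s + 9 * s ^ 2 - 15 * s * v + 9 * s ^ 2 * v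

/-- The Gram determinant of `1, μ, μ²` for the weight, up to a positive factor; it is the
denominator of `c`. -/
def eh : Expr3 := (28 - 16 * s - 4 * s * v + s ^ 2 * v) *
  (140 - 176 * s + 48 * s ^ 2 - 20 * s * v + 20 * s ^ 2 * v - 3 * s ^ 3 * v)

/-- The numerator of `c = 3 τ nh / eh`. -/
def nh : Expr3 :=
  (2688 - 4880 * s + 2800 * s ^ 2 - 512 * s ^ 3) +
  (0 - 783 + 1198 * s - 527 * s ^ 2 + 64 * s ^ 3) * (s * v) +
  (57 - 71 * s + 22 * s ^ 2 - 2 * s ^ 3) * (s ^ 2 * v ^ 2)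

/-- The numerator of `c' = 9 c1h dx² / (4 eh² qx)`. -/
def c1h : Expr3 :=
  (1756160 - 4754176 * s + 5031936 * s ^ 2 - 2603520 * s ^ 3 + 659456 * s ^ 4 - 65536 * s ^ 5) +
  (0 - 944720 + 2307760 * s - 2163648 * s ^ 2 + 968256 * s ^ 3 - 205568 * s ^ 4 +
   16384 * s ^ 5) * (s * v) +
  (189840 - 413466 * s + 338868 * s ^ 2 - 129690 * s ^ 3 + 23088 * s ^ 4 -
   1536 * s ^ 5) * (s ^ 2 * v ^ 2) +
  (0 - 16880 + 32284 * s - 22788 * s ^ 2 + 7407 * s ^ 3 - 1121 * s ^ 4 +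
   64 * s ^ 5) * (s ^ 3 * v ^ 3) +
  (560 - 922 * s + 552 * s ^ 2 - 153 * s ^ 3 + 20 * s ^ 4 - s ^ 5) * (s ^ 4 * v ^ 4)

/-- The numerator of `m = 3 τ r⁴ kh / (2 dx³ eh dn)`. -/
def kh : Expr3 :=
  (6773760 - 10293472 * s - 1122656 * s ^ 2 + 6291264 * s ^ 3 + 558400 * s ^ 4 -
   2573920 * s ^ 5 + 90144 * s ^ 6 + 497664 * s ^ 7 - 110592 * s ^ 8) +
  (0 - 2874690 + 3621036 * s + 1111650 * s ^ 2 - 2039832 * s ^ 3 - 649182 * s ^ 4 +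
   766380 * s ^ 5 + 106110 * s ^ 6 - 145152 * s ^ 7 + 20736 * s ^ 8) * (s * v) +
  (406620 - 406452 * s - 219264 * s ^ 2 + 194112 * s ^ 3 + 119964 * s ^ 4 - 63012 * s ^ 5 -
   22248 * s ^ 6 + 12312 * s ^ 7 - 1296 * s ^ 8) * (s ^ 2 * v ^ 2) +
  (0 - 19170 + 14176 * s + 11948 * s ^ 2 - 4800 * s ^ 3 - 5719 * s ^ 4 + 1180 * s ^ 5 +
   954 * s ^ 6 - 324 * s ^ 7 + 27 * s ^ 8) * (s ^ 3 * v ^ 3)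

/-- The numerator of `m' = 9 r² m1h / (4 dx² eh² qx dn)`. -/
def m1h : Expr3 :=
  (6638284800 - 176682428160 * s + 429334406144 * s ^ 2 - 238281455104 * s ^ 3 -
   187087313920 * s ^ 4 + 145374877184 * s ^ 5 + 78842442752 * s ^ 6 - 9661063168 * s ^ 7 -
   90673251328 * s ^ 8 + 31145875712 * s ^ 9 + 26421266432 * s ^ 10 - 19121926656 * s ^ 11 +
   3465400320 * s ^ 12 + 199950336 * s ^ 13 - 84934656 * s ^ 14) +
  (0 - 4908330000 + 123980893680 * s - 269975160448 * s ^ 2 + 106734161792 * s ^ 3 +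
   134877887648 * s ^ 4 - 55739596384 * s ^ 5 - 58015148608 * s ^ 6 - 15321209920 * s ^ 7 +
   56297673200 * s ^ 8 - 7429481488 * s ^ 9 - 17905572544 * s ^ 10 + 8773378368 * s ^ 11 -
   1050547968 * s ^ 12 - 133152768 * s ^ 13 + 26542080 * s ^ 14) * (s * v) +
  (1450008000 - 34763837010 * s + 66908172548 * s ^ 2 - 15300084394 * s ^ 3 -
   35681163616 * s ^ 4 + 4545148796 * s ^ 5 + 14162178776 * s ^ 6 + 9023397500 * s ^ 7 -
   12543717616 * s ^ 8 - 817167658 * s ^ 9 + 4264268612 * s ^ 10 - 1479345618 * s ^ 11 +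
   103813488 * s ^ 12 + 25477632 * s ^ 13 - 3317760 * s ^ 14) * (s ^ 2 * v ^ 2) +
  (0 - 213948000 + 4868544570 * s - 8135164070 * s ^ 2 + 421145323 * s ^ 3 + 4344264859 * s ^ 4 +
   584206240 * s ^ 5 - 1407673952 * s ^ 6 - 1669588982 * s ^ 7 + 1225841482 * s ^ 8 +
   356570686 * s ^ 9 - 456966434 * s ^ 10 + 114550707 * s ^ 11 - 3303261 * s ^ 12 -
   2144448 * s ^ 13 + 207360 * s ^ 14) * (s ^ 3 * v ^ 3) +
  (15768000 - 340520790 * s + 482238088 * s ^ 2 + 67946398 * s ^ 3 - 239636960 * s ^ 4 -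
   100019825 * s ^ 5 + 47209240 * s ^ 6 + 126290896 * s ^ 7 - 49098584 * s ^ 8 -
   31735916 * s ^ 9 + 22297648 * s ^ 10 - 4091622 * s ^ 11 - 42120 * s ^ 12 + 84267 * s ^ 13 -
   6480 * s ^ 14) * (s ^ 4 * v ^ 4) +
  (0 - 464400 + 9515310 * s - 11037134 * s ^ 2 - 3971303 * s ^ 3 + 4557583 * s ^ 4 +
   3677068 * s ^ 5 + 181696 * s ^ 6 - 3307457 * s ^ 7 + 497473 * s ^ 8 + 863167 * s ^ 9 -
   401639 * s ^ 10 + 53796 * s ^ 11 + 2916 * s ^ 12 - 1269 * s ^ 13 + 81 * s ^ 14) * (s ^ 5 * v ^ 5)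

/-- The derivation `ϑ = (1 - s) τ d/dτ`; its value on `v` is the Riccati equation of the tail. -/
def theta : Expr3 → Expr3 :=
  deriv fun i => if i = 0 then 2 * r * s else if i = 1 then 16 - (9 - s) * v + s * v ^ 2 else 0

/-- The numerator of `τ c'' = 9 c2s dx³ / (32 r² eh³ qx³)`. -/
def c2s : Expr3 :=
  theta c1h * (dx * eh * qx) + 2 * c1h * theta dx * (eh * qx) -
    c1h * dx * (2 * theta eh * qx + eh * theta qx)

/-- The numerator of `τ m'' = 9 m2s / (32 dx eh³ qx³ dn²)`. -/
def m2s : Expr3 :=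
  (theta m1h - 4 * s * m1h) * (dx * eh * qx * dn) -
    m1h * ((2 * theta dx * eh * qx + 2 * dx * theta eh * qx + dx * eh * theta qx) * dn +
      dx * eh * qx * theta dn)

/-- The numerator of `3 x - c = 3 τ gh / (dx eh)`. -/
def gh : Expr3 := 8 * (1 + s) * eh - nh * dx

/-- The numerator of `2 (3 x - c) + m''`, times `τ`. -/
def gm : Expr3 := 64 * s * gh * (eh ^ 2 * qx ^ 3 * dn ^ 2) + 3 * m2s

/-- The constant coefficient in `δ` of the polynomial that is left after `Y` has been eliminated
between the characteristic cubic and the nonlinearity factor; each of `k0`, …, `k4` is given up to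
a monomial in `τ`, `r` and `dx`. -/
def k0 : Expr3 := 864 * kh * c1h * (eh ^ 2 * qx ^ 3 * dn)
/-- The linear coefficient after elimination. -/
def k1 : Expr3 := (1296 * m1h * c1h * qx - 54 * c2s * kh) * (eh * qx * dn)
/-- The quadratic coefficient after elimination. -/
def k2 : Expr3 := 81 * (m2s * c1h - c2s * m1h * dn)
/-- The cubic coefficient after elimination. -/
def k3 : Expr3 := 144 * c1h * (9 * c1h * dx ^ 2 -
 4 * eh ^ 2 * qx) * (r ^ 2 * eh * qx ^ 2 * dn ^ 2) +
  108 * c2s * gh * (eh * qx * dn ^ 2)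
/-- The quartic coefficient after elimination. -/
def k4 : Expr3 := 36 * c2s * (eh ^ 2 * qx * dn ^ 2)
/-- The terms of degree at most three of `kw`. -/
def kw3 : Expr3 := k0 + w * (k1 + w * (k2 + s * w * k3))
/-- The eliminated polynomial in the variable `w` with `δ = τ r² w / dx`. -/
def kw : Expr3 := kw3 + s * r ^ 2 * w ^ 4 * k4

/-- The substitution `v ↦ 4 s v`, after which the bound `V < 4 s` reads `v < 1`. -/
def substY : Expr3 → Expr3 := subst fun i => if i = 0 then s else if i = 1 then 4 * s * v else w
/-- The substitution `s ↦ τ²`; the first variable now stands for `τ`. -/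
def substT : Expr3 → Expr3 := subst fun i => if i = 0 then s ^ 2 else if i = 1 then v else w

/-- The eliminated polynomial in the variables `τ`, `v` and `w = δ`, for small `τ`. -/
def ks : Expr3 :=
  substT k0 * substT r ^ 6 * var 0 ^ 2 + var 0 * (substT k1 * substT r ^ 4 * substT dx) * w +
    substT k2 * (substT r ^ 2 * substT dx ^ 2) * w ^ 2 + var 0 * substT k3 * substT dx ^ 3 * w ^ 3 +
    substT k4 * substT dx ^ 4 * w ^ 4

/-- The point `δ = -lsep / (50 dx)` on the left of the velocity, in the variables `τ`, `v` and
`w = Y / (1 - x²)`. For fixed `τ` it is affine in `w`; the coefficients are chosen so that the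
characteristic cubic and the nonlinearity factor both have the required sign there. -/
def lsep : Expr3 :=
  400 * var 0 * substT (1 + s) + substT (r ^ 2 * (1 + s) * dx) * (23 + 28 * w)

/-- The characteristic cubic at the separating point, up to a positive factor. -/
def pl : Expr3 :=
  substT (eh * qx * dn) * lsep ^ 2 * (600 * var 0 * substT gh - 4 * lsep * substT eh) +
   substT (r ^ 2) * (22500 * lsep * (substT m1h + w * substT (c1h * qy * dx ^ 2 * dn)) -
     750000 * var 0 * substT (r ^ 2 * kh * eh * qx))

/-- The nonlinearity factor at the separating point, up to a positive factor and times `τ`. -/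
def nl : Expr3 :=
  144 * var 0 * substT (c1h * dx ^ 2 * eh * qx ^ 2 * dn ^ 2) *
    (lsep ^ 2 - 2500 * w * substT (r ^ 2 * qy)) -
  50 * lsep * (substT (192 * s * gh * (eh ^ 2 * qx ^ 3 * dn ^ 2) + 9 * m2s) +
    9 * w * substT (c2s * dx ^ 2 * qy * dn ^ 2))

end Poly
end M1P2

/-! ### Sign certificates -/

namespace M1P2.Poly

open Expr3 Box

section

variable {s₀ v₀ w₀ : ℝ}

/-- The box `0 ≤ s < 1`, `16/9 ≤ v < 4`, `0 ≤ w < 1`. -/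
def baseBox : Box := ⟨⟨0, 1, 1, 1⟩, ⟨16, 9, 4, 1⟩, ⟨0, 1, 1, 1⟩⟩

theorem mem_baseBox (hs : 0 ≤ s₀) (hs' : s₀ < 1) (hv : 16 / 9 ≤ v₀) (hv' : v₀ < 4) :
    baseBox.Mem (point s₀ v₀ 0) := by
  intro i
  fin_cases i <;> simp [baseBox, side, Axis.Mem, point] <;> constructor <;> linarith

theorem dn_test : baseBox.testPos 20 dn = true := by decide +kernel
theorem eh_test : baseBox.testPos 40 eh = true := by decide +kernel
theorem c1h_test : baseBox.testPos 60 c1h = true := by decide +kernel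
theorem kh_test : baseBox.testPos 60 kh = true := by decide +kernel
theorem gm_test : baseBox.test 150 gm = true := by decide +kernel

/-- The difference of the two sides of the quotient rule for `dc/dτ`; it is zero. -/
def idc : Expr3 := r * nh * eh + (theta nh * eh - nh * theta eh) - 6 * r ^ 2 * c1h

/-- The difference of the two sides of the quotient rule for `dm/dτ`; it is zero. -/
def idm : Expr3 := ((r - 8 * s) * kh + theta kh) * (dx * eh * dn) -
  kh * (3 * theta dx * eh * dn + dx * theta eh * dn + dx * eh * theta dn) - 12 * m1h * dn

-- an expression is zero if it and its negative pass the test for nonnegativity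
theorem idc_test : baseBox.test 80 idc = true := by decide +kernel
theorem idc_test' : baseBox.test 80 (0 - idc) = true := by decide +kernel
theorem idm_test : baseBox.test 120 idm = true := by decide +kernel
theorem idm_test' : baseBox.test 120 (0 - idm) = true := by decide +kernel

/-- The box `0 ≤ s < 4/5`, `16/9 ≤ v < 16/5`. -/
def boxC₁ : Box := ⟨⟨0, 1, 4, 5⟩, ⟨16, 9, 16, 5⟩, ⟨0, 1, 1, 1⟩⟩
/-- The box `4/5 ≤ s < 124/125`, `4/9 ≤ v < 1`, where `v` is `V / (4 s)`. -/
def boxC₂ : Box := ⟨⟨4, 5, 124, 125⟩, ⟨4, 9, 1, 1⟩, ⟨0, 1, 1, 1⟩⟩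
/-- The box `4/5 ≤ s < 1`, `4/9 ≤ v < 1`, where `v` is `V / (4 s)`. -/
def boxC₃ : Box := ⟨⟨4, 5, 1, 1⟩, ⟨4, 9, 1, 1⟩, ⟨0, 1, 1, 1⟩⟩
/-- A minorant of `3 c2s` where `6912 r² ≤ dn³`. -/
def c2s' : Expr3 := 3 * c2s - 32 * s * dn ^ 2 * (dn ^ 3 - 6912 * r ^ 2)

theorem c2s_test₁ : boxC₁.test 140 c2s = true := by decide +kernel
theorem c2s_test₂ : boxC₂.test 280 (substY c2s) = true := by decide +kernel
theorem c2s_test₃ : boxC₃.test 160 (substY c2s') = true := by decide +kernel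

/-- The box `1/10 ≤ s < 4/5`, `16/9 ≤ v < 16/5`, `a/b ≤ w < c/d`, unbounded in `w` if `d = 0`. -/
def boxK (a : ℤ) (b : ℕ) (c : ℤ) (d : ℕ) : Box := ⟨⟨1, 10, 4, 5⟩, ⟨16, 9, 16, 5⟩, ⟨a, b, c, d⟩⟩
/-- The box `4/5 ≤ s < 1`, `4/9 ≤ v < 1`, `a/b ≤ w < c/d`, where `v` is `V / (4 s)`. -/
def boxY (a : ℤ) (b : ℕ) (c : ℤ) (d : ℕ) : Box := ⟨⟨4, 5, 1, 1⟩, ⟨4, 9, 1, 1⟩, ⟨a, b, c, d⟩⟩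
/-- The box `0 ≤ τ < 7/20`, `16/9 ≤ v < 16/5`, `a/b ≤ w < c/d`. -/
def boxS (a : ℤ) (b : ℕ) (c : ℤ) (d : ℕ) : Box := ⟨⟨0, 1, 7, 20⟩, ⟨16, 9, 16, 5⟩, ⟨a, b, c, d⟩⟩

theorem kw_test₁ : (boxK 0 1 27 20).testPos 330 kw = true := by decide +kernel
theorem kw_test₂ : (boxK 27 20 9 2).testPos 330 kw = true := by decide +kernel
theorem kw_test₃ : (boxK 9 2 1 0).testPos 330 kw = true := by decide +kernel
theorem kw3_test₁ : (boxY 0 1 1 1).testPos 300 (substY kw3) = true := by decide +kernel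
theorem kw3_test₂ : (boxY 1 1 1 0).testPos 300 (substY kw3) = true := by decide +kernel
theorem ks_test₁ : (boxS 0 1 3 10).test 570 (ks - var 0 * w) = true := by decide +kernel
theorem ks_test₂ : (boxS 3 10 1 1).test 570 (ks - var 0 * w) = true := by decide +kernel

/-- The box `a/b ≤ τ < c/d`, `16/9 ≤ v < 4`, `e/f ≤ w < g/h`. -/
def boxL (a : ℤ) (b : ℕ) (c : ℤ) (d : ℕ) (e : ℤ) (f : ℕ) (g : ℤ) (h : ℕ) : Box :=
  ⟨⟨a, b, c, d⟩, ⟨16, 9, 4, 1⟩, ⟨e, f, g, h⟩⟩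

theorem pl_test₁ : (boxL 0 1 39 40 0 1 1 1).testPos 420 pl = true := by decide +kernel
theorem pl_test₂ : (boxL 39 40 1 1 0 1 1 1).testPos 420 pl = true := by decide +kernel
theorem nl_test₁ : (boxL 0 1 1 1 0 1 1 2).test 200 nl = true := by decide +kernel
theorem nl_test₂ : (boxL 0 1 1 1 1 2 1 1).test 200 nl = true := by decide +kernel

end
end M1P2.Poly

/-! ### Rational bounds for the inverse hyperbolic tangent -/

namespace M1P2

open Real Set

noncomputable section

theorem artanh_hasDerivAt {t : ℝ} (ht : t ∈ Ioo (-1 : ℝ) 1) :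
    HasDerivAt artanh (1 / (1 - t ^ 2)) t := by
  have h1 : 0 < 1 + t := by linarith [ht.1]
  have h2 : 0 < 1 - t := by linarith [ht.2]
  have h : HasDerivAt (fun t : ℝ => 1 / 2 * (log (1 + t) - log (1 - t))) (1 / (1 - t ^ 2)) t := by
    have a := ((hasDerivAt_id t).const_add 1).log h1.ne'
    have b := ((hasDerivAt_id t).const_sub 1).log h2.ne'
    refine ((a.sub b).const_mul (1 / 2)).congr_deriv ?_
    have h3 : 1 - t ^ 2 = (1 + t) * (1 - t) := by ring
    have h4 := h1.ne'
    have h5 := h2.ne'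
    simp only [id]
    rw [h3]
    field_simp
    ring
  refine h.congr_of_eventuallyEq ?_
  filter_upwards [Ioo_mem_nhds ht.1 ht.2] with u hu
  have h3 : 1 + u ≠ 0 := by have := hu.1; intro h; linarith
  have h4 : 1 - u ≠ 0 := by have := hu.2; intro h; linarith
  rw [artanh_eq_half_log ⟨hu.1.le, hu.2.le⟩, log_div h3 h4]

theorem artanh_neg' (t : ℝ) (ht : t ∈ Ioo (-1 : ℝ) 1) : artanh (-t) = -artanh t := by
  have h1 : 1 + t ≠ 0 := by have := ht.1; intro h; linarith
  have h2 : 1 - t ≠ 0 := by have := ht.2; intro h; linarith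
  rw [artanh_eq_half_log ⟨ht.1.le, ht.2.le⟩, artanh_eq_half_log ⟨by linarith [ht.2], by
    linarith [ht.1]⟩, sub_neg_eq_add, ← sub_eq_add_neg, log_div h1 h2, log_div h2 h1]
  ring

theorem pos_of_hasDerivAt_pos {f f' : ℝ → ℝ} (h0 : f 0 = 0)
    (hf : ∀ t ∈ Ico (0 : ℝ) 1, HasDerivAt f (f' t) t) (hf' : ∀ t ∈ Ioo (0 : ℝ) 1, 0 < f' t)
    {t : ℝ} (ht : t ∈ Ioo (0 : ℝ) 1) : 0 < f t := by
  have hmono : StrictMonoOn f (Icc 0 t) := by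
    refine strictMonoOn_of_deriv_pos (convex_Icc 0 t) (fun x hx => (hf x ⟨hx.1,
      hx.2.trans_lt ht.2⟩).continuousAt.continuousWithinAt) fun x hx => ?_
    rw [interior_Icc] at hx
    rw [(hf x ⟨hx.1.le, hx.2.trans ht.2⟩).deriv]
    exact hf' x ⟨hx.1, hx.2.trans ht.2⟩
  have := hmono (left_mem_Icc.2 ht.1.le) (right_mem_Icc.2 ht.1.le) ht.1
  rwa [h0] at this

section bounds

variable {t : ℝ}

/-- The Padé bound behind the positivity of the denominator of `tail`. -/
theorem artanh_gt_coarse (ht : t ∈ Ioo (0 : ℝ) 1) :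
    0 < artanh t - t * (15 - 4 * t ^ 2) / (15 - 9 * t ^ 2) := by
  refine pos_of_hasDerivAt_pos (f := fun t => artanh t - t * (15 - 4 * t ^ 2) / (15 - 9 * t ^ 2))
    (f' := fun t => 36 * t ^ 6 / ((1 - t ^ 2) * (15 - 9 * t ^ 2) ^ 2)) (by simp) ?_ ?_ ht
  · intro t ht
    have h1 : 0 < 1 - t ^ 2 := by nlinarith [ht.1, ht.2]
    have h2 : 0 < 15 - 9 * t ^ 2 := by nlinarith
    have hn : HasDerivAt (fun t : ℝ => t * (15 - 4 * t ^ 2)) (15 - 12 * t ^ 2) t := by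
      convert! (hasDerivAt_id t).mul (((hasDerivAt_pow 2 t).const_mul 4).const_sub 15) using 1
      simp
      ring
    have hd : HasDerivAt (fun t : ℝ => 15 - 9 * t ^ 2) (-18 * t) t := by
      convert! ((hasDerivAt_pow 2 t).const_mul 9).const_sub 15 using 1
      simp
      ring
    refine ((artanh_hasDerivAt ⟨by linarith [ht.1], ht.2⟩).sub
      (hn.div hd h2.ne')).congr_deriv ?_
    have h3 := h1.ne'
    have h4 := h2.ne'
    rw [div_sub_div _ _ h3 (pow_ne_zero 2 h4)]
    congr 1
    ring
  · intro t ht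
    have h1 : 0 < 1 - t ^ 2 := by nlinarith [ht.1, ht.2]
    have h2 : 0 < 15 - 9 * t ^ 2 := by nlinarith
    have := ht.1
    positivity

/-- The Padé bound that amounts to `16 / 9 < tail t`. -/
theorem artanh_gt_fine (ht : t ∈ Ioo (0 : ℝ) 1) :
    0 < artanh t - t * (945 - 735 * t ^ 2 + 64 * t ^ 4) / (945 - 1050 * t ^ 2 + 225 * t ^ 4) := by
  have key : ∀ t ∈ Ico (0 : ℝ) 1, 0 < 945 - 1050 * t ^ 2 + 225 * t ^ 4 := by
    intro t ht
    have h1 : 0 < 1 - t ^ 2 := by nlinarith [ht.1, ht.2]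
    nlinarith [mul_pos h1 h1]
  refine pos_of_hasDerivAt_pos
    (f := fun t => artanh t - t * (945 - 735 * t ^ 2 + 64 * t ^ 4) /
      (945 - 1050 * t ^ 2 + 225 * t ^ 4))
    (f' := fun t => 14400 * t ^ 10 / ((1 - t ^ 2) * (945 - 1050 * t ^ 2 + 225 * t ^ 4) ^ 2))
    (by simp) ?_ ?_ ht
  · intro t ht
    have h1 : 0 < 1 - t ^ 2 := by nlinarith [ht.1, ht.2]
    have h2 := key t ht
    have hn : HasDerivAt (fun t : ℝ => t * (945 - 735 * t ^ 2 + 64 * t ^ 4))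
        (945 - 2205 * t ^ 2 + 320 * t ^ 4) t := by
      convert! (hasDerivAt_id t).mul ((((hasDerivAt_pow 2 t).const_mul 735).const_sub 945).add
        ((hasDerivAt_pow 4 t).const_mul 64)) using 1
      simp
      ring
    have hd : HasDerivAt (fun t : ℝ => 945 - 1050 * t ^ 2 + 225 * t ^ 4)
        (-2100 * t + 900 * t ^ 3) t := by
      convert! (((hasDerivAt_pow 2 t).const_mul 1050).const_sub 945).add
        ((hasDerivAt_pow 4 t).const_mul 225) using 1
      simp
      ring
    refine ((artanh_hasDerivAt ⟨by linarith [ht.1], ht.2⟩).sub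
      (hn.div hd h2.ne')).congr_deriv ?_
    have h3 := h1.ne'
    have h4 := h2.ne'
    rw [div_sub_div _ _ h3 (pow_ne_zero 2 h4)]
    congr 1
    ring
  · intro t ht
    have h1 : 0 < 1 - t ^ 2 := by nlinarith [ht.1, ht.2]
    have h2 := key t ⟨ht.1.le, ht.2⟩
    have := ht.1
    positivity

/-- The Padé-type bound that amounts to `tail t < 16 / (9 - 5 t²)`. -/
theorem artanh_lt_rational (ht : t ∈ Ioo (0 : ℝ) 1) :
    0 < t * (945 - 1260 * t ^ 2 + 339 * t ^ 4) /
      (45 * (1 - t ^ 2) * (21 - 14 * t ^ 2 + t ^ 4)) - artanh t := by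
  have key : ∀ t ∈ Ico (0 : ℝ) 1, 0 < 21 - 14 * t ^ 2 + t ^ 4 := by
    intro t ht
    have h1 : 0 < 1 - t ^ 2 := by nlinarith [ht.1, ht.2]
    nlinarith [mul_pos h1 h1]
  refine pos_of_hasDerivAt_pos
    (f := fun t => t * (945 - 1260 * t ^ 2 + 339 * t ^ 4) /
      (45 * (1 - t ^ 2) * (21 - 14 * t ^ 2 + t ^ 4)) - artanh t)
    (f' := fun t => 17280 * t ^ 10 * (1 - t ^ 2) /
      ((45 * (1 - t ^ 2) * (21 - 14 * t ^ 2 + t ^ 4)) ^ 2 * (1 - t ^ 2)))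
    (by simp) ?_ ?_ ht
  · intro t ht
    have h1 : 0 < 1 - t ^ 2 := by nlinarith [ht.1, ht.2]
    have h2 := key t ht
    have hn : HasDerivAt (fun t : ℝ => t * (945 - 1260 * t ^ 2 + 339 * t ^ 4))
        (945 - 3780 * t ^ 2 + 1695 * t ^ 4) t := by
      convert! (hasDerivAt_id t).mul ((((hasDerivAt_pow 2 t).const_mul 1260).const_sub 945).add
        ((hasDerivAt_pow 4 t).const_mul 339)) using 1
      simp
      ring
    have hd : HasDerivAt (fun t : ℝ => 45 * (1 - t ^ 2) * (21 - 14 * t ^ 2 + t ^ 4))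
        (-3150 * t + 2700 * t ^ 3 - 270 * t ^ 5) t := by
      convert! (((hasDerivAt_pow 2 t).const_sub 1).const_mul 45).mul
        ((((hasDerivAt_pow 2 t).const_mul 14).const_sub 21).add (hasDerivAt_pow 4 t)) using 1
      simp
      ring
    refine ((hn.div hd (by positivity)).sub
      (artanh_hasDerivAt ⟨by linarith [ht.1], ht.2⟩)).congr_deriv ?_
    have h4 := h1.ne'
    have h5 := h2.ne'
    rw [div_sub_div _ _ (by positivity) h4]
    congr 1
    ring
  · intro t ht
    have h1 : 0 < 1 - t ^ 2 := by nlinarith [ht.1, ht.2]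
    have h2 := key t ⟨ht.1.le, ht.2⟩
    have := ht.1
    positivity

end bounds

end
end M1P2

/-! ### The tail of the continued fraction -/

namespace M1P2

open Real Set Filter Topology

noncomputable section

/-- The function `V` of `τ ∈ (-1, 1)` with
`artanh τ = τ (105 - 55 s - (15 - 4 s) s V) / (105 - 90 s + 9 s² - (15 - 9 s) s V)`, `s = τ²`.
It is the third tail of the continued fraction of `artanh`; replacing `artanh τ` by the bounded
quantity `V` removes all cancellations at `τ = 0`. -/
def tail (τ : ℝ) : ℝ :=
  if τ = 0 then 16 / 9 else
    ((105 - 90 * τ ^ 2 + 9 * τ ^ 4) * artanh τ - (105 - 55 * τ ^ 2) * τ) /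
      (τ ^ 2 * ((15 - 9 * τ ^ 2) * artanh τ - (15 - 4 * τ ^ 2) * τ))

theorem tail_zero : tail 0 = 16 / 9 := if_pos rfl

theorem tail_of_ne {τ : ℝ} (h : τ ≠ 0) : tail τ =
    ((105 - 90 * τ ^ 2 + 9 * τ ^ 4) * artanh τ - (105 - 55 * τ ^ 2) * τ) /
      (τ ^ 2 * ((15 - 9 * τ ^ 2) * artanh τ - (15 - 4 * τ ^ 2) * τ)) := if_neg h

theorem tail_neg {τ : ℝ} (h : τ ∈ Ioo (-1 : ℝ) 1) : tail (-τ) = tail τ := by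
  by_cases h0 : τ = 0
  · simp [h0]
  · rw [tail_of_ne h0, tail_of_ne (neg_ne_zero.2 h0), artanh_neg' τ h, ← neg_div_neg_eq]
    ring_nf

variable {τ : ℝ}

theorem tail_den_pos (h : τ ∈ Ioo (0 : ℝ) 1) :
    0 < (15 - 9 * τ ^ 2) * artanh τ - (15 - 4 * τ ^ 2) * τ := by
  have h1 := artanh_gt_coarse h
  have h2 : 0 < 15 - 9 * τ ^ 2 := by nlinarith [h.1, h.2]
  rw [sub_pos, div_lt_iff₀ h2] at h1
  linarith

theorem tail_den_ne (h : τ ∈ Ioo (-1 : ℝ) 1) (h0 : τ ≠ 0) :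
    (15 - 9 * τ ^ 2) * artanh τ - (15 - 4 * τ ^ 2) * τ ≠ 0 := by
  rcases lt_or_gt_of_ne h0 with h1 | h1
  · have := tail_den_pos (τ := -τ) ⟨by linarith, by linarith [h.1]⟩
    rw [artanh_neg' τ h] at this
    intro h2
    nlinarith
  · exact (tail_den_pos ⟨h1, h.2⟩).ne'

theorem tail_gt_of_pos (h : τ ∈ Ioo (0 : ℝ) 1) : 16 / 9 < tail τ := by
  have h1 := artanh_gt_fine h
  have hs : τ ^ 2 < 1 := by nlinarith [h.1, h.2]
  have h2 : 0 < 945 - 1050 * τ ^ 2 + 225 * τ ^ 4 := by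
    nlinarith [mul_pos (sub_pos.2 hs) (sub_pos.2 hs)]
  rw [sub_pos, div_lt_iff₀ h2] at h1
  have h3 := tail_den_pos h
  rw [tail_of_ne h.1.ne', div_lt_div_iff₀ (by norm_num) (mul_pos (pow_pos h.1 2) h3)]
  nlinarith

theorem tail_lt_of_pos (h : τ ∈ Ioo (0 : ℝ) 1) : tail τ < 16 / (9 - 5 * τ ^ 2) := by
  have h1 := artanh_lt_rational h
  have hs : 0 < 1 - τ ^ 2 := by nlinarith [h.1, h.2]
  have h2 : 0 < 45 * (1 - τ ^ 2) * (21 - 14 * τ ^ 2 + τ ^ 4) := by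
    have : 0 < 21 - 14 * τ ^ 2 + τ ^ 4 := by nlinarith [sq_nonneg (τ ^ 2)]
    positivity
  rw [sub_pos, lt_div_iff₀ h2] at h1
  have h3 := tail_den_pos h
  rw [tail_of_ne h.1.ne', div_lt_div_iff₀ (mul_pos (pow_pos h.1 2) h3) (by linarith)]
  linarith

theorem tail_mem (h : τ ∈ Ioo (-1 : ℝ) 1) : 16 / 9 ≤ tail τ ∧ tail τ ≤ 16 / (9 - 5 * τ ^ 2) := by
  rcases lt_trichotomy τ 0 with h1 | h1 | h1
  · have h2 : -τ ∈ Ioo (0 : ℝ) 1 := ⟨by linarith, by linarith [h.1]⟩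
    have h3 := tail_gt_of_pos h2
    have h4 := tail_lt_of_pos h2
    rw [tail_neg h] at h3 h4
    rw [neg_sq] at h4
    exact ⟨h3.le, h4.le⟩
  · subst h1
    rw [tail_zero]
    norm_num
  · exact ⟨(tail_gt_of_pos ⟨h1, h.2⟩).le, (tail_lt_of_pos ⟨h1, h.2⟩).le⟩

/-- The relation defining the tail. -/
theorem tail_relation (h : τ ∈ Ioo (-1 : ℝ) 1) :
    (105 - 90 * τ ^ 2 + 9 * τ ^ 4 - (15 - 9 * τ ^ 2) * τ ^ 2 * tail τ) * artanh τ =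
      τ * (105 - 55 * τ ^ 2 - (15 - 4 * τ ^ 2) * τ ^ 2 * tail τ) := by
  by_cases h0 : τ = 0
  · simp [h0]
  · have h1 := tail_den_ne h h0
    have h2 : tail τ * (τ ^ 2 * ((15 - 9 * τ ^ 2) * artanh τ - (15 - 4 * τ ^ 2) * τ)) =
        (105 - 90 * τ ^ 2 + 9 * τ ^ 4) * artanh τ - (105 - 55 * τ ^ 2) * τ := by
      rw [tail_of_ne h0]
      exact div_mul_cancel₀ _ (mul_ne_zero (pow_ne_zero 2 h0) h1)
    linear_combination -h2

/-- The derivative of the tail; it satisfies a Riccati equation. -/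
def tail' (τ : ℝ) : ℝ :=
  if τ = 0 then 0 else (16 - (9 - τ ^ 2) * tail τ + τ ^ 2 * tail τ ^ 2) / (τ * (1 - τ ^ 2))

theorem mul_tail' (h : τ ∈ Ioo (-1 : ℝ) 1) :
    τ * (1 - τ ^ 2) * tail' τ = 16 - (9 - τ ^ 2) * tail τ + τ ^ 2 * tail τ ^ 2 := by
  by_cases h0 : τ = 0
  · subst h0
    rw [tail_zero]
    norm_num
  · rw [tail', if_neg h0]
    have : 1 - τ ^ 2 ≠ 0 := by nlinarith [h.1, h.2]
    field_simp

theorem tail_hasDerivAt (h : τ ∈ Ioo (-1 : ℝ) 1) : HasDerivAt tail (tail' τ) τ := by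
  by_cases h0 : τ = 0
  · -- at `0` the two-sided bound `16 / 9 ≤ tail ≤ 16 / (9 - 5 t²)` gives the derivative `0`
    subst h0
    rw [tail', if_pos rfl]
    rw [hasDerivAt_iff_isLittleO_nhds_zero]
    refine Asymptotics.IsBigO.trans_isLittleO (g := fun t : ℝ => t ^ 2) ?_ ?_
    · refine Asymptotics.IsBigO.of_bound (20 / 9) ?_
      filter_upwards [Ioo_mem_nhds h.1 h.2] with t ht
      obtain ⟨h1, h2⟩ := tail_mem ht
      have hs : t ^ 2 < 1 := by nlinarith [ht.1, ht.2]
      have h3 : 16 / (9 - 5 * t ^ 2) ≤ 16 / 9 + 20 / 9 * t ^ 2 := by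
        rw [div_le_iff₀ (by linarith)]
        nlinarith [mul_nonneg (sq_nonneg t) (sub_nonneg.2 hs.le)]
      simp only [zero_add, tail_zero, smul_zero, sub_zero, norm_eq_abs]
      rw [abs_of_nonneg (by linarith), abs_of_nonneg (sq_nonneg t)]
      linarith
    · simpa using Asymptotics.isLittleO_pow_pow (𝕜 := ℝ) (m := 1) (n := 2) (by norm_num)
  · have h1 := tail_den_ne h h0
    have hr : 1 - τ ^ 2 ≠ 0 := by nlinarith [h.1, h.2]
    have hL := artanh_hasDerivAt h
    have hd : HasDerivAt (fun τ : ℝ => τ ^ 2 * ((15 - 9 * τ ^ 2) * artanh τ - (15 - 4 * τ ^ 2) * τ))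
        (2 * τ * ((15 - 9 * τ ^ 2) * artanh τ - (15 - 4 * τ ^ 2) * τ) +
          τ ^ 2 * (-18 * τ * artanh τ + (15 - 9 * τ ^ 2) * (1 / (1 - τ ^ 2)) - (15 - 12 * τ ^ 2)))
        τ := by
      convert! (hasDerivAt_pow 2 τ).mul ((((hasDerivAt_pow 2 τ).const_mul 9).const_sub 15).mul
        hL |>.sub ((((hasDerivAt_pow 2 τ).const_mul 4).const_sub 15).mul (hasDerivAt_id τ))) using 1
      simp
      left
      ring
    have hn : HasDerivAt
        (fun τ : ℝ => (105 - 90 * τ ^ 2 + 9 * τ ^ 4) * artanh τ - (105 - 55 * τ ^ 2) * τ)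
        ((-180 * τ + 36 * τ ^ 3) * artanh τ + (105 - 90 * τ ^ 2 + 9 * τ ^ 4) * (1 / (1 - τ ^ 2)) -
          (105 - 165 * τ ^ 2)) τ := by
      convert! ((((hasDerivAt_pow 2 τ).const_mul 90).const_sub 105).add
        ((hasDerivAt_pow 4 τ).const_mul 9)).mul hL |>.sub
        ((((hasDerivAt_pow 2 τ).const_mul 55).const_sub 105).mul (hasDerivAt_id τ)) using 1
      simp
      ring
    have hD : τ ^ 2 * ((15 - 9 * τ ^ 2) * artanh τ - (15 - 4 * τ ^ 2) * τ) ≠ 0 :=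
      mul_ne_zero (pow_ne_zero 2 h0) h1
    refine ((hn.div hd hD).congr_of_eventuallyEq ?_).congr_deriv ?_
    · filter_upwards [isOpen_ne.mem_nhds h0] with t ht using tail_of_ne ht
    · rw [tail', if_neg h0, tail_of_ne h0]
      set L := artanh τ
      have hτ : τ ^ 2 ≠ 0 := pow_ne_zero 2 h0
      generalize hE : (15 - 9 * τ ^ 2) * L - (15 - 4 * τ ^ 2) * τ = E at *
      field_simp
      rw [← hE]
      ring

theorem tail'_zero : tail' 0 = 0 := if_pos rfl

/-- It follows from `l³ / 3! ≤ exp l` with `l = 2 artanh τ`. -/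
theorem artanh_pow_three_mul_le (h : τ ∈ Ico (0 : ℝ) 1) : artanh τ ^ 3 * (1 - τ ^ 2) ≤ 3 := by
  have h1 : 0 < 1 - τ := by linarith [h.2]
  have h2 : 0 < 1 + τ := by linarith [h.1]
  have hy : 1 ≤ (1 + τ) / (1 - τ) := by
    rw [le_div_iff₀ h1]
    linarith [h.1]
  have h3 := pow_div_factorial_le_exp _ (log_nonneg hy) 3
  rw [exp_log (by linarith), le_div_iff₀ h1] at h3
  rw [artanh_eq_half_log ⟨by linarith [h.1], h.2.le⟩]
  set l := log ((1 + τ) / (1 - τ))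
  norm_num [Nat.factorial] at h3
  have h4 : l ^ 3 * (1 - τ) * (1 + τ) ≤ 6 * (1 + τ) * (1 + τ) := by
    refine mul_le_mul_of_nonneg_right ?_ h2.le
    linarith
  nlinarith [h.1, h.2]

end
end M1P2

/-! ### Polynomials along the tail -/

namespace M1P2

open Real Set M1P2.Poly Expr3 Box

noncomputable section

/-- The value of a polynomial at `s = τ²`, `v = tail τ`. -/
def val (e : Expr3) (τ : ℝ) : ℝ := ev (point (τ ^ 2) (tail τ) 0) e

/-- The derivative of `val e`. -/
def dval (e : Expr3) (τ : ℝ) : ℝ := dir (point (τ ^ 2) (tail τ) 0) (point (2 * τ) (tail' τ) 0) e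

variable {τ : ℝ}

theorem val_hasDerivAt (h : τ ∈ Ioo (-1 : ℝ) 1) (e : Expr3) : HasDerivAt (val e) (dval e τ) τ := by
  refine hasDerivAt_ev (x := fun τ => point (τ ^ 2) (tail τ) 0) (fun i => ?_) e
  fin_cases i
  · simpa [point] using hasDerivAt_pow 2 τ
  · exact tail_hasDerivAt h
  · exact hasDerivAt_const τ 0

theorem val_theta (h : τ ∈ Ioo (-1 : ℝ) 1) (e : Expr3) :
    val (theta e) τ = τ * (1 - τ ^ 2) * dval e τ := by
  refine ev_deriv (fun i => ?_) e
  fin_cases i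
  · simp [point]
    ring
  · simp [point, mul_tail' h]
  · simp [point]

theorem dval_zero (e : Expr3) : dval e 0 = 0 := by
  have : (point (2 * 0) (tail' 0) 0 : Fin 3 → ℝ) = 0 := by
    funext i
    fin_cases i <;> simp [point, tail'_zero]
  rw [dval, this, dir_zero]

theorem val_neg (h : τ ∈ Ioo (-1 : ℝ) 1) (e : Expr3) : val e (-τ) = val e τ := by
  rw [val, tail_neg h, neg_sq, val]

@[simp] theorem val_add (e g : Expr3) : val (e + g) τ = val e τ + val g τ := ev_add _ _ _
@[simp] theorem val_sub (e g : Expr3) : val (e - g) τ = val e τ - val g τ := ev_sub _ _ _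
@[simp] theorem val_mul (e g : Expr3) : val (e * g) τ = val e τ * val g τ := ev_mul _ _ _
@[simp] theorem val_pow (e : Expr3) (n : ℕ) : val (e ^ n) τ = val e τ ^ n := ev_pow _ _ _
@[simp] theorem val_ofNat (n : ℕ) [n.AtLeastTwo] : val (ofNat(n) : Expr3) τ = ofNat(n) :=
  ev_ofNat _ _
@[simp] theorem val_one : val 1 τ = 1 := ev_one _
@[simp] theorem val_s : val s τ = τ ^ 2 := rfl

theorem ev_eq_val {e : Expr3} (he : free 2 e = true) (w : ℝ) :
    ev (point (τ ^ 2) (tail τ) w) e = val e τ := by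
  refine ev_eq_of_free he fun j hj => ?_
  fin_cases j <;> first | rfl | exact absurd rfl hj

theorem ev_substT {e : Expr3} (he : free 2 e = true) (t w : ℝ) :
    ev (point t (tail t) w) (substT e) = val e t := by
  rw [substT, ev_subst, val]
  refine ev_eq_of_free he fun j hj => ?_
  fin_cases j
  · simp [point]
  · simp [point]
  · exact absurd rfl hj

section range

variable (h : τ ∈ Ico (0 : ℝ) 1)
include h

theorem sq_mem : 0 ≤ τ ^ 2 ∧ τ ^ 2 < 1 := ⟨sq_nonneg τ, by nlinarith [h.1, h.2]⟩

theorem tail_bounds : 16 / 9 ≤ tail τ ∧ tail τ < 4 := by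
  obtain ⟨h1, h2⟩ := tail_mem (τ := τ) ⟨by linarith [h.1], h.2⟩
  refine ⟨h1, h2.trans_lt ?_⟩
  have := (sq_mem h).2
  rw [div_lt_iff₀ (by linarith)]
  linarith

theorem tail_lt_of_sq_lt (hs : τ ^ 2 < 4 / 5) : tail τ < 16 / 5 := by
  obtain ⟨-, h2⟩ := tail_mem (τ := τ) ⟨by linarith [h.1], h.2⟩
  refine h2.trans_lt ?_
  rw [div_lt_iff₀ (by linarith)]
  linarith

theorem tail_lt_of_le_sq (hs : 4 / 5 ≤ τ ^ 2) : tail τ < 4 * τ ^ 2 := by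
  have h0 : 0 < τ := by
    refine lt_of_le_of_ne h.1 fun h0 => ?_
    rw [← h0] at hs
    norm_num at hs
  refine (tail_lt_of_pos ⟨h0, h.2⟩).trans_le ?_
  have := (sq_mem h).2
  rw [div_le_iff₀ (by linarith)]
  nlinarith

theorem mem_baseBox_tail : baseBox.Mem (point (τ ^ 2) (tail τ) 0) :=
  mem_baseBox (sq_mem h).1 (sq_mem h).2 (tail_bounds h).1 (tail_bounds h).2

theorem val_dn_pos : 0 < val dn τ := pos_of_testPos dn_test (mem_baseBox_tail h)
theorem val_eh_pos : 0 < val eh τ := pos_of_testPos eh_test (mem_baseBox_tail h)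
theorem val_c1h_pos : 0 < val c1h τ := pos_of_testPos c1h_test (mem_baseBox_tail h)
theorem val_kh_pos : 0 < val kh τ := pos_of_testPos kh_test (mem_baseBox_tail h)
theorem val_gm_nonneg : 0 ≤ val gm τ := nonneg_of_test gm_test (mem_baseBox_tail h)

theorem val_idc : val idc τ = 0 := by
  have h1 := nonneg_of_test idc_test (mem_baseBox_tail h)
  have h2 := nonneg_of_test idc_test' (mem_baseBox_tail h)
  rw [ev_sub, ev_zero] at h2
  exact le_antisymm (sub_nonneg.1 h2) h1

theorem val_idm : val idm τ = 0 := by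
  have h1 := nonneg_of_test idm_test (mem_baseBox_tail h)
  have h2 := nonneg_of_test idm_test' (mem_baseBox_tail h)
  rw [ev_sub, ev_zero] at h2
  exact le_antisymm (sub_nonneg.1 h2) h1

theorem ev_substY (hs : 4 / 5 ≤ τ ^ 2) (e : Expr3) (w : ℝ) :
    ev (point (τ ^ 2) (tail τ / (4 * τ ^ 2)) w) (substY e) = ev (point (τ ^ 2) (tail τ) w) e := by
  rw [substY, ev_subst]
  congr 1
  funext j
  have : τ ≠ 0 := by
    rintro rfl
    norm_num at hs
  fin_cases j
  · simp [point]
  · simp [point]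
    field_simp
  · simp [point]

theorem y_bounds (hs : 4 / 5 ≤ τ ^ 2) :
    4 / 9 ≤ tail τ / (4 * τ ^ 2) ∧ tail τ / (4 * τ ^ 2) < 1 := by
  have h1 := (sq_mem h).2
  have h2 := tail_lt_of_le_sq h hs
  have h3 := (tail_bounds h).1
  rw [le_div_iff₀ (by linarith), div_lt_iff₀ (by linarith)]
  constructor <;> linarith

/-- Close to `τ = 1` the number `dn³` dominates `(1 - s)²`, because
`artanh³ τ (1 - s)` is bounded. -/
theorem val_dn_pow_ge (hs : 124 / 125 ≤ τ ^ 2) : 6912 * (1 - τ ^ 2) ^ 2 ≤ val dn τ ^ 3 := by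
  have h1 := (sq_mem h).2
  have h2 := tail_lt_of_le_sq h (by linarith)
  have h3 := (tail_bounds h).1
  have h4 := tail_relation (τ := τ) ⟨by linarith [h.1], h.2⟩
  have h5 := artanh_pow_three_mul_le h
  have h6 := val_dn_pos h
  have h7 : val dn τ = 105 - 90 * τ ^ 2 + 9 * τ ^ 4 - (15 - 9 * τ ^ 2) * τ ^ 2 * tail τ := by
    simp [dn, val, point]
    ring
  rw [← h7] at h4
  have h8 : 6 ≤ 105 - 55 * τ ^ 2 - (15 - 4 * τ ^ 2) * τ ^ 2 * tail τ := by
    have : (15 - 4 * τ ^ 2) * τ ^ 2 * tail τ ≤ (15 - 4 * τ ^ 2) * τ ^ 2 * (4 * τ ^ 2) := by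
      have : 0 ≤ (15 - 4 * τ ^ 2) * τ ^ 2 := by nlinarith
      gcongr
    nlinarith [mul_nonneg (sq_nonneg (τ ^ 2)) (sub_nonneg.2 h1.le)]
  have hr : 0 < 1 - τ ^ 2 := by linarith
  -- `dn artanh τ ≥ 6 τ`, hence `3 dn³ ≥ dn³ artanh³ τ (1 - s) ≥ 216 τ³ (1 - s)`
  have h9 : 6 * τ ≤ val dn τ * artanh τ := by
    rw [h4]
    nlinarith [h.1]
  have h10 : (6 * τ) ^ 3 ≤ (val dn τ * artanh τ) ^ 3 :=
    pow_le_pow_left₀ (by linarith [h.1]) h9 3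
  have h11 : (6 * τ) ^ 3 * (1 - τ ^ 2) ≤ 3 * val dn τ ^ 3 := by
    calc (6 * τ) ^ 3 * (1 - τ ^ 2) ≤ (val dn τ * artanh τ) ^ 3 * (1 - τ ^ 2) := by gcongr
      _ = val dn τ ^ 3 * (artanh τ ^ 3 * (1 - τ ^ 2)) := by ring
      _ ≤ val dn τ ^ 3 * 3 := by gcongr
      _ = _ := by ring
  have h12 : 32 / 33 ≤ τ ^ 3 := by nlinarith [h.1, h.2, mul_nonneg h.1 (sub_nonneg.2 h.2.le)]
  nlinarith [mul_nonneg hr.le (sub_nonneg.2 h12)]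

/-- Convexity of `c` for `τ ≥ 0`. Near `τ = 1` the bounds on the tail alone do not suffice. -/
theorem val_c2s_nonneg : 0 ≤ val c2s τ := by
  obtain ⟨h1, h2⟩ := sq_mem h
  obtain ⟨h3, h4⟩ := tail_bounds h
  rcases lt_or_ge (τ ^ 2) (4 / 5) with h5 | h5
  · have h6 := tail_lt_of_sq_lt h h5
    refine nonneg_of_test c2s_test₁ fun i => ?_
    fin_cases i <;> simp [boxC₁, side, Axis.Mem, point] <;> constructor <;> linarith
  obtain ⟨h6, h7⟩ := y_bounds h h5
  rcases lt_or_ge (τ ^ 2) (124 / 125) with h8 | h8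
  · have := nonneg_of_test c2s_test₂ (x := point (τ ^ 2) (tail τ / (4 * τ ^ 2)) 0) fun i => by
      fin_cases i <;> simp only [boxC₂, side, Axis.Mem, point] <;>
        norm_num [-sq_lt_one_iff_abs_lt_one] <;>
        constructor <;> linarith
    rwa [ev_substY h h5] at this
  · have h9 := nonneg_of_test c2s_test₃ (x := point (τ ^ 2) (tail τ / (4 * τ ^ 2)) 0) fun i => by
      fin_cases i <;> simp only [boxC₃, side, Axis.Mem, point] <;>
        norm_num [-sq_lt_one_iff_abs_lt_one] <;>
        constructor <;> linarith
    rw [ev_substY h h5] at h9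
    change 0 ≤ val c2s' τ at h9
    simp only [c2s', val_sub, val_mul, val_pow, val_ofNat, val_one, val_s] at h9
    have h10 := val_dn_pow_ge h h8
    have h11 : 0 ≤ 32 * τ ^ 2 * val dn τ ^ 2 * (val dn τ ^ 3 - 6912 * (1 - τ ^ 2) ^ 2) :=
      mul_nonneg (by positivity) (by linarith)
    linarith

theorem val_k4_nonneg : 0 ≤ val k4 τ := by
  have h1 := val_c2s_nonneg h
  have h2 : 0 ≤ val qx τ := by
    simp only [qx, val_add, val_mul, val_ofNat, val_s, val_pow]
    positivity
  simp only [k4, val_mul, val_pow, val_ofNat]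
  positivity

theorem ev_kw_pos (hs : 1 / 10 ≤ τ ^ 2) {w : ℝ} (hw : 0 ≤ w) :
    0 < ev (point (τ ^ 2) (tail τ) w) kw := by
  obtain ⟨h1, h2⟩ := sq_mem h
  obtain ⟨h3, h4⟩ := tail_bounds h
  rcases lt_or_ge (τ ^ 2) (4 / 5) with h5 | h5
  · have h6 := tail_lt_of_sq_lt h h5
    rcases lt_or_ge w (27 / 20) with h7 | h7
    · refine pos_of_testPos kw_test₁ fun i => ?_
      fin_cases i <;> simp only [boxK, side, Axis.Mem, point] <;>
        norm_num [-sq_lt_one_iff_abs_lt_one] <;>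
        constructor <;> linarith
    rcases lt_or_ge w (9 / 2) with h8 | h8
    · refine pos_of_testPos kw_test₂ fun i => ?_
      fin_cases i <;> simp only [boxK, side, Axis.Mem, point] <;>
        norm_num [-sq_lt_one_iff_abs_lt_one] <;>
        constructor <;> linarith
    · refine pos_of_testPos kw_test₃ fun i => ?_
      fin_cases i <;> simp only [boxK, side, Axis.Mem, point] <;>
        norm_num [-sq_lt_one_iff_abs_lt_one] <;>
        first | linarith | (constructor <;> linarith)
  · obtain ⟨h6, h7⟩ := y_bounds h h5
    have h8 : 0 < ev (point (τ ^ 2) (tail τ) w) kw3 := by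
      rw [← ev_substY h h5]
      rcases lt_or_ge w 1 with h7 | h7
      · refine pos_of_testPos kw3_test₁ fun i => ?_
        fin_cases i <;> simp only [boxY, side, Axis.Mem, point] <;>
        norm_num [-sq_lt_one_iff_abs_lt_one] <;>
          constructor <;> linarith
      · refine pos_of_testPos kw3_test₂ fun i => ?_
        fin_cases i <;> simp only [boxY, side, Axis.Mem, point] <;>
        norm_num [-sq_lt_one_iff_abs_lt_one] <;>
          first | linarith | (constructor <;> linarith)
    have h9 := val_k4_nonneg h
    have h10 : ev (point (τ ^ 2) (tail τ) w) k4 = val k4 τ := ev_eq_val (by decide +kernel) w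
    rw [kw, ev_add, ev_mul, ev_mul, ev_mul, ev_pow, ev_pow, h10]
    have h11 : 0 ≤ ev (point (τ ^ 2) (tail τ) w) s * ev (point (τ ^ 2) (tail τ) w) r ^ 2 *
        ev (point (τ ^ 2) (tail τ) w) Poly.w ^ 4 * val k4 τ := by
      change 0 ≤ τ ^ 2 * _ * w ^ 4 * val k4 τ
      positivity
    linarith

/-- Positivity of the eliminated polynomial for `s ≥ 1/10`, in the variable `w` with
`δ = τ r² w / dx`. -/
theorem kw_pos (hs : 1 / 10 ≤ τ ^ 2) {w : ℝ} (hw : 0 ≤ w) :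
    0 < val k0 τ + val k1 τ * w + val k2 τ * w ^ 2 + τ ^ 2 * val k3 τ * w ^ 3 +
      τ ^ 2 * (1 - τ ^ 2) ^ 2 * val k4 τ * w ^ 4 := by
  have h1 := ev_kw_pos h hs hw
  have h2 : free 2 k0 = true ∧ free 2 k1 = true ∧ free 2 k2 = true ∧ free 2 k3 = true ∧
    free 2 k4 = true := by decide +kernel
  simp only [kw, kw3, ev_add, ev_mul, ev_pow, ev_eq_val h2.1, ev_eq_val h2.2.1,
    ev_eq_val h2.2.2.1, ev_eq_val h2.2.2.2.1, ev_eq_val h2.2.2.2.2, ev_var, point, ev_sub,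
    ev_one] at h1
  linarith

/-- Positivity of the eliminated polynomial for `s ≤ 1/10` and `0 < δ < 1`. -/
theorem ks_pos (h0 : 0 < τ) (hs : τ ^ 2 ≤ 1 / 10) {δ : ℝ} (hδ : 0 < δ) (hδ' : δ < 1) :
    0 < val k0 τ * (1 - τ ^ 2) ^ 6 * τ ^ 2 + τ * (val k1 τ * (1 - τ ^ 2) ^ 4 * val dx τ) * δ +
      val k2 τ * ((1 - τ ^ 2) ^ 2 * val dx τ ^ 2) * δ ^ 2 + τ * val k3 τ * val dx τ ^ 3 * δ ^ 3 +
      val k4 τ * val dx τ ^ 4 * δ ^ 4 := by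
  obtain ⟨h3, h4⟩ := tail_bounds h
  have h5 := tail_lt_of_sq_lt h (by linarith)
  have h6 : τ < 7 / 20 := by nlinarith
  have h1 : 0 ≤ ev (point τ (tail τ) δ) (ks - var 0 * w) := by
    rcases lt_or_ge δ (3 / 10) with h7 | h7
    · refine nonneg_of_test ks_test₁ fun i => ?_
      fin_cases i <;> simp only [boxS, side, Axis.Mem, point] <;>
        norm_num [-sq_lt_one_iff_abs_lt_one] <;>
        constructor <;> linarith
    · refine nonneg_of_test ks_test₂ fun i => ?_
      fin_cases i <;> simp only [boxS, side, Axis.Mem, point] <;>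
        norm_num [-sq_lt_one_iff_abs_lt_one] <;>
        constructor <;> linarith
  have h2 : free 2 k0 = true ∧ free 2 k1 = true ∧ free 2 k2 = true ∧ free 2 k3 = true ∧
    free 2 k4 = true ∧ free 2 r = true ∧ free 2 dx = true := by decide +kernel
  obtain ⟨a0, a1, a2, a3, a4, a5, a6⟩ := h2
  simp only [ks, ev_add, ev_mul, ev_pow, ev_substT a0, ev_substT a1, ev_substT a2, ev_substT a3,
    ev_substT a4, ev_substT a5, ev_substT a6, ev_var, point, ev_sub] at h1
  simp only [val_sub, val_one, val_s] at h1
  have := mul_pos h0 hδ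
  linarith

theorem ev_pl_pos {t : ℝ} (ht : t ∈ Ico (0 : ℝ) 1) : 0 < ev (point τ (tail τ) t) pl := by
  obtain ⟨h3, h4⟩ := tail_bounds h
  obtain ⟨h1, h2⟩ := h
  obtain ⟨h5, h6⟩ := ht
  rcases lt_or_ge τ (39 / 40) with h7 | h7
  · refine pos_of_testPos pl_test₁ fun i => ?_
    fin_cases i <;> simp only [boxL, side, Axis.Mem, point] <;>
        norm_num [-sq_lt_one_iff_abs_lt_one] <;>
      constructor <;> linarith
  · refine pos_of_testPos pl_test₂ fun i => ?_
    fin_cases i <;> simp only [boxL, side, Axis.Mem, point] <;>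
        norm_num [-sq_lt_one_iff_abs_lt_one] <;>
      constructor <;> linarith

theorem ev_nl_nonneg {t : ℝ} (ht : t ∈ Ico (0 : ℝ) 1) : 0 ≤ ev (point τ (tail τ) t) nl := by
  obtain ⟨h3, h4⟩ := tail_bounds h
  obtain ⟨h1, h2⟩ := h
  obtain ⟨h5, h6⟩ := ht
  rcases lt_or_ge t (1 / 2) with h7 | h7
  · refine nonneg_of_test nl_test₁ fun i => ?_
    fin_cases i <;> simp only [boxL, side, Axis.Mem, point] <;>
        norm_num [-sq_lt_one_iff_abs_lt_one] <;>
      constructor <;> linarith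
  · refine nonneg_of_test nl_test₂ fun i => ?_
    fin_cases i <;> simp only [boxL, side, Axis.Mem, point] <;>
        norm_num [-sq_lt_one_iff_abs_lt_one] <;>
      constructor <;> linarith

end range
end
end M1P2

/-! ### The closure coefficients as functions of the parameter -/

namespace M1P2

open Real Set M1P2.Poly Expr3 Box

noncomputable section

theorem val_dx (τ : ℝ) : val dx τ = (3 + τ ^ 2) * (1 + 3 * τ ^ 2) := by
  simp only [dx, val_add, val_mul, val_ofNat, val_one, val_s]

theorem val_qx (τ : ℝ) : val qx τ = 3 + 2 * τ ^ 2 + 3 * τ ^ 4 := by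
  simp only [qx, val_add, val_mul, val_ofNat, val_s, val_pow]
  ring

theorem val_dx_pos (τ : ℝ) : 0 < val dx τ := by
  rw [val_dx]
  positivity

theorem val_qx_pos (τ : ℝ) : 0 < val qx τ := by
  rw [val_qx]
  positivity

/-- The velocity `x = E₁ / E₀` as a function of the parameter `τ ∈ (-1, 1)`. -/
def velT (τ : ℝ) : ℝ := 8 * τ * (1 + τ ^ 2) / val dx τ

/-- The derivative of `velT`. -/
def velT' (τ : ℝ) : ℝ := 8 * (1 - τ ^ 2) * val qx τ / val dx τ ^ 2

/-- The coefficient `c` of `E₃ = E₀ (x³ + m(x) + c(x) Y)` as a function of `τ`. -/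
def cT (τ : ℝ) : ℝ := 3 * τ * val nh τ / val eh τ

/-- The derivative `c' = dc/dx` as a function of `τ`. -/
def c1T (τ : ℝ) : ℝ := 9 / 4 * val c1h τ * val dx τ ^ 2 / (val eh τ ^ 2 * val qx τ)

/-- The second derivative `c'' = d²c/dx²` as a function of `τ`. -/
def c2T (τ : ℝ) : ℝ :=
  9 / 4 * ((dval c1h τ * val dx τ ^ 2 + 2 * val c1h τ * val dx τ * dval dx τ) *
      (val eh τ ^ 2 * val qx τ) - val c1h τ * val dx τ ^ 2 *
      (2 * val eh τ * dval eh τ * val qx τ + val eh τ ^ 2 * dval qx τ)) /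
    (val eh τ ^ 2 * val qx τ) ^ 2 / velT' τ

/-- The coefficient `m` of `E₃ = E₀ (x³ + m(x) + c(x) Y)` as a function of `τ`. -/
def mT (τ : ℝ) : ℝ :=
  3 / 2 * τ * (1 - τ ^ 2) ^ 4 * val kh τ / (val dx τ ^ 3 * val eh τ * val dn τ)

/-- The derivative `m' = dm/dx` as a function of `τ`. -/
def m1T (τ : ℝ) : ℝ :=
  9 / 4 * (1 - τ ^ 2) ^ 2 * val m1h τ / (val dx τ ^ 2 * val eh τ ^ 2 * val qx τ * val dn τ)

/-- The second derivative `m'' = d²m/dx²` as a function of `τ`. -/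
def m2T (τ : ℝ) : ℝ :=
  9 / 4 * ((-4 * τ * (1 - τ ^ 2) * val m1h τ + (1 - τ ^ 2) ^ 2 * dval m1h τ) *
      (val dx τ ^ 2 * val eh τ ^ 2 * val qx τ * val dn τ) - (1 - τ ^ 2) ^ 2 * val m1h τ *
      (val dx τ * val eh τ * (2 * dval dx τ * val eh τ * val qx τ +
        2 * val dx τ * dval eh τ * val qx τ + val dx τ * val eh τ * dval qx τ) * val dn τ +
        val dx τ ^ 2 * val eh τ ^ 2 * val qx τ * dval dn τ)) /
    (val dx τ ^ 2 * val eh τ ^ 2 * val qx τ * val dn τ) ^ 2 / velT' τ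

variable {τ : ℝ}

/-- `val e` is even, so that facts on `[0, 1)` extend to `(-1, 1)`. -/
theorem val_abs (h : τ ∈ Ioo (-1 : ℝ) 1) (e : Expr3) : val e |τ| = val e τ := by
  rcases abs_cases τ with ⟨h1, -⟩ | ⟨h1, -⟩ <;> rw [h1]
  exact val_neg h e

theorem abs_mem (h : τ ∈ Ioo (-1 : ℝ) 1) : |τ| ∈ Ico (0 : ℝ) 1 := ⟨abs_nonneg τ, abs_lt.2 h⟩

section

variable (h : τ ∈ Ioo (-1 : ℝ) 1)
include h

theorem val_dn_pos' : 0 < val dn τ := val_abs h dn ▸ val_dn_pos (abs_mem h)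
theorem val_eh_pos' : 0 < val eh τ := val_abs h eh ▸ val_eh_pos (abs_mem h)
theorem val_c1h_pos' : 0 < val c1h τ := val_abs h c1h ▸ val_c1h_pos (abs_mem h)
theorem val_idc' : val idc τ = 0 := val_abs h idc ▸ val_idc (abs_mem h)
theorem val_idm' : val idm τ = 0 := val_abs h idm ▸ val_idm (abs_mem h)

theorem one_sub_sq_pos : 0 < 1 - τ ^ 2 := by nlinarith [h.1, h.2]

theorem velT'_pos : 0 < velT' τ := by
  have := one_sub_sq_pos h
  have := val_qx_pos τ
  have := val_dx_pos τ
  rw [velT']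
  positivity

omit h in
theorem velT_hasDerivAt : HasDerivAt velT (velT' τ) τ := by
  have h1 : HasDerivAt (fun t : ℝ => 8 * t * (1 + t ^ 2)) (8 + 24 * τ ^ 2) τ := by
    convert! ((hasDerivAt_id τ).const_mul 8).mul ((hasDerivAt_pow 2 τ).const_add 1) using 1
    simp
    ring
  have h2 : HasDerivAt (val dx) (20 * τ + 12 * τ ^ 3) τ := by
    rw [funext val_dx]
    convert! ((hasDerivAt_pow 2 τ).const_add 3).mul
      (((hasDerivAt_pow 2 τ).const_mul 3).const_add 1) using 1
    simp
    ring
  refine (h1.div h2 (val_dx_pos τ).ne').congr_deriv ?_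
  rw [velT']
  congr 1
  rw [val_dx, val_qx]
  ring

theorem cT_hasDerivAt : HasDerivAt cT (c1T τ * velT' τ) τ := by
  have he := (val_eh_pos' h).ne'
  have hr := (one_sub_sq_pos h).ne'
  have hd := (val_dx_pos τ).ne'
  have hq := (val_qx_pos τ).ne'
  refine ((((hasDerivAt_id τ).const_mul 3).mul (val_hasDerivAt h nh)).div
    (val_hasDerivAt h eh) he).congr_deriv ?_
  have h1 := val_idc' h
  simp only [idc, val_add, val_sub, val_mul, val_pow, val_ofNat, val_one, val_s, val_theta h] at h1
  simp only [c1T, velT', id, Pi.mul_apply]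
  generalize val nh τ = a at *
  generalize val eh τ = b at *
  generalize val dx τ = d at *
  generalize val qx τ = q at *
  rw [div_mul_div_comm, div_eq_div_iff (by positivity) (by positivity)]
  refine mul_left_cancel₀ hr ?_
  linear_combination (3 * b ^ 2 * q * d ^ 2) * h1

theorem c1T_hasDerivAt : HasDerivAt c1T (c2T τ * velT' τ) τ := by
  have he := (val_eh_pos' h).ne'
  have hq := (val_qx_pos τ).ne'
  rw [c2T, div_mul_cancel₀ _ (velT'_pos h).ne']
  refine ((((val_hasDerivAt h c1h).const_mul (9 / 4)).mul ((val_hasDerivAt h dx).pow 2)).div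
    (((val_hasDerivAt h eh).pow 2).mul (val_hasDerivAt h qx))
    (mul_ne_zero (pow_ne_zero 2 he) hq)).congr_deriv ?_
  simp only [Nat.cast_ofNat, Pi.pow_apply, Pi.mul_apply]
  congr 1
  ring

theorem mul_c2T : τ * c2T τ =
    9 / 32 * val c2s τ * val dx τ ^ 3 / ((1 - τ ^ 2) ^ 2 * val eh τ ^ 3 * val qx τ ^ 3) := by
  have he := (val_eh_pos' h).ne'
  have hr := (one_sub_sq_pos h).ne'
  have hd := (val_dx_pos τ).ne'
  have hq := (val_qx_pos τ).ne'
  rw [c2T, c2s, velT']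
  simp only [val_add, val_sub, val_mul, val_ofNat, val_theta h]
  generalize val eh τ = b at *
  generalize val dx τ = d at *
  generalize val qx τ = q at *
  generalize 1 - τ ^ 2 = ρ at *
  rw [div_div, mul_div_assoc', div_eq_div_iff (by positivity) (by positivity)]
  field_simp
  ring

theorem mT_hasDerivAt : HasDerivAt mT (m1T τ * velT' τ) τ := by
  have he := (val_eh_pos' h).ne'
  have hn := (val_dn_pos' h).ne'
  have hr := (one_sub_sq_pos h).ne'
  have hd := (val_dx_pos τ).ne'
  have hq := (val_qx_pos τ).ne'
  have h1 : HasDerivAt (fun t : ℝ => 3 / 2 * t * (1 - t ^ 2) ^ 4)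
      (3 / 2 * (1 - τ ^ 2) ^ 4 - 12 * τ ^ 2 * (1 - τ ^ 2) ^ 3) τ := by
    convert! ((hasDerivAt_id τ).const_mul (3 / 2)).mul
      (((hasDerivAt_pow 2 τ).const_sub 1).pow 4) using 1
    simp
    ring
  refine ((h1.mul (val_hasDerivAt h kh)).div ((((val_hasDerivAt h dx).pow 3).mul
    (val_hasDerivAt h eh)).mul (val_hasDerivAt h dn))
    (mul_ne_zero (mul_ne_zero (pow_ne_zero 3 hd) he) hn)).congr_deriv ?_
  have h1 := val_idm' h
  have e8 : val (r - 8 * s) τ = 1 - τ ^ 2 - 8 * τ ^ 2 := by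
    simp only [val_sub, val_one, val_s, val_mul, val_ofNat]
  rw [idm, val_sub, val_sub, val_mul, val_add, val_mul (r - 8 * s), e8] at h1
  simp only [val_add, val_mul, val_ofNat, val_theta h] at h1
  simp only [m1T, velT', Pi.mul_apply, Pi.pow_apply, Nat.cast_ofNat]
  generalize val kh τ = a at *
  generalize val eh τ = b at *
  generalize val dx τ = d at *
  generalize val qx τ = q at *
  generalize val dn τ = n at *
  rw [div_mul_div_comm, div_eq_div_iff (by positivity) (by positivity)]
  refine mul_left_cancel₀ hr ?_
  linear_combination (3 / 2 * (1 - τ ^ 2) ^ 4 * d ^ 2 * (d ^ 2 * b ^ 2 * q * n * d ^ 2)) * h1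

theorem m1T_hasDerivAt : HasDerivAt m1T (m2T τ * velT' τ) τ := by
  have he := (val_eh_pos' h).ne'
  have hn := (val_dn_pos' h).ne'
  have hd := (val_dx_pos τ).ne'
  have hq := (val_qx_pos τ).ne'
  have h1 : HasDerivAt (fun t : ℝ => 9 / 4 * (1 - t ^ 2) ^ 2) (-9 * τ * (1 - τ ^ 2)) τ := by
    convert! (((hasDerivAt_pow 2 τ).const_sub 1).pow 2).const_mul (9 / 4) using 1
    simp
    ring
  rw [m2T, div_mul_cancel₀ _ (velT'_pos h).ne']
  refine ((h1.mul (val_hasDerivAt h m1h)).div (((((val_hasDerivAt h dx).pow 2).mul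
    ((val_hasDerivAt h eh).pow 2)).mul (val_hasDerivAt h qx)).mul (val_hasDerivAt h dn))
    (mul_ne_zero (mul_ne_zero (mul_ne_zero (pow_ne_zero 2 hd) (pow_ne_zero 2 he)) hq)
      hn)).congr_deriv ?_
  simp only [Nat.cast_ofNat, Pi.pow_apply, Pi.mul_apply]
  congr 1
  ring

theorem mul_m2T : τ * m2T τ =
    9 / 32 * val m2s τ / (val dx τ * val eh τ ^ 3 * val qx τ ^ 3 * val dn τ ^ 2) := by
  have he := (val_eh_pos' h).ne'
  have hn := (val_dn_pos' h).ne'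
  have hr := (one_sub_sq_pos h).ne'
  have hd := (val_dx_pos τ).ne'
  have hq := (val_qx_pos τ).ne'
  rw [m2T, m2s, velT']
  simp only [val_add, val_sub, val_mul, val_ofNat, val_theta h, val_s]
  generalize val eh τ = b at *
  generalize val dx τ = d at *
  generalize val qx τ = q at *
  generalize val dn τ = n at *
  generalize 1 - τ ^ 2 = ρ at *
  rw [div_div, mul_div_assoc', div_eq_div_iff (by positivity) (by positivity)]
  field_simp
  ring

omit h in
theorem c2T_zero : c2T 0 = 0 := by simp [c2T, dval_zero]

omit h in
theorem m2T_zero : m2T 0 = 0 := by simp [m2T, dval_zero]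

end

end
end M1P2

/-! ### Sign changes and the nonlinearity factor -/

namespace M1P2

open Real Set M1P2.Poly Expr3 Box

noncomputable section

/-- The characteristic polynomial of the Jacobian in the variable `δ = λ - x`. -/
def cubicT (τ Y δ : ℝ) : ℝ :=
  δ ^ 3 + (3 * velT τ - cT τ) * δ ^ 2 - (m1T τ + c1T τ * Y) * δ - mT τ

/-- The nonlinearity factor: the derivative of the characteristic polynomial at `λ = x + δ` along
the direction `(1, λ, λ²)` is `-δ gnlT / E₀`. -/
def gnlT (τ Y δ : ℝ) : ℝ :=
  2 * c1T τ * δ ^ 2 + δ * (2 * (3 * velT τ - cT τ) + m2T τ + c2T τ * Y) - 2 * c1T τ * Y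

variable {τ : ℝ}

theorem three_velT_sub_cT (h : τ ∈ Ioo (-1 : ℝ) 1) :
    3 * velT τ - cT τ = 3 * τ * val gh τ / (val dx τ * val eh τ) := by
  have he := (val_eh_pos' h).ne'
  have hd := (val_dx_pos τ).ne'
  simp only [velT, cT, gh, val_sub, val_mul, val_add, val_ofNat, val_one, val_s]
  field_simp

theorem one_sub_velT_sq (τ : ℝ) :
    1 - velT τ ^ 2 = (1 - τ ^ 2) ^ 2 * val qy τ / val dx τ ^ 2 := by
  have hd := (val_dx_pos τ).ne'
  simp only [velT, qy, val_sub, val_mul, val_add, val_ofNat, val_one, val_s, val_pow]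
  rw [div_pow, one_sub_div (by positivity)]
  congr 1
  rw [val_dx]
  ring

theorem val_qy_pos (τ : ℝ) : 0 < val qy τ := by
  have := val_dx_pos τ
  simp only [qy, val_sub, val_mul, val_add, val_ofNat, val_one, val_s, val_pow]
  positivity

section

variable (h : τ ∈ Ioo (0 : ℝ) 1)
include h

theorem mem_Ico_of_mem : τ ∈ Ico (0 : ℝ) 1 := ⟨h.1.le, h.2⟩
theorem mem_Ioo_of_mem : τ ∈ Ioo (-1 : ℝ) 1 := ⟨by linarith [h.1], h.2⟩

theorem mT_pos : 0 < mT τ := by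
  have h0 := mem_Ico_of_mem h
  have := one_sub_sq_pos (mem_Ioo_of_mem h)
  have := val_kh_pos h0
  have := val_eh_pos h0
  have := val_dn_pos h0
  have := val_dx_pos τ
  have := h.1
  rw [mT]
  positivity

theorem c2T_nonneg : 0 ≤ c2T τ := by
  have h0 := mem_Ico_of_mem h
  have := one_sub_sq_pos (mem_Ioo_of_mem h)
  have := val_c2s_nonneg h0
  have := val_eh_pos h0
  have := val_dx_pos τ
  have := val_qx_pos τ
  refine nonneg_of_mul_nonneg_right ?_ h.1
  rw [mul_c2T (mem_Ioo_of_mem h)]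
  positivity

theorem gap_nonneg : 0 ≤ 2 * (3 * velT τ - cT τ) + m2T τ := by
  have h0 := mem_Ico_of_mem h
  have he := val_eh_pos h0
  have hn := val_dn_pos h0
  have hd := val_dx_pos τ
  have hq := val_qx_pos τ
  have hg := val_gm_nonneg h0
  refine nonneg_of_mul_nonneg_right ?_ h.1
  have : τ * (2 * (3 * velT τ - cT τ) + m2T τ) = 3 / 32 * val gm τ /
      (val dx τ * val eh τ ^ 3 * val qx τ ^ 3 * val dn τ ^ 2) := by
    rw [mul_add, mul_m2T (mem_Ioo_of_mem h), three_velT_sub_cT (mem_Ioo_of_mem h)]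
    simp only [gm, val_add, val_mul, val_ofNat, val_s, val_pow]
    field_simp
    ring
  rw [this]
  positivity

/-- Elimination of `Y`: the combination `c' δ N - (2 c' - c'' δ) P` of the characteristic
polynomial `P` and the nonlinearity factor `N` is free of `Y`. It is written out here, multiplied
by `τ` and the common denominator. -/
theorem elimination {Y δ : ℝ} (hP : cubicT τ Y δ = 0) :
    128 * ((1 - τ ^ 2) ^ 2 * val dx τ * val eh τ ^ 5 * val qx τ ^ 4 * val dn τ ^ 2) *
      (τ * c1T τ * (δ * gnlT τ Y δ)) =
    val k0 τ * (1 - τ ^ 2) ^ 6 * τ ^ 2 + τ * (val k1 τ * (1 - τ ^ 2) ^ 4 * val dx τ) * δ +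
      val k2 τ * ((1 - τ ^ 2) ^ 2 * val dx τ ^ 2) * δ ^ 2 + τ * val k3 τ * val dx τ ^ 3 * δ ^ 3 +
      val k4 τ * val dx τ ^ 4 * δ ^ 4 := by
  have h0 := mem_Ico_of_mem h
  have h1 := mem_Ioo_of_mem h
  have hr := (one_sub_sq_pos h1).ne'
  have he := (val_eh_pos h0).ne'
  have hn := (val_dn_pos h0).ne'
  have hd := (val_dx_pos τ).ne'
  have hq := (val_qx_pos τ).ne'
  have ht := h.1.ne'
  set M := (1 - τ ^ 2) ^ 2 * val dx τ * val eh τ ^ 5 * val qx τ ^ 4 * val dn τ ^ 2 with hM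
  have e0 : 128 * M * (2 * mT τ * c1T τ) = τ * (1 - τ ^ 2) ^ 6 * val k0 τ := by
    simp only [hM, mT, c1T, k0, val_mul, val_pow, val_ofNat]
    generalize 1 - τ ^ 2 = ρ at *
    field_simp
    ring
  have hc2 : c2T τ = 9 / 32 * val c2s τ * val dx τ ^ 3 /
      ((1 - τ ^ 2) ^ 2 * val eh τ ^ 3 * val qx τ ^ 3) / τ := by
    rw [← mul_c2T h1, mul_div_cancel_left₀ _ ht]
  have hm2 : m2T τ =
    9 / 32 * val m2s τ / (val dx τ * val eh τ ^ 3 * val qx τ ^ 3 * val dn τ ^ 2) / τ := by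
    rw [← mul_m2T h1, mul_div_cancel_left₀ _ ht]
  have e1 : 128 * M * (2 * m1T τ * c1T τ - c2T τ * mT τ) =
      (1 - τ ^ 2) ^ 4 * val dx τ * val k1 τ := by
    simp only [hM, hc2, mT, m1T, c1T, k1, val_mul, val_sub, val_ofNat]
    generalize 1 - τ ^ 2 = ρ at *
    field_simp
    ring
  have e2 : τ * (128 * M * (m2T τ * c1T τ - c2T τ * m1T τ)) =
      (1 - τ ^ 2) ^ 2 * val dx τ ^ 2 * val k2 τ := by
    simp only [hM, hc2, hm2, m1T, c1T, k2, val_mul, val_sub, val_ofNat]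
    generalize 1 - τ ^ 2 = ρ at *
    field_simp
    ring
  have e3 : 128 * M * (2 * (c1T τ - 1) * c1T τ + c2T τ * (3 * velT τ - cT τ)) =
      val dx τ ^ 3 * val k3 τ := by
    simp only [hM, hc2, three_velT_sub_cT h1, c1T, k3, val_mul, val_pow, val_sub, val_add,
      val_ofNat, val_one, val_s]
    generalize 1 - τ ^ 2 = ρ at *
    field_simp
    ring
  have e4 : τ * (128 * M * c2T τ) = val dx τ ^ 4 * val k4 τ := by
    simp only [hM, hc2, k4, val_mul, val_pow, val_ofNat]
    generalize 1 - τ ^ 2 = ρ at *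
    field_simp
    ring
  rw [cubicT] at hP
  rw [gnlT]
  linear_combination τ * e0 + τ * δ * e1 + δ ^ 2 * e2 + τ * δ ^ 3 * e3 + δ ^ 4 * e4 +
    128 * M * τ * (2 * c1T τ - c2T τ * δ) * hP

/-- On the right of the velocity the nonlinearity factor is positive at the zeros of the
characteristic polynomial. -/
theorem gnlT_pos_of_pos {Y δ : ℝ} (hY : 0 < Y) (hY' : Y < 1 - velT τ ^ 2) (hδ : 0 < δ)
    (hP : cubicT τ Y δ = 0) : 0 < gnlT τ Y δ := by
  have h0 := mem_Ico_of_mem h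
  have h1 := mem_Ioo_of_mem h
  have hr := one_sub_sq_pos h1
  have he := val_eh_pos h0
  have hn := val_dn_pos h0
  have hd := val_dx_pos τ
  have hq := val_qx_pos τ
  have hc := val_c1h_pos h0
  have hc1 : 0 < c1T τ := by
    rw [c1T]
    positivity
  have hE := elimination h hP
  have ht := h.1
  suffices H : 0 < val k0 τ * (1 - τ ^ 2) ^ 6 * τ ^ 2 +
      τ * (val k1 τ * (1 - τ ^ 2) ^ 4 * val dx τ) * δ +
      val k2 τ * ((1 - τ ^ 2) ^ 2 * val dx τ ^ 2) * δ ^ 2 + τ * val k3 τ * val dx τ ^ 3 * δ ^ 3 +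
      val k4 τ * val dx τ ^ 4 * δ ^ 4 by
    rw [← hE] at H
    have := pos_of_mul_pos_right H (by positivity)
    have := pos_of_mul_pos_right this (by positivity)
    exact pos_of_mul_pos_right this hδ.le
  rcases le_or_gt (1 / 10) (τ ^ 2) with hs | hs
  · -- the coefficients are bounded after the rescaling `δ = τ r² w / dx`
    have h2 := kw_pos h0 hs (w := δ * val dx τ / (τ * (1 - τ ^ 2) ^ 2)) (by positivity)
    have h3 := mul_pos (mul_pos (pow_pos ht 2) (pow_pos hr 6)) h2
    refine h3.trans_eq ?_
    generalize 1 - τ ^ 2 = ρ at *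
    field_simp
  · -- if the factor were not positive, then `δ² ≤ Y < 1`
    by_contra hcon
    have hδ1 : δ < 1 := by
      by_contra! hδ1
      have h2 : 0 < gnlT τ Y δ := by
        have h3 := mul_nonneg hδ.le (gap_nonneg h)
        have h4 := mul_nonneg hδ.le (mul_nonneg (c2T_nonneg h) hY.le)
        have h5 : 0 < 2 * c1T τ * (δ ^ 2 - Y) := by
          have : 0 < δ ^ 2 - Y := by nlinarith [sq_nonneg (velT τ)]
          positivity
        rw [gnlT]
        linarith
      refine hcon ?_
      rw [← hE]
      positivity
    exact hcon (ks_pos h0 ht hs.le hδ hδ1)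

end

/-- A point on the left of the velocity that separates the first eigenvalue from the others, and
where the nonlinearity factor is nonnegative. -/
theorem exists_separator (h : τ ∈ Ico (0 : ℝ) 1) {Y : ℝ} (hY : 0 < Y)
    (hY' : Y < 1 - velT τ ^ 2) :
    ∃ z < 0, 0 < cubicT τ Y z ∧ 0 ≤ gnlT τ Y z := by
  have h1 : τ ∈ Ioo (-1 : ℝ) 1 := ⟨by linarith [h.1], h.2⟩
  have hr := one_sub_sq_pos h1
  have he := val_eh_pos h
  have hn := val_dn_pos h
  have hd := val_dx_pos τ
  have hq := val_qx_pos τ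
  have hy := val_qy_pos τ
  have ht := h.1
  obtain ⟨t, ht0, ht1, rfl⟩ : ∃ t, 0 < t ∧ t < 1 ∧ Y = t * (1 - velT τ ^ 2) := by
    have : 0 < 1 - velT τ ^ 2 := hY.trans hY'
    refine ⟨Y / (1 - velT τ ^ 2), by positivity, (div_lt_one this).2 hY', ?_⟩
    field_simp
  have hp := ev_pl_pos h (t := t) ⟨ht0.le, ht1⟩
  have hq' := ev_nl_nonneg h (t := t) ⟨ht0.le, ht1⟩
  set D : ℝ := 400 * τ * (1 + τ ^ 2) + (1 - τ ^ 2) ^ 2 * (1 + τ ^ 2) * val dx τ * (23 + 28 * t)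
    with hD
  have hDpos : 0 < D := by positivity
  have hl : ev (point τ (tail τ) t) lsep = D := by
    have a1 : free 2 (1 + s) = true ∧ free 2 (r ^ 2 * (1 + s) * dx) = true := by decide +kernel
    simp only [lsep, ev_add, ev_mul, ev_substT a1.1, ev_substT a1.2, ev_var, ev_ofNat, val_add,
      val_mul, val_one, val_s, val_pow, val_sub, point]
    ring
  refine ⟨-D / (50 * val dx τ), div_neg_of_neg_of_pos (by linarith) (by positivity), ?_, ?_⟩
  · have a1 : free 2 (eh * qx * dn) = true ∧ free 2 gh = true ∧ free 2 eh = true ∧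
        free 2 (r ^ 2) = true ∧ free 2 m1h = true ∧ free 2 (c1h * qy * dx ^ 2 * dn) = true ∧
        free 2 (r ^ 2 * kh * eh * qx) = true := by decide +kernel
    obtain ⟨a1, a2, a3, a4, a5, a6, a7⟩ := a1
    simp only [pl, ev_add, ev_mul, ev_sub, ev_pow, ev_substT a1, ev_substT a2, ev_substT a3,
      ev_substT a4, ev_substT a5, ev_substT a6, ev_substT a7, hl, ev_ofNat, ev_var, point,
      val_mul, val_pow, val_sub, val_one, val_s] at hp
    have key : cubicT τ (t * (1 - velT τ ^ 2)) (-D / (50 * val dx τ)) * (500000 *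
        (val dx τ ^ 3 * val eh τ ^ 2 * val qx τ * val dn τ)) =
      (val eh τ * val qx τ * val dn τ) * D ^ 2 * (600 * τ * val gh τ - 4 * D * val eh τ) +
      (1 - τ ^ 2) ^ 2 * (22500 * D *
        (val m1h τ + t * (val c1h τ * val qy τ * val dx τ ^ 2 * val dn τ)) -
        750000 * τ * ((1 - τ ^ 2) ^ 2 * val kh τ * val eh τ * val qx τ)) := by
      rw [cubicT, three_velT_sub_cT h1, one_sub_velT_sq, m1T, c1T, mT]
      generalize D = D' at *
      generalize 1 - τ ^ 2 = ρ at *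
      field_simp
      ring
    refine pos_of_mul_pos_left ?_ (b := 500000 *
        (val dx τ ^ 3 * val eh τ ^ 2 * val qx τ * val dn τ)) (by positivity)
    rw [key]
    exact hp
  · -- the certificate carries a factor `τ`, so that `τ = 0` is treated directly
    rcases ht.eq_or_lt with h0 | h0
    · subst h0
      have e1 : velT 0 = 0 := by simp [velT]
      have e2 : cT 0 = 0 := by simp [cT]
      have e3 : val dx 0 = 3 := by rw [val_dx]; norm_num
      have hc1 : 0 < c1T 0 := by
        have := val_c1h_pos h
        rw [c1T]
        positivity
      rw [gnlT, e1, e2, c2T_zero, m2T_zero]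
      have : D = 3 * (23 + 28 * t) := by rw [hD, e3]; ring
      have h5 : t ≤ (-D / (50 * val dx 0)) ^ 2 := by
        rw [this, e3]
        nlinarith [sq_nonneg (3136 * t - 2424)]
      nlinarith [mul_nonneg hc1.le (sub_nonneg.2 h5)]
    · have a1 : free 2 (c1h * dx ^ 2 * eh * qx ^ 2 * dn ^ 2) = true ∧ free 2 (r ^ 2 * qy) = true ∧
          free 2 (192 * s * gh * (eh ^ 2 * qx ^ 3 * dn ^ 2) + 9 * m2s) = true ∧
          free 2 (c2s * dx ^ 2 * qy * dn ^ 2) = true := by decide +kernel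
      obtain ⟨a1, a2, a3, a4⟩ := a1
      simp only [nl, ev_add, ev_mul, ev_sub, ev_pow, ev_substT a1, ev_substT a2, ev_substT a3,
        ev_substT a4, hl, ev_ofNat, ev_var, point,
        val_mul, val_pow, val_sub, val_one, val_s, val_add, val_ofNat] at hq'
      have key : gnlT τ (t * (1 - velT τ ^ 2)) (-D / (50 * val dx τ)) * (τ * (80000 *
          (val dx τ ^ 2 * val eh τ ^ 3 * val qx τ ^ 3 * val dn τ ^ 2))) =
        144 * τ * (val c1h τ * val dx τ ^ 2 * val eh τ * val qx τ ^ 2 * val dn τ ^ 2) *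
          (D ^ 2 - 2500 * t * ((1 - τ ^ 2) ^ 2 * val qy τ)) -
        50 * D * ((192 * τ ^ 2 * val gh τ * (val eh τ ^ 2 * val qx τ ^ 3 * val dn τ ^ 2) +
          9 * val m2s τ) + 9 * t * (val c2s τ * val dx τ ^ 2 * val qy τ * val dn τ ^ 2)) := by
        have hc2 : c2T τ = 9 / 32 * val c2s τ * val dx τ ^ 3 /
            ((1 - τ ^ 2) ^ 2 * val eh τ ^ 3 * val qx τ ^ 3) / τ := by
          rw [← mul_c2T h1, mul_div_cancel_left₀ _ h0.ne']
        have hm2 : m2T τ =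
            9 / 32 * val m2s τ / (val dx τ * val eh τ ^ 3 * val qx τ ^ 3 * val dn τ ^ 2) / τ := by
          rw [← mul_m2T h1, mul_div_cancel_left₀ _ h0.ne']
        rw [gnlT, three_velT_sub_cT h1, one_sub_velT_sq, hc2, hm2, c1T]
        generalize D = D' at *
        generalize 1 - τ ^ 2 = ρ at *
        field_simp
        ring
      refine nonneg_of_mul_nonneg_left (b := τ * (80000 *
        (val dx τ ^ 2 * val eh τ ^ 3 * val qx τ ^ 3 * val dn τ ^ 2))) ?_ (by positivity)
      rw [key]
      exact hq'

end
end M1P2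

/-! ### Moments of the weight -/

namespace M1P2

open Real Set M1P2.Poly Expr3 Box MeasureTheory

noncomputable section

section moments

variable {a : ℝ}

theorem one_add_mul_pos (ha : |a| < 1) {μ : ℝ} (hμ : μ ∈ Icc (-1 : ℝ) 1) : 0 < 1 + a * μ := by
  obtain ⟨h1, h2⟩ := abs_lt.1 ha
  obtain ⟨h3, h4⟩ := hμ
  rcases le_or_gt 0 a with h | h <;> nlinarith

theorem continuousOn_weight (ha : |a| < 1) : ContinuousOn (weight a) (Icc (-1) 1) := by
  refine ContinuousOn.div continuousOn_const (by fun_prop) fun μ hμ => ?_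
  exact pow_ne_zero 4 (one_add_mul_pos ha hμ).ne'

theorem intervalIntegrable_mul_weight (ha : |a| < 1) {g : ℝ → ℝ} (hg : Continuous g) :
    IntervalIntegrable (fun μ => g μ * weight a μ) volume (-1) 1 := by
  refine ContinuousOn.intervalIntegrable ?_
  rw [uIcc_of_le (by norm_num)]
  exact hg.continuousOn.mul (continuousOn_weight ha)

/-- The integral of a Laurent polynomial in `1 + a μ`. -/
theorem integral_laurent (ha : |a| < 1) (h0 : a ≠ 0) (c₀ c₁ c₂ c₃ c₄ c₅ : ℝ) :
    ∫ μ in (-1 : ℝ)..1, (c₀ + c₁ * (1 + a * μ) + c₂ * (1 + a * μ) ^ 2 + c₃ * (1 + a * μ) ^ 3 +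
      c₄ * (1 + a * μ) ^ 4 + c₅ * (1 + a * μ) ^ 5) / (1 + a * μ) ^ 4 =
    c₀ * (2 / 3 * (3 + a ^ 2) / (1 - a ^ 2) ^ 3) + c₁ * (2 / (1 - a ^ 2) ^ 2) +
      c₂ * (2 / (1 - a ^ 2)) + c₃ * ((log (1 + a) - log (1 - a)) / a) + c₄ * 2 + c₅ * 2 := by
  have hp := one_add_mul_pos ha (μ := 1) (by norm_num)
  have hq := one_add_mul_pos ha (μ := -1) (by norm_num)
  have hu : ∀ μ ∈ uIcc (-1 : ℝ) 1, 1 + a * μ ≠ 0 := fun μ hμ => by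
    rw [uIcc_of_le (by norm_num)] at hμ
    exact (one_add_mul_pos ha hμ).ne'
  have hd : ∀ μ ∈ uIcc (-1 : ℝ) 1, HasDerivAt (fun μ => c₀ * (-1 / (3 * a) / (1 + a * μ) ^ 3) +
      c₁ * (-1 / (2 * a) / (1 + a * μ) ^ 2) + c₂ * (-1 / a / (1 + a * μ)) +
      c₃ * (log (1 + a * μ) / a) + c₄ * ((1 + a * μ) / a) + c₅ * ((1 + a * μ) ^ 2 / (2 * a)))
      ((c₀ + c₁ * (1 + a * μ) + c₂ * (1 + a * μ) ^ 2 + c₃ * (1 + a * μ) ^ 3 +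
      c₄ * (1 + a * μ) ^ 4 + c₅ * (1 + a * μ) ^ 5) / (1 + a * μ) ^ 4) μ := by
    intro μ hμ
    have hne := hu μ hμ
    have h1 : HasDerivAt (fun μ => 1 + a * μ) a μ := by
      simpa using ((hasDerivAt_id μ).const_mul a).const_add 1
    refine (((((((hasDerivAt_const μ (-1 / (3 * a))).div (h1.pow 3) (pow_ne_zero 3 hne)).const_mul
      c₀).add (((hasDerivAt_const μ (-1 / (2 * a))).div (h1.pow 2)
      (pow_ne_zero 2 hne)).const_mul c₁)).add (((hasDerivAt_const μ (-1 / a)).div h1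
      hne).const_mul c₂)).add (((h1.log hne).div_const a).const_mul c₃)).add
      ((h1.div_const a).const_mul c₄)).add (((h1.pow 2).div_const (2 * a)).const_mul c₅)
      |>.congr_deriv ?_
    simp only [Pi.pow_apply]
    generalize 1 + a * μ = u at *
    field_simp
    ring
  rw [intervalIntegral.integral_eq_sub_of_hasDerivAt hd]
  · have e1 : 1 - a ^ 2 = (1 + a) * (1 - a) := by ring
    have e2 : 1 + a * -1 = 1 - a := by ring
    rw [mul_one] at hp
    rw [e2] at hq
    simp only [e1, e2, mul_one]
    have hp' := hp.ne'
    have hq' := hq.ne'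
    field_simp
    ring
  · refine ContinuousOn.intervalIntegrable ?_
    exact ContinuousOn.div (by fun_prop) (by fun_prop) fun μ hμ => pow_ne_zero 4 (hu μ hμ)

end moments

variable {τ : ℝ}

theorem val_dn (τ : ℝ) :
    val dn τ = 105 - 90 * τ ^ 2 + 9 * τ ^ 4 - (15 - 9 * τ ^ 2) * τ ^ 2 * tail τ := by
  simp [dn, val, point]
  ring

theorem val_eh (τ : ℝ) :
    val eh τ = (28 - 16 * τ ^ 2 - 4 * τ ^ 2 * tail τ + τ ^ 4 * tail τ) *
      (140 - 176 * τ ^ 2 + 48 * τ ^ 4 - 20 * τ ^ 2 * tail τ + 20 * τ ^ 4 * tail τ -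
      3 * τ ^ 6 * tail τ) := by
  simp [eh, val, point]
  ring

theorem val_nh (τ : ℝ) :
    val nh τ = (2688 - 4880 * τ ^ 2 + 2800 * τ ^ 4 - 512 * τ ^ 6) +
      (0 - 783 + 1198 * τ ^ 2 - 527 * τ ^ 4 + 64 * τ ^ 6) * (τ ^ 2 * tail τ) +
      (57 - 71 * τ ^ 2 + 22 * τ ^ 4 - 2 * τ ^ 6) * (τ ^ 4 * tail τ ^ 2) := by
  simp [nh, val, point]
  ring

/-- The weight parameter `α = -2 τ / (1 + τ²)` as a function of `τ`. With it,
`(1 + α) / (1 - α) = ((1 - τ) / (1 + τ))²`, so that the logarithms in the moments become `artanh τ`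
and the square root in `α(x)` disappears. -/
def slope (τ : ℝ) : ℝ := -(2 * τ / (1 + τ ^ 2))

theorem abs_slope_lt (h : τ ∈ Ioo (-1 : ℝ) 1) : |slope τ| < 1 := by
  have h1 : 0 < 1 + τ ^ 2 := by positivity
  rw [slope, abs_neg, abs_lt, lt_div_iff₀ h1, div_lt_iff₀ h1]
  have h2 : 0 < (1 + τ) ^ 2 := pow_pos (by linarith [h.1]) 2
  have h3 : 0 < (1 - τ) ^ 2 := pow_pos (by linarith [h.2]) 2
  constructor <;> linarith

theorem log_slope (h : τ ∈ Ioo (-1 : ℝ) 1) :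
    log (1 + slope τ) - log (1 - slope τ) = -4 * artanh τ := by
  have h1 : 0 < 1 + τ ^ 2 := by positivity
  have h2 : 1 + τ ≠ 0 := by intro h0; linarith [h.1]
  have h3 : 1 - τ ≠ 0 := by intro h0; linarith [h.2]
  have e1 : 1 + slope τ = (1 - τ) ^ 2 / (1 + τ ^ 2) := by
    rw [slope]; field_simp; ring
  have e2 : 1 - slope τ = (1 + τ) ^ 2 / (1 + τ ^ 2) := by
    rw [slope]; field_simp; ring
  rw [e1, e2, log_div (pow_ne_zero 2 h3) h1.ne', log_div (pow_ne_zero 2 h2) h1.ne', log_pow,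
    log_pow, artanh_eq_half_log ⟨h.1.le, h.2.le⟩, log_div h2 h3]
  push_cast
  ring

theorem one_sub_slope_sq (τ : ℝ) : 1 - slope τ ^ 2 = (1 - τ ^ 2) ^ 2 / (1 + τ ^ 2) ^ 2 := by
  have h1 : 0 < 1 + τ ^ 2 := by positivity
  rw [slope]
  field_simp
  ring

theorem three_add_slope_sq (τ : ℝ) : 3 + slope τ ^ 2 = val dx τ / (1 + τ ^ 2) ^ 2 := by
  have h1 : 0 < 1 + τ ^ 2 := by positivity
  rw [slope, val_dx]
  field_simp
  ring

section nonzero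

variable (h : τ ∈ Ioo (-1 : ℝ) 1) (h0 : τ ≠ 0)
include h h0

omit h in
theorem slope_ne : slope τ ≠ 0 := by
  have : 1 + τ ^ 2 ≠ 0 := by positivity
  rw [slope]
  exact neg_ne_zero.2 (div_ne_zero (mul_ne_zero two_ne_zero h0) this)

/-- The moments of the weight, from the expansion of `(u - 1)^k`, `u = 1 + α μ`. -/
theorem wm_of_eq {k : ℕ} {c₀ c₁ c₂ c₃ c₄ c₅ : ℝ} (hk : ∀ u : ℝ, (u - 1) ^ k =
    c₀ + c₁ * u + c₂ * u ^ 2 + c₃ * u ^ 3 + c₄ * u ^ 4 + c₅ * u ^ 5) :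
    slope τ ^ k * wm (slope τ) k = 3 * (1 - τ ^ 2) ^ 6 / (2 * (1 + τ ^ 2) ^ 4 * val dx τ) *
      (c₀ * (2 / 3 * val dx τ * (1 + τ ^ 2) ^ 4 / (1 - τ ^ 2) ^ 6) +
      c₁ * (2 * (1 + τ ^ 2) ^ 4 / (1 - τ ^ 2) ^ 4) + c₂ * (2 * (1 + τ ^ 2) ^ 2 / (1 - τ ^ 2) ^ 2) +
      c₃ * (2 * (1 + τ ^ 2) * (artanh τ / τ)) + c₄ * 2 + c₅ * 2) := by
  have ha := abs_slope_lt h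
  have h1 := (one_sub_sq_pos h).ne'
  have h2 : 1 + τ ^ 2 ≠ 0 := by positivity
  have hd := (val_dx_pos τ).ne'
  have hI := integral_laurent ha (slope_ne h0) c₀ c₁ c₂ c₃ c₄ c₅
  have e : ∀ μ, slope τ ^ k * (μ ^ k * weight (slope τ) μ) =
      3 * (1 - slope τ ^ 2) ^ 3 / (2 * (3 + slope τ ^ 2)) *
      ((c₀ + c₁ * (1 + slope τ * μ) + c₂ * (1 + slope τ * μ) ^ 2 + c₃ * (1 + slope τ * μ) ^ 3 +
      c₄ * (1 + slope τ * μ) ^ 4 + c₅ * (1 + slope τ * μ) ^ 5) / (1 + slope τ * μ) ^ 4) := by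
    intro μ
    rw [← hk, weight]
    ring
  rw [wm, moment, ← intervalIntegral.integral_const_mul]
  simp only [e]
  rw [intervalIntegral.integral_const_mul, hI, log_slope h, one_sub_slope_sq, three_add_slope_sq,
    slope]
  field_simp
  ring

theorem wm_one_of_ne : wm (slope τ) 1 = velT τ := by
  have h1 := (one_sub_sq_pos h).ne'
  have h2 : 1 + τ ^ 2 ≠ 0 := by positivity
  have hd := (val_dx_pos τ).ne'
  have := wm_of_eq h h0 (k := 1) (c₀ := -1) (c₁ := 1) (c₂ := 0) (c₃ := 0) (c₄ := 0) (c₅ := 0)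
    (fun u => by ring)
  refine mul_left_cancel₀ (pow_ne_zero 1 (slope_ne h0)) (this.trans ?_)
  rw [slope, velT]
  field_simp
  rw [val_dx]
  ring

theorem wm_two_of_ne : wm (slope τ) 2 = (1 + 14 * τ ^ 2 + τ ^ 4) / val dx τ := by
  have h1 := (one_sub_sq_pos h).ne'
  have h2 : 1 + τ ^ 2 ≠ 0 := by positivity
  have hd := (val_dx_pos τ).ne'
  have := wm_of_eq h h0 (k := 2) (c₀ := 1) (c₁ := -2) (c₂ := 1) (c₃ := 0) (c₄ := 0) (c₅ := 0)
    (fun u => by ring)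
  refine mul_left_cancel₀ (pow_ne_zero 2 (slope_ne h0)) (this.trans ?_)
  rw [slope]
  field_simp
  rw [val_dx]
  ring

theorem wm_three_of_ne {A : ℝ} (hA : artanh τ / τ = A) : wm (slope τ) 3 =
    ((1 + τ ^ 2) ^ 3 * val dx τ - 9 * (1 + τ ^ 2) ^ 3 * (1 - τ ^ 2) ^ 2 +
      9 * (1 + τ ^ 2) * (1 - τ ^ 2) ^ 4 - 3 * (1 - τ ^ 2) ^ 6 * A) / (8 * τ ^ 3 * val dx τ) := by
  have h1 := (one_sub_sq_pos h).ne'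
  have h2 : 1 + τ ^ 2 ≠ 0 := by positivity
  have hd := (val_dx_pos τ).ne'
  have := wm_of_eq h h0 (k := 3) (c₀ := -1) (c₁ := 3) (c₂ := -3) (c₃ := 1) (c₄ := 0) (c₅ := 0)
    (fun u => by ring)
  rw [hA] at this
  refine mul_left_cancel₀ (pow_ne_zero 3 (slope_ne h0)) (this.trans ?_)
  rw [slope]
  generalize val dx τ = d at *
  generalize hρ : 1 - τ ^ 2 = ρ at *
  field_simp
  ring

theorem wm_four_of_ne {A : ℝ} (hA : artanh τ / τ = A) : wm (slope τ) 4 =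
    ((1 + τ ^ 2) ^ 4 * val dx τ - 12 * (1 + τ ^ 2) ^ 4 * (1 - τ ^ 2) ^ 2 +
      18 * (1 + τ ^ 2) ^ 2 * (1 - τ ^ 2) ^ 4 - 12 * (1 + τ ^ 2) * (1 - τ ^ 2) ^ 6 * A +
      3 * (1 - τ ^ 2) ^ 6) / (16 * τ ^ 4 * val dx τ) := by
  have h1 := (one_sub_sq_pos h).ne'
  have h2 : 1 + τ ^ 2 ≠ 0 := by positivity
  have hd := (val_dx_pos τ).ne'
  have := wm_of_eq h h0 (k := 4) (c₀ := 1) (c₁ := -4) (c₂ := 6) (c₃ := -4) (c₄ := 1) (c₅ := 0)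
    (fun u => by ring)
  rw [hA] at this
  refine mul_left_cancel₀ (pow_ne_zero 4 (slope_ne h0)) (this.trans ?_)
  rw [slope]
  generalize val dx τ = d at *
  generalize hρ : 1 - τ ^ 2 = ρ at *
  field_simp
  ring

theorem wm_five_of_ne {A : ℝ} (hA : artanh τ / τ = A) : wm (slope τ) 5 =
    ((1 + τ ^ 2) ^ 5 * val dx τ - 15 * (1 + τ ^ 2) ^ 5 * (1 - τ ^ 2) ^ 2 +
      30 * (1 + τ ^ 2) ^ 3 * (1 - τ ^ 2) ^ 4 - 30 * (1 + τ ^ 2) ^ 2 * (1 - τ ^ 2) ^ 6 * A +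
      12 * (1 + τ ^ 2) * (1 - τ ^ 2) ^ 6) / (32 * τ ^ 5 * val dx τ) := by
  have h1 := (one_sub_sq_pos h).ne'
  have h2 : 1 + τ ^ 2 ≠ 0 := by positivity
  have hd := (val_dx_pos τ).ne'
  have := wm_of_eq h h0 (k := 5) (c₀ := -1) (c₁ := 5) (c₂ := -10) (c₃ := 10) (c₄ := -5) (c₅ := 1)
    (fun u => by ring)
  rw [hA] at this
  refine mul_left_cancel₀ (pow_ne_zero 5 (slope_ne h0)) (this.trans ?_)
  rw [slope]
  generalize val dx τ = d at *
  generalize hρ : 1 - τ ^ 2 = ρ at *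
  field_simp
  ring

theorem artanh_div_eq : artanh τ / τ =
    (105 - 55 * τ ^ 2 - (15 - 4 * τ ^ 2) * τ ^ 2 * tail τ) / val dn τ := by
  have hn := (val_dn_pos' h).ne'
  have h1 := tail_relation h
  rw [← val_dn] at h1
  rw [div_eq_div_iff h0 hn]
  linarith

theorem var_eq : wm (slope τ) 2 - wm (slope τ) 1 ^ 2 = 3 * (1 - τ ^ 2) ^ 4 / val dx τ ^ 2 := by
  have hd := (val_dx_pos τ).ne'
  rw [wm_one_of_ne h h0, wm_two_of_ne h h0, velT]
  field_simp
  rw [val_dx]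
  ring

/-- The Gram determinant of `1, μ, μ²` for the weight. -/
theorem gram_eq : (wm (slope τ) 2 - wm (slope τ) 1 ^ 2) * (wm (slope τ) 4 - wm (slope τ) 2 ^ 2) -
    (wm (slope τ) 3 - wm (slope τ) 2 * wm (slope τ) 1) ^ 2 =
    9 / 4 * (1 - τ ^ 2) ^ 10 * val eh τ / (val dx τ ^ 3 * val dn τ ^ 2) := by
  have hd := (val_dx_pos τ).ne'
  have hn := (val_dn_pos' h).ne'
  rw [var_eq h h0, wm_three_of_ne h h0 (artanh_div_eq h h0),
    wm_four_of_ne h h0 (artanh_div_eq h h0), wm_one_of_ne h h0, wm_two_of_ne h h0, velT]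
  field_simp
  rw [val_dn, val_eh, val_dx]
  ring

/-- The determinant with the pairings of `1, μ, μ²` with `μ³` in the last row; its quotient by
the Gram determinant is `c`. -/
theorem gram_mul_eq :
    (wm (slope τ) 2 - wm (slope τ) 1 ^ 2) * (wm (slope τ) 5 - wm (slope τ) 2 * wm (slope τ) 3) -
    (wm (slope τ) 3 - wm (slope τ) 2 * wm (slope τ) 1) *
      (wm (slope τ) 4 - wm (slope τ) 1 * wm (slope τ) 3) =
    27 / 4 * (1 - τ ^ 2) ^ 10 * τ * val nh τ / (val dx τ ^ 3 * val dn τ ^ 2) := by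
  have hd := (val_dx_pos τ).ne'
  have hn := (val_dn_pos' h).ne'
  rw [var_eq h h0, wm_three_of_ne h h0 (artanh_div_eq h h0),
    wm_four_of_ne h h0 (artanh_div_eq h h0), wm_five_of_ne h h0 (artanh_div_eq h h0),
    wm_one_of_ne h h0, wm_two_of_ne h h0, velT]
  field_simp
  rw [val_dn, val_nh, val_dx]
  ring

/-- The defining relation of `m`: at `E₂ = E₀ ℰ₂` the expansion has no quadratic term. -/
theorem mean_eq : wm (slope τ) 3 - velT τ ^ 3 - 3 * (1 - τ ^ 2) ^ 4 / val dx τ ^ 2 * cT τ =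
    mT τ := by
  have hd := (val_dx_pos τ).ne'
  have hn := (val_dn_pos' h).ne'
  have he := (val_eh_pos' h).ne'
  rw [wm_three_of_ne h h0 (artanh_div_eq h h0), velT, cT, mT]
  obtain ⟨y, hy⟩ : ∃ y, y = val kh τ := ⟨_, rfl⟩
  rw [← hy]
  simp [kh, val, point] at hy
  field_simp
  rw [hy, val_dn, val_nh, val_eh, val_dx]
  ring

end nonzero

theorem wm_zero (k : ℕ) : wm 0 k = (1 - (-1) ^ (k + 1)) / (2 * (k + 1)) := by
  have : ∀ μ : ℝ, μ ^ k * weight 0 μ = 1 / 2 * μ ^ k := fun μ => by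
    rw [weight]
    norm_num
    ring
  rw [wm, moment]
  simp only [this]
  rw [intervalIntegral.integral_const_mul, integral_pow]
  have : (k : ℝ) + 1 ≠ 0 := by positivity
  simp only [one_pow]
  field_simp

/-- The closed moment in terms of moments of the weight. -/
theorem E3_eq_wm {U : State} {a : ℝ} (ha : alpha U = a) (h : |a| < 1) :
    E3 U = U 0 * wm a 3 +
      f2 U * (wm a 5 - wm a 2 * wm a 3 - beta a * (wm a 4 - wm a 1 * wm a 3)) := by
  have hi : ∀ k : ℕ, IntervalIntegrable (fun μ => μ ^ k * weight a μ) volume (-1) 1 := fun k =>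
    intervalIntegrable_mul_weight h (continuous_pow k)
  have e : ∀ μ, μ ^ 3 * ansatz U μ = (U 0 - f2 U * (wm a 2 - beta a * wm a 1)) *
      (μ ^ 3 * weight a μ) + f2 U * (μ ^ 5 * weight a μ) -
        f2 U * beta a * (μ ^ 4 * weight a μ) := by
    intro μ
    rw [ansatz, ha, phi2]
    ring
  rw [E3, moment]
  simp only [e]
  rw [intervalIntegral.integral_sub (((hi 3).const_mul _).add ((hi 5).const_mul _))
    ((hi 4).const_mul _), intervalIntegral.integral_add ((hi 3).const_mul _) ((hi 5).const_mul _),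
    intervalIntegral.integral_const_mul, intervalIntegral.integral_const_mul,
    intervalIntegral.integral_const_mul]
  change _ * wm a 3 + _ * wm a 5 - _ * wm a 4 = _
  ring

/-- The closure is affine in `E₂`. -/
theorem E3_eq_of_alpha {U : State} (h : τ ∈ Ioo (-1 : ℝ) 1) (ha : alpha U = slope τ)
    (hU : U 0 ≠ 0) :
    E3 U = U 0 * (velT τ ^ 3 + mT τ + cT τ * (U 2 / U 0 - velT τ ^ 2)) := by
  rw [E3_eq_wm ha (abs_slope_lt h), f2, ha]
  by_cases h0 : τ = 0
  · subst h0
    have : slope 0 = 0 := by simp [slope]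
    rw [this, beta]
    simp only [wm_zero]
    norm_num [velT, mT, cT]
  · have e1 := var_eq h h0
    have e2 := gram_eq h h0
    have e3 := gram_mul_eq h h0
    have e4 := mean_eq h h0
    have w1 := wm_one_of_ne h h0
    have hr := (one_sub_sq_pos h).ne'
    have hd := (val_dx_pos τ).ne'
    have hn := (val_dn_pos' h).ne'
    have he := (val_eh_pos' h).ne'
    set a := slope τ
    have hS : wm a 2 - wm a 1 ^ 2 ≠ 0 := by
      rw [e1]
      positivity
    have f1 : wm a 4 - wm a 2 ^ 2 - beta a * (wm a 3 - wm a 1 * wm a 2) =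
        9 / 4 * (1 - τ ^ 2) ^ 10 * val eh τ / (val dx τ ^ 3 * val dn τ ^ 2) /
          (wm a 2 - wm a 1 ^ 2) := by
      rw [← e2, beta, eq_div_iff hS]
      field_simp
    have f2 : wm a 5 - wm a 2 * wm a 3 - beta a * (wm a 4 - wm a 1 * wm a 3) =
        27 / 4 * (1 - τ ^ 2) ^ 10 * τ * val nh τ / (val dx τ ^ 3 * val dn τ ^ 2) /
          (wm a 2 - wm a 1 ^ 2) := by
      rw [← e3, beta, eq_div_iff hS]
      field_simp
    have f3 : wm a 2 = 3 * (1 - τ ^ 2) ^ 4 / val dx τ ^ 2 + velT τ ^ 2 := by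
      rw [← e1, w1]
      ring
    have f4 : (U 2 - U 0 * wm a 2) / (9 / 4 * (1 - τ ^ 2) ^ 10 * val eh τ /
        (val dx τ ^ 3 * val dn τ ^ 2) / (wm a 2 - wm a 1 ^ 2)) * (27 / 4 * (1 - τ ^ 2) ^ 10 * τ *
        val nh τ / (val dx τ ^ 3 * val dn τ ^ 2) / (wm a 2 - wm a 1 ^ 2)) =
        (U 2 - U 0 * wm a 2) * cT τ := by
      rw [cT]
      generalize wm a 2 - wm a 1 ^ 2 = S at *
      generalize 1 - τ ^ 2 = ρ at *
      field_simp
      ring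
    rw [f1, f2, f4, f3, ← e4]
    field_simp
    ring

end
end M1P2

/-! ### The parameter as a function of the velocity -/

namespace M1P2

open Real Set Filter Topology M1P2.Poly Expr3 Box MeasureTheory

noncomputable section

/-- The boost velocity `b = -α` as a function of the velocity `x = E₁ / E₀`. -/
def boost (x : ℝ) : ℝ := 3 * x / (2 + √(4 - 3 * x ^ 2))

/-- The parameter `τ` as a function of the velocity. -/
def param (x : ℝ) : ℝ := boost x / (1 + √(1 - boost x ^ 2))

section param

variable {x : ℝ}

theorem boost_spec (hx : x ∈ Ioo (-1 : ℝ) 1) :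
    boost x ^ 2 < 1 ∧ 4 * boost x = x * (3 + boost x ^ 2) := by
  have h1 : 1 < 4 - 3 * x ^ 2 := by nlinarith [hx.1, hx.2]
  have h2 : √(4 - 3 * x ^ 2) ^ 2 = 4 - 3 * x ^ 2 := sq_sqrt (by linarith)
  have h3 : 1 < √(4 - 3 * x ^ 2) := by
    rw [lt_sqrt (by norm_num)]
    linarith
  rw [boost]
  set q := √(4 - 3 * x ^ 2)
  have h4 : (3 * x / (2 + q)) ^ 2 = 3 * (2 - q) / (2 + q) := by
    rw [div_pow, div_eq_div_iff (by positivity) (by positivity)]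
    linear_combination (3 * (2 + q)) * h2
  constructor
  · rw [h4, div_lt_one (by linarith)]
    linarith
  · rw [h4]
    field_simp
    ring

theorem param_spec (hx : x ∈ Ioo (-1 : ℝ) 1) :
    param x ∈ Ioo (-1 : ℝ) 1 ∧ 2 * param x / (1 + param x ^ 2) = boost x := by
  obtain ⟨h1, -⟩ := boost_spec hx
  have h2 : √(1 - boost x ^ 2) ^ 2 = 1 - boost x ^ 2 := sq_sqrt (by linarith)
  have h3 : 0 < √(1 - boost x ^ 2) := sqrt_pos.2 (by linarith)
  rw [param]
  set b := boost x
  set p := √(1 - b ^ 2)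
  have h4 : (b / (1 + p)) ^ 2 = (1 - p) / (1 + p) := by
    rw [div_pow, div_eq_div_iff (by positivity) (by positivity)]
    linear_combination (1 + p) * h2
  constructor
  · refine abs_lt.1 (sq_lt_one_iff_abs_lt_one _ |>.1 ?_)
    rw [h4, div_lt_one (by linarith)]
    linarith
  · rw [h4]
    field_simp
    ring

theorem velT_param (hx : x ∈ Ioo (-1 : ℝ) 1) : velT (param x) = x := by
  obtain ⟨-, h1⟩ := boost_spec hx
  obtain ⟨-, h2⟩ := param_spec hx
  rw [← h2] at h1
  rw [velT, div_eq_iff (val_dx_pos _).ne', val_dx]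
  have : 1 + param x ^ 2 ≠ 0 := by positivity
  field_simp at h1
  linear_combination h1

theorem boost_neg (x : ℝ) : boost (-x) = -boost x := by
  rw [boost, boost, neg_sq]
  ring

theorem param_neg (x : ℝ) : param (-x) = -param x := by
  rw [param, param, boost_neg, neg_sq]
  ring

theorem param_hasDerivAt (hx : x ∈ Ioo (-1 : ℝ) 1) :
    HasDerivAt param (velT' (param x))⁻¹ x := by
  refine HasDerivAt.of_local_left_inverse (f := velT) ?_ velT_hasDerivAt
    (velT'_pos (param_spec hx).1).ne' ?_
  · have h1 : ContinuousAt boost x := by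
      refine ContinuousAt.div (by fun_prop) (by fun_prop) ?_
      positivity
    refine ContinuousAt.div h1 (by fun_prop) ?_
    positivity
  · filter_upwards [Ioo_mem_nhds hx.1 hx.2] with y hy using velT_param hy

theorem comp_param_hasDerivAt (hx : x ∈ Ioo (-1 : ℝ) 1) {f f' : ℝ → ℝ}
    (hf : HasDerivAt f (f' (param x) * velT' (param x)) (param x)) :
    HasDerivAt (fun x => f (param x)) (f' (param x)) x := by
  refine (hf.comp x (param_hasDerivAt hx)).congr_deriv ?_
  rw [mul_assoc, mul_inv_cancel₀ (velT'_pos (param_spec hx).1).ne', mul_one]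

end param

section parity

variable {τ : ℝ} (h : τ ∈ Ioo (-1 : ℝ) 1)
include h

omit h in
theorem velT_neg : velT (-τ) = -velT τ := by
  rw [velT, velT, val_dx, val_dx, neg_sq]
  ring

theorem cT_neg : cT (-τ) = -cT τ := by
  rw [cT, cT, val_neg h, val_neg h]
  ring

theorem c1T_neg : c1T (-τ) = c1T τ := by
  simp only [c1T, val_neg h]

theorem mT_neg : mT (-τ) = -mT τ := by
  simp only [mT, val_neg h, neg_sq]
  ring

theorem m1T_neg : m1T (-τ) = m1T τ := by
  simp only [m1T, val_neg h, neg_sq]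

theorem neg_mem : -τ ∈ Ioo (-1 : ℝ) 1 := ⟨by linarith [h.2], by linarith [h.1]⟩

theorem c2T_neg : c2T (-τ) = -c2T τ := by
  by_cases h0 : τ = 0
  · simp [h0, c2T_zero]
  · refine mul_left_cancel₀ (neg_ne_zero.2 h0) ?_
    rw [mul_c2T (neg_mem h), neg_mul_neg, mul_c2T h]
    simp only [val_neg h, neg_sq]

theorem m2T_neg : m2T (-τ) = -m2T τ := by
  by_cases h0 : τ = 0
  · simp [h0, m2T_zero]
  · refine mul_left_cancel₀ (neg_ne_zero.2 h0) ?_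
    rw [mul_m2T (neg_mem h), neg_mul_neg, mul_m2T h]
    simp only [val_neg h]

theorem cubicT_neg (Y δ : ℝ) : cubicT (-τ) Y δ = -cubicT τ Y (-δ) := by
  simp only [cubicT, velT_neg, cT_neg h, c1T_neg h, mT_neg h, m1T_neg h]
  ring

theorem gnlT_neg (Y δ : ℝ) : gnlT (-τ) Y δ = gnlT τ Y (-δ) := by
  simp only [gnlT, velT_neg, cT_neg h, c1T_neg h, m2T_neg h, c2T_neg h]
  ring

theorem c1T_pos : 0 < c1T τ := by
  have := val_c1h_pos' h
  have := val_eh_pos' h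
  have := val_qx_pos τ
  have := val_dx_pos τ
  rw [c1T]
  positivity

theorem exists_separators_of_nonneg (h0 : 0 ≤ τ) {Y : ℝ} (hY : 0 < Y) (hY' : Y < 1 - velT τ ^ 2) :
    (∃ z < 0, 0 < cubicT τ Y z ∧ ∀ δ < z, cubicT τ Y δ = 0 → 0 < gnlT τ Y δ) ∧
      ∃ w > 0, cubicT τ Y w < 0 ∧ ∀ δ > w, cubicT τ Y δ = 0 → 0 < gnlT τ Y δ := by
  obtain ⟨z, hz, hz1, hz2⟩ := exists_separator ⟨h0, h.2⟩ hY hY'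
  -- `gnlT τ Y δ / δ` increases with `δ` on the negative axis
  have hleft : ∀ δ < z, 0 < gnlT τ Y δ := by
    intro δ hδ
    have h1 := c1T_pos h
    have h2 : gnlT τ Y δ * z - gnlT τ Y z * δ =
        (δ - z) * (2 * c1T τ * (δ * z) + 2 * c1T τ * Y) := by
      simp only [gnlT]
      ring
    have h3 : 0 < δ * z := mul_pos_of_neg_of_neg (hδ.trans hz) hz
    have h4 : (δ - z) * (2 * c1T τ * (δ * z) + 2 * c1T τ * Y) < 0 :=
      mul_neg_of_neg_of_pos (by linarith) (by positivity)
    by_contra! h5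
    nlinarith [mul_nonneg_of_nonpos_of_nonpos h5 hz.le,
      mul_nonneg hz2 (neg_nonneg.2 (hδ.trans hz).le)]
  refine ⟨⟨z, hz, hz1, fun δ hδ _ => hleft δ hδ⟩, ?_⟩
  rcases h0.eq_or_lt with h1 | h1
  · subst h1
    have e1 := cubicT_neg h Y
    have e2 := gnlT_neg h Y
    rw [neg_zero] at e1 e2
    refine ⟨-z, by linarith, ?_, fun δ hδ hr => ?_⟩
    · rw [e1, neg_neg]
      linarith
    · rw [e2]
      exact hleft _ (by linarith)
  · have h2 := mT_pos ⟨h1, h.2⟩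
    have h3 : ContinuousAt (cubicT τ Y) 0 := by
      unfold cubicT
      fun_prop
    have h4 : cubicT τ Y 0 < 0 := by
      simp only [cubicT]
      linarith
    obtain ⟨w, hw, hw'⟩ := ((h3.eventually_lt_const h4).filter_mono nhdsWithin_le_nhds |>.and
      (self_mem_nhdsWithin : Ioi (0 : ℝ) ∈ 𝓝[>] 0)).exists
    exact ⟨w, hw', hw, fun δ hδ hr => gnlT_pos_of_pos ⟨h1, h.2⟩ hY hY' (lt_trans hw' hδ) hr⟩

/-- The characteristic cubic is positive somewhere on the left of `δ = 0` and negative somewhere on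
the right, and the nonlinearity factor is positive at the zeros beyond these points. -/
theorem exists_separators {Y : ℝ} (hY : 0 < Y) (hY' : Y < 1 - velT τ ^ 2) :
    (∃ z < 0, 0 < cubicT τ Y z ∧ ∀ δ < z, cubicT τ Y δ = 0 → 0 < gnlT τ Y δ) ∧
      ∃ w > 0, cubicT τ Y w < 0 ∧ ∀ δ > w, cubicT τ Y δ = 0 → 0 < gnlT τ Y δ := by
  rcases le_or_gt 0 τ with h0 | h0
  · exact exists_separators_of_nonneg h h0 hY hY'
  · have h1 := neg_mem h
    obtain ⟨⟨z, hz, hz1, hz2⟩, w, hw, hw1, hw2⟩ :=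
      exists_separators_of_nonneg (τ := -τ) h1 (by linarith) hY (by rwa [velT_neg, neg_sq])
    have e1 := cubicT_neg h1 Y
    have e2 := gnlT_neg h1 Y
    rw [neg_neg] at e1 e2
    refine ⟨⟨-w, by linarith, ?_, fun δ hδ hr => ?_⟩, -z, by linarith, ?_, fun δ hδ hr => ?_⟩
    · rw [e1, neg_neg]
      linarith
    · rw [e2]
      refine hw2 _ (by linarith) ?_
      rw [e1] at hr
      linarith
    · rw [e1, neg_neg]
      linarith
    · rw [e2]
      refine hz2 _ (by linarith) ?_
      rw [e1] at hr
      linarith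

end parity

end
end M1P2

/-! ### The flux and its Jacobian -/

namespace M1P2

open Real Set Filter Topology M1P2.Poly Expr3 Box MeasureTheory

noncomputable section

/-- The states with `0 < E₀`, `E₁² < E₀ E₂` and `E₂ < E₀`; every realizable state is one. -/
def region : Set State := {U | 0 < U 0 ∧ U 1 ^ 2 < U 0 * U 2 ∧ U 2 < U 0}

/-- The variance `E₂ / E₀ - (E₁ / E₀)²`. -/
def spread (U : State) : ℝ := U 2 / U 0 - vel U ^ 2

theorem isOpen_region : IsOpen region := by
  refine (isOpen_lt continuous_const (continuous_apply 0)).inter (IsOpen.inter ?_ ?_)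
  · exact isOpen_lt ((continuous_apply 1).pow 2) ((continuous_apply 0).mul (continuous_apply 2))
  · exact isOpen_lt (continuous_apply 2) (continuous_apply 0)

section

variable {U : State} (hU : U ∈ region)
include hU

theorem vel_mem : vel U ∈ Ioo (-1 : ℝ) 1 := by
  obtain ⟨h0, h1, h2⟩ := hU
  refine abs_lt.1 (sq_lt_one_iff_abs_lt_one _ |>.1 ?_)
  rw [vel, div_pow, div_lt_one (by positivity)]
  nlinarith

theorem spread_pos : 0 < spread U := by
  obtain ⟨h0, h1, h2⟩ := hU
  rw [spread, vel, div_pow, sub_pos, div_lt_div_iff₀ (by positivity) h0]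
  nlinarith

theorem spread_lt : spread U < 1 - vel U ^ 2 := by
  obtain ⟨h0, h1, h2⟩ := hU
  have : U 2 / U 0 < 1 := (div_lt_one h0).2 h2
  rw [spread]
  linarith

theorem alpha_eq : alpha U = slope (param (vel U)) := by
  rw [slope, (param_spec (vel_mem hU)).2, boost, alpha, vel, neg_div]

theorem E3_eq : E3 U = U 0 * (vel U ^ 3 + mT (param (vel U)) + cT (param (vel U)) * spread U) := by
  rw [E3_eq_of_alpha (param_spec (vel_mem hU)).1 (alpha_eq hU) hU.1.ne', velT_param (vel_mem hU),
    spread]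

end

/-- The characteristic polynomial of the Jacobian, in a form that displays the velocity. -/
def charFun (U : State) (l : ℝ) : ℝ := cubicT (param (vel U)) (spread U) (l - vel U)

/-- The derivative of `E₃` at `U` in the direction `v`. -/
def gradE3 (U v : State) : ℝ :=
  v 0 * (vel U ^ 3 + mT (param (vel U)) + cT (param (vel U)) * spread U) +
    (3 * vel U ^ 2 + m1T (param (vel U)) + c1T (param (vel U)) * spread U) * (v 1 - vel U * v 0) +
    cT (param (vel U)) * (v 2 - U 2 / U 0 * v 0 - 2 * vel U * (v 1 - vel U * v 0))

section curves

variable {W : ℝ → State} {v : State} {S : Set ℝ} {t : ℝ} (hW : HasDerivWithinAt W v S t)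
  (hU : W t ∈ region)
include hW hU

theorem vel_hasDerivWithinAt :
    HasDerivWithinAt (fun t => vel (W t)) ((v 1 - vel (W t) * v 0) / W t 0) S t := by
  have h := hasDerivWithinAt_pi.1 hW
  have h0 := hU.1.ne'
  refine ((h 1).div (h 0) h0).congr_deriv ?_
  rw [vel]
  field_simp

theorem spread_hasDerivWithinAt : HasDerivWithinAt (fun t => spread (W t))
    ((v 2 - W t 2 / W t 0 * v 0 - 2 * vel (W t) * (v 1 - vel (W t) * v 0)) / W t 0) S t := by
  have h := hasDerivWithinAt_pi.1 hW
  have h0 := hU.1.ne'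
  refine (((h 2).div (h 0) h0).sub ((vel_hasDerivWithinAt hW hU).pow 2)).congr_deriv ?_
  field_simp
  ring

theorem comp_vel_hasDerivWithinAt {f f' : ℝ → ℝ}
    (hf : ∀ τ ∈ Ioo (-1 : ℝ) 1, HasDerivAt f (f' τ * velT' τ) τ) :
    HasDerivWithinAt (fun t => f (param (vel (W t))))
      (f' (param (vel (W t))) * ((v 1 - vel (W t) * v 0) / W t 0)) S t :=
  HasDerivAt.comp_hasDerivWithinAt (h₂ := fun x => f (param x)) t
    (comp_param_hasDerivAt (vel_mem hU) (hf _ (param_spec (vel_mem hU)).1))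
    (vel_hasDerivWithinAt hW hU)

theorem E3_formula_hasDerivWithinAt : HasDerivWithinAt (fun t => W t 0 * (vel (W t) ^ 3 +
    mT (param (vel (W t))) + cT (param (vel (W t))) * spread (W t))) (gradE3 (W t) v) S t := by
  have h0 := hU.1.ne'
  have hx := vel_hasDerivWithinAt hW hU
  have hY := spread_hasDerivWithinAt hW hU
  have hm := comp_vel_hasDerivWithinAt hW hU fun τ h => mT_hasDerivAt h
  have hc := comp_vel_hasDerivWithinAt hW hU fun τ h => cT_hasDerivAt h
  refine ((hasDerivWithinAt_pi.1 hW 0).mul (((hx.pow 3).add hm).add (hc.mul hY))).congr_deriv ?_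
  rw [gradE3]
  simp only [Pi.add_apply, Pi.mul_apply, Pi.pow_apply]
  field_simp
  ring

/-- Along the direction `(1, l, l²)` the derivative of the characteristic polynomial at the point
`l` is a multiple of the nonlinearity factor. -/
theorem charFun_hasDerivWithinAt {k l : ℝ} (hv : v = k • ![1, l, l ^ 2]) :
    HasDerivWithinAt (fun t => charFun (W t) l) (-(k * (l - vel (W t)) *
      gnlT (param (vel (W t))) (spread (W t)) (l - vel (W t)) / W t 0)) S t := by
  have h0 := hU.1.ne'
  have hx := vel_hasDerivWithinAt hW hU
  have hY := spread_hasDerivWithinAt hW hU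
  have hm := comp_vel_hasDerivWithinAt hW hU fun τ h => mT_hasDerivAt h
  have hc := comp_vel_hasDerivWithinAt hW hU fun τ h => cT_hasDerivAt h
  have hm1 := comp_vel_hasDerivWithinAt hW hU fun τ h => m1T_hasDerivAt h
  have hc1 := comp_vel_hasDerivWithinAt hW hU fun τ h => c1T_hasDerivAt h
  have hv0 : v 0 = k := by simp [hv]
  have hv1 : v 1 = k * l := by simp [hv]
  have hv2 : v 2 = k * l ^ 2 := by simp [hv]
  have hd := (hx.const_sub l)
  have hy : W t 2 / W t 0 = spread (W t) + vel (W t) ^ 2 := by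
    rw [spread]
    ring
  have hvT : ∀ᶠ t' in 𝓝[S] t, charFun (W t') l = (l - vel (W t')) ^ 3 +
      (3 * vel (W t') - cT (param (vel (W t')))) * (l - vel (W t')) ^ 2 -
      (m1T (param (vel (W t'))) + c1T (param (vel (W t'))) * spread (W t')) * (l - vel (W t')) -
      mT (param (vel (W t'))) := by
    filter_upwards [hW.continuousWithinAt.eventually (isOpen_region.mem_nhds hU)] with t' ht'
    rw [charFun, cubicT, velT_param (vel_mem ht')]
  refine (((((hd.pow 3).add (((hx.const_mul 3).sub hc).mul (hd.pow 2))).sub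
    ((hm1.add (hc1.mul hY)).mul hd)).sub hm).congr_of_eventuallyEq hvT ?_).congr_deriv ?_
  · rw [charFun, cubicT, velT_param (vel_mem hU)]
    rfl
  · rw [gnlT, velT_param (vel_mem hU)]
    simp only [Pi.add_apply, Pi.mul_apply, Pi.pow_apply, Pi.sub_apply, hv0, hv1, hv2, hy]
    field_simp
    ring

end curves

section flux

variable {U : State} (hU : U ∈ region)
include hU

theorem differentiableAt_E3 : DifferentiableAt ℝ E3 U := by
  have h0 := hU.1.ne'
  have hp : ∀ i : Fin 3, DifferentiableAt ℝ (fun U : State => U i) U := fun i =>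
    differentiableAt_apply i U
  have hx : DifferentiableAt ℝ vel U := ((hp 1).mul ((hp 0).inv h0)).congr_of_eventuallyEq
    (.of_forall fun U => div_eq_mul_inv _ _)
  have hY : DifferentiableAt ℝ spread U := (((hp 2).mul ((hp 0).inv h0)).sub
    (hx.pow 2)).congr_of_eventuallyEq (.of_forall fun U => by simp [spread, div_eq_mul_inv])
  have hm : DifferentiableAt ℝ (fun U => mT (param (vel U))) U :=
    (comp_param_hasDerivAt (vel_mem hU)
      (mT_hasDerivAt (param_spec (vel_mem hU)).1)).differentiableAt.comp U hx
  have hc : DifferentiableAt ℝ (fun U => cT (param (vel U))) U :=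
    (comp_param_hasDerivAt (vel_mem hU)
      (cT_hasDerivAt (param_spec (vel_mem hU)).1)).differentiableAt.comp U hx
  refine ((hp 0).mul (((hx.pow 3).add hm).add (hc.mul hY))).congr_of_eventuallyEq ?_
  filter_upwards [isOpen_region.mem_nhds hU] with U' hU' using E3_eq hU'

theorem fderiv_E3 (v : State) : fderiv ℝ E3 U v = gradE3 U v := by
  have h1 : HasDerivAt (fun t : ℝ => U + t • v) v 0 := by
    simpa using ((hasDerivAt_id (0 : ℝ)).smul_const v).const_add U
  have h2 : U + (0 : ℝ) • v = U := by simp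
  have h3 := (differentiableAt_E3 hU).hasFDerivAt
  rw [← h2] at h3
  have h4 := h3.comp_hasDerivAt (0 : ℝ) h1
  have hU0 : U + (0 : ℝ) • v ∈ region := by rwa [h2]
  have h5 := (E3_formula_hasDerivWithinAt (W := fun t : ℝ => U + t • v) (S := univ)
    h1.hasDerivWithinAt hU0).hasDerivAt univ_mem
  have h6 : HasDerivAt (E3 ∘ fun t : ℝ => U + t • v) (gradE3 (U + (0 : ℝ) • v) v) 0 := by
    refine h5.congr_of_eventuallyEq ?_
    filter_upwards [h1.continuousAt.eventually (isOpen_region.mem_nhds hU0)] with t ht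
    exact E3_eq ht
  have h7 := h4.unique h6
  rwa [h2] at h7

theorem differentiableAt_flux : DifferentiableAt ℝ flux U := by
  refine differentiableAt_pi.2 fun i => ?_
  fin_cases i
  · exact differentiableAt_apply 1 U
  · exact differentiableAt_apply 2 U
  · exact differentiableAt_E3 hU

theorem jacobian_eq : jacobian U = !![0, 1, 0; 0, 0, 1;
    gradE3 U (Pi.single 0 1), gradE3 U (Pi.single 1 1), gradE3 U (Pi.single 2 1)] := by
  have h0 : ∀ v : State, fderiv ℝ flux U v 0 = v 1 := fun v => by
    have h1 := ((hasFDerivAt_pi'.1 (differentiableAt_flux hU).hasFDerivAt) 0)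
    have h2 := h1.unique (hasFDerivAt_apply (𝕜 := ℝ) (1 : Fin 3) U)
    exact DFunLike.congr_fun h2 v
  have h1 : ∀ v : State, fderiv ℝ flux U v 1 = v 2 := fun v => by
    have h1 := ((hasFDerivAt_pi'.1 (differentiableAt_flux hU).hasFDerivAt) 1)
    have h2 := h1.unique (hasFDerivAt_apply (𝕜 := ℝ) (2 : Fin 3) U)
    exact DFunLike.congr_fun h2 v
  have h2 : ∀ v : State, fderiv ℝ flux U v 2 = gradE3 U v := fun v => by
    have h1 := ((hasFDerivAt_pi'.1 (differentiableAt_flux hU).hasFDerivAt) 2)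
    have h2 := h1.unique (differentiableAt_E3 hU).hasFDerivAt
    exact (DFunLike.congr_fun h2 v).trans (fderiv_E3 hU v)
  ext i j
  rw [jacobian, Matrix.of_apply]
  fin_cases i
  · simp only [Fin.zero_eta, h0]
    fin_cases j <;> simp
  · simp only [Fin.mk_one, h1]
    fin_cases j <;> simp
  · simp only [Fin.reduceFinMk, h2]
    fin_cases j <;> simp

omit hU in
theorem gradE3_linear (a b c : ℝ) : gradE3 U ![a, b, c] = a * gradE3 U (Pi.single 0 1) +
    b * gradE3 U (Pi.single 1 1) + c * gradE3 U (Pi.single 2 1) := by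
  simp [gradE3]
  ring

theorem charFun_eq (l : ℝ) : charFun U l = l ^ 3 - gradE3 U ![1, l, l ^ 2] := by
  have hy : U 2 / U 0 = spread U + vel U ^ 2 := by
    rw [spread]
    ring
  simp [gradE3, charFun, cubicT, velT_param (vel_mem hU), hy]
  ring

theorem eval_charpoly_jacobian (l : ℝ) : (jacobian U).charpoly.eval l = charFun U l := by
  rw [Matrix.eval_charpoly, jacobian_eq hU, charFun_eq hU, gradE3_linear, Matrix.det_fin_three]
  simp [Matrix.scalar_apply]
  ring

end flux

end
end M1P2

/-! ### Characteristic speeds -/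

namespace M1P2

open Real Set Filter Topology Polynomial MeasureTheory

noncomputable section

/-- A monic cubic with a positive value on the left of a negative value is a product of linear
factors with distinct zeros. -/
theorem cubic_factorization {f : ℝ → ℝ} {a b c : ℝ}
    (hf : ∀ x, f x = x ^ 3 + a * x ^ 2 + b * x + c) {z w : ℝ} (hzw : z < w)
    (hz : 0 < f z) (hw : f w < 0) :
    ∃ l₀ l₁ l₂ : ℝ, l₀ < z ∧ z < l₁ ∧ l₁ < w ∧ w < l₂ ∧
      ∀ x, f x = (x - l₀) * (x - l₁) * (x - l₂) := by
  have hcont : Continuous f := by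
    rw [funext hf]
    fun_prop
  set K := 1 + |a| + |b| + |c| + |z| + |w| with hK
  have ha := abs_nonneg a
  have hb := abs_nonneg b
  have hc := abs_nonneg c
  have hz' := abs_nonneg z
  have hw' := abs_nonneg w
  have hK1 : 1 ≤ K := by linarith
  have hKK : K ≤ K ^ 2 := by nlinarith
  have hbound : |a| * K ^ 2 + |b| * K + |c| < K ^ 3 := by
    have h1 : |b| * K ≤ |b| * K ^ 2 := by gcongr
    have h2 : |c| ≤ |c| * K ^ 2 := by nlinarith
    nlinarith [mul_nonneg hz' (sq_nonneg K), mul_nonneg hw' (sq_nonneg K)]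
  have h1 : f (-K) < 0 := by
    rw [hf]
    have := mul_le_mul_of_nonneg_right (le_abs_self a) (sq_nonneg K)
    have := mul_le_mul_of_nonneg_right (neg_abs_le b) (show 0 ≤ K by linarith)
    have := le_abs_self c
    nlinarith
  have h2 : 0 < f K := by
    rw [hf]
    have := mul_le_mul_of_nonneg_right (neg_abs_le a) (sq_nonneg K)
    have := mul_le_mul_of_nonneg_right (neg_abs_le b) (show 0 ≤ K by linarith)
    have := neg_abs_le c
    nlinarith
  have hKz : -K < z := by linarith [neg_abs_le z]
  have hwK : w < K := by linarith [le_abs_self w]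
  obtain ⟨l₀, ⟨-, h01⟩, h02⟩ := intermediate_value_Ioo hKz.le hcont.continuousOn ⟨h1, hz⟩
  obtain ⟨l₁, ⟨h10, h11⟩, h12⟩ := intermediate_value_Ioo' hzw.le hcont.continuousOn ⟨hw, hz⟩
  obtain ⟨l₂, ⟨h20, -⟩, h22⟩ := intermediate_value_Ioo hwK.le hcont.continuousOn ⟨hw, h2⟩
  refine ⟨l₀, l₁, l₂, h01, h10, h11, h20, fun x => ?_⟩
  -- divided differences of the three equations determine the coefficients
  rw [hf] at h02 h12 h22 ⊢
  have e1 : l₀ ^ 2 + l₀ * l₁ + l₁ ^ 2 + a * (l₀ + l₁) + b = 0 := by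
    refine mul_left_cancel₀ (sub_ne_zero.2 (h01.trans h10).ne') ?_
    linear_combination h12 - h02
  have e2 : l₁ ^ 2 + l₁ * l₂ + l₂ ^ 2 + a * (l₁ + l₂) + b = 0 := by
    refine mul_left_cancel₀ (sub_ne_zero.2 (h11.trans h20).ne') ?_
    linear_combination h22 - h12
  have e3 : l₀ + l₁ + l₂ + a = 0 := by
    refine mul_left_cancel₀ (sub_ne_zero.2 ((h01.trans h10).trans (h11.trans h20)).ne') ?_
    linear_combination e2 - e1
  linear_combination h02 + (x - l₀) * e1 + (x - l₀) * (x - l₁) * e3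

section speeds

variable {U : State} (hU : U ∈ region)

theorem charSpeed_eq_of_factorization {l₀ l₁ l₂ : ℝ} (h₁ : l₀ < l₁) (h₂ : l₁ < l₂)
    (h : ∀ x, (jacobian U).charpoly.eval x = (x - l₀) * (x - l₁) * (x - l₂)) :
    charSpeed 0 U = l₀ ∧ charSpeed 1 U = l₁ ∧ charSpeed 2 U = l₂ := by
  have h3 : (jacobian U).charpoly = (({l₀, l₁, l₂} : Multiset ℝ).map fun a => X - C a).prod := by
    refine Polynomial.funext fun x => ?_
    rw [h]
    simp [mul_assoc]
  have h4 : ({l₀, l₁, l₂} : Multiset ℝ).sort (· ≤ ·) = [l₀, l₁, l₂] := by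
    change Multiset.sort (([l₀, l₁, l₂] : List ℝ) : Multiset ℝ) (· ≤ ·) = _
    rw [Multiset.coe_sort]
    refine List.mergeSort_eq_self _ ?_
    simp [h₁.le, h₂.le, (h₁.trans h₂).le]
  have h5 : (jacobian U).charpoly.roots = {l₀, l₁, l₂} := by
    rw [h3]
    exact roots_multiset_prod_X_sub_C _
  simp only [charSpeed, h5, h4]
  exact ⟨rfl, rfl, rfl⟩

include hU

/-- The spectral picture: the characteristic polynomial has three distinct real zeros, the
velocity lies strictly between the first and the last, and the nonlinearity factor is positive at
the first. -/
theorem charFun_factorization : charSpeed 0 U < charSpeed 1 U ∧ charSpeed 1 U < charSpeed 2 U ∧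
    charSpeed 0 U < vel U ∧ vel U < charSpeed 2 U ∧
    (∀ l, charFun U l = (l - charSpeed 0 U) * (l - charSpeed 1 U) * (l - charSpeed 2 U)) ∧
    0 < gnlT (param (vel U)) (spread U) (charSpeed 0 U - vel U) := by
  obtain ⟨⟨z, hz, hz1, hz2⟩, w, hw, hw1, -⟩ :=
    exists_separators (param_spec (vel_mem hU)).1 (spread_pos hU) (by
      rw [velT_param (vel_mem hU)]
      exact spread_lt hU)
  obtain ⟨d₀, d₁, d₂, h0, h1, h2, h3, h4⟩ := cubic_factorization
    (f := cubicT (param (vel U)) (spread U)) (fun x => by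
      rw [cubicT, sub_eq_add_neg, sub_eq_add_neg, ← neg_mul]) (hz.trans hw) hz1 hw1
  obtain ⟨e0, e1, e2⟩ := charSpeed_eq_of_factorization (U := U) (l₀ := vel U + d₀)
    (l₁ := vel U + d₁) (l₂ := vel U + d₂) (by linarith) (by linarith) (fun x => by
      rw [eval_charpoly_jacobian hU, charFun, h4]
      ring)
  rw [e0, e1, e2]
  refine ⟨by linarith, by linarith, by linarith, by linarith, fun l => ?_, ?_⟩
  · rw [charFun, h4]
    ring
  · rw [add_sub_cancel_left]
    exact hz2 _ h0 (by rw [h4]; ring)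

theorem charSpeed_strictMono : StrictMono fun k : Fin 3 => charSpeed k U := by
  obtain ⟨h1, h2, -⟩ := charFun_factorization hU
  refine Fin.strictMono_iff_lt_succ.2 fun i => ?_
  fin_cases i
  · exact h1
  · exact h2

theorem charFun_charSpeed (k : Fin 3) : charFun U (charSpeed k U) = 0 := by
  obtain ⟨-, -, -, -, h, -⟩ := charFun_factorization hU
  rw [h]
  fin_cases k <;> simp

theorem jacobian_mulVec_eigvec (k : Fin 3) :
    (jacobian U).mulVec (eigvec k U) = charSpeed k U • eigvec k U := by
  have h := charFun_charSpeed hU k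
  rw [charFun_eq hU, gradE3_linear] at h
  rw [jacobian_eq hU, eigvec]
  ext i
  fin_cases i
  · simp [Matrix.mulVec, dotProduct, Fin.sum_univ_three]
  · simp [Matrix.mulVec, dotProduct, Fin.sum_univ_three]
    ring
  · simp [Matrix.mulVec, dotProduct, Fin.sum_univ_three]
    linear_combination -h

end speeds

section reflection

/-- The reflection `μ ↦ -μ` on states. -/
def reflect (U : State) : State := ![U 0, -U 1, U 2]

variable {U : State}

theorem vel_reflect : vel (reflect U) = -vel U := by simp [vel, reflect, neg_div]

theorem spread_reflect : spread (reflect U) = spread U := by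
  rw [spread, spread, vel_reflect, neg_sq]
  rfl

theorem press_reflect : press (reflect U) = press U := by simp [press, reflect]

theorem reflect_mem (hU : U ∈ region) : reflect U ∈ region := by
  simpa [region, reflect] using hU

theorem charFun_reflect (hU : U ∈ region) (l : ℝ) : charFun (reflect U) l = -charFun U (-l) := by
  rw [charFun, charFun, vel_reflect, spread_reflect, param_neg,
    cubicT_neg (param_spec (vel_mem hU)).1]
  ring_nf

theorem charSpeed_reflect (hU : U ∈ region) : charSpeed 0 (reflect U) = -charSpeed 2 U := by
  obtain ⟨h1, h2, -, -, h, -⟩ := charFun_factorization hU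
  refine (charSpeed_eq_of_factorization (l₁ := -charSpeed 1 U) (l₂ := -charSpeed 0 U)
    (by linarith) (by linarith) fun x => ?_).1
  rw [eval_charpoly_jacobian (reflect_mem hU), charFun_reflect hU, h]
  ring

end reflection

end
end M1P2

/-! ### Genuine nonlinearity and integral curves -/

namespace M1P2

open Real Set Filter Topology MeasureTheory

noncomputable section

section continuity

variable {U : State} (hU : U ∈ region)
include hU

theorem continuousAt_vel : ContinuousAt vel U :=
  (continuous_apply 1).continuousAt.div (continuous_apply 0).continuousAt hU.1.ne'

theorem continuousAt_charFun (l : ℝ) : ContinuousAt (fun U => charFun U l) U := by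
  have hx := continuousAt_vel hU
  have hY : ContinuousAt spread U :=
    ((continuous_apply 2).continuousAt.div (continuous_apply 0).continuousAt hU.1.ne').sub
      (hx.pow 2)
  have hτ := (param_spec (vel_mem hU)).1
  have key : ∀ {f : ℝ → ℝ}, ContinuousAt f (param (vel U)) →
      ContinuousAt (fun U => f (param (vel U))) U := fun {f} hf =>
    (ContinuousAt.comp (f := param) hf (param_hasDerivAt (vel_mem hU)).continuousAt).comp hx
  have h1 := key velT_hasDerivAt.continuousAt
  have h2 := key (cT_hasDerivAt hτ).continuousAt
  have h3 := key (c1T_hasDerivAt hτ).continuousAt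
  have h4 := key (mT_hasDerivAt hτ).continuousAt
  have h5 := key (m1T_hasDerivAt hτ).continuousAt
  unfold charFun cubicT
  fun_prop

/-- A point on the left of the velocity with a positive value of the characteristic polynomial
separates the first two eigenvalues. -/
theorem charSpeed_lt_of_charFun_pos {l : ℝ} (hl : l < vel U) (h : 0 < charFun U l) :
    charSpeed 0 U < l ∧ l < charSpeed 1 U := by
  obtain ⟨h1, h2, h3, h4, h5, -⟩ := charFun_factorization hU
  rw [h5] at h
  have h6 : (l - charSpeed 0 U) * (l - charSpeed 1 U) < 0 := by
    by_contra! h7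
    have := mul_nonpos_of_nonneg_of_nonpos h7 (show l - charSpeed 2 U ≤ 0 by linarith)
    linarith
  constructor
  · by_contra! h7
    have := mul_nonneg_of_nonpos_of_nonpos (show l - charSpeed 0 U ≤ 0 by linarith)
      (show l - charSpeed 1 U ≤ 0 by linarith)
    linarith
  · by_contra! h7
    have := mul_nonneg (show 0 ≤ l - charSpeed 0 U by linarith)
      (show 0 ≤ l - charSpeed 1 U by linarith)
    linarith

theorem charFun_pos_of_mem {l : ℝ} (h : charSpeed 0 U < l) (h' : l < charSpeed 1 U) :
    0 < charFun U l := by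
  obtain ⟨h1, h2, h3, h4, h5, -⟩ := charFun_factorization hU
  rw [h5]
  exact mul_pos_of_neg_of_neg (mul_neg_of_pos_of_neg (by linarith) (by linarith)) (by linarith)

theorem charFun_neg_of_lt {l : ℝ} (h : l < charSpeed 0 U) : charFun U l < 0 := by
  obtain ⟨h1, h2, h3, h4, h5, -⟩ := charFun_factorization hU
  rw [h5]
  exact mul_neg_of_pos_of_neg (mul_pos_of_neg_of_neg (by linarith) (by linarith)) (by linarith)

theorem eventually_separated {l : ℝ} (hl : l < vel U) (h : 0 < charFun U l) :
    ∀ᶠ U' in 𝓝 U, U' ∈ region ∧ charSpeed 0 U' < l ∧ l < charSpeed 1 U' := by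
  filter_upwards [isOpen_region.mem_nhds hU, (continuousAt_charFun hU l).eventually_const_lt h,
    (continuousAt_vel hU).eventually_const_lt hl] with U' h1 h2 h3
  exact ⟨h1, charSpeed_lt_of_charFun_pos h1 h3 h2⟩

theorem continuousAt_charSpeed : ContinuousAt (charSpeed 0) U := by
  obtain ⟨h1, h2, h3, h4, h5, -⟩ := charFun_factorization hU
  have key : ∀ b > charSpeed 0 U, ∃ l < b, l < vel U ∧ 0 < charFun U l := by
    intro b hb
    obtain ⟨l, hl, hl'⟩ := exists_between (lt_min (lt_min hb h1) h3)
    rw [lt_min_iff, lt_min_iff] at hl'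
    exact ⟨l, hl'.1.1, hl'.2, charFun_pos_of_mem hU hl hl'.1.2⟩
  refine tendsto_order.2 ⟨fun a ha => ?_, fun b hb => ?_⟩
  · obtain ⟨l, -, hl, hl'⟩ := key _ (lt_add_one _)
    filter_upwards [eventually_separated hU hl hl',
      (continuousAt_charFun hU a).eventually_lt_const (charFun_neg_of_lt hU ha)] with U' h6 h7
    by_contra! h8
    obtain ⟨h9, h10, h11⟩ := h6
    have hal : a < l := ha.trans (charSpeed_lt_of_charFun_pos hU hl hl').1
    rcases h8.eq_or_lt with h12 | h12
    · rw [← h12, charFun_charSpeed h9] at h7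
      exact lt_irrefl _ h7
    · exact lt_asymm h7 (charFun_pos_of_mem h9 h12 (hal.trans h11))
  · obtain ⟨l, hlb, hl, hl'⟩ := key b hb
    filter_upwards [eventually_separated hU hl hl'] with U' h6
    exact h6.2.1.trans hlb

end continuity

theorem eventually_pos_of_hasDerivWithinAt_pos {g : ℝ → ℝ} {g' : ℝ} {S : Set ℝ} {t : ℝ}
    (h : HasDerivWithinAt g g' S t) (hg : 0 < g') (h0 : g t = 0) :
    (∀ᶠ x in 𝓝[S ∩ Ioi t] t, 0 < g x) ∧ ∀ᶠ x in 𝓝[S ∩ Iio t] t, g x < 0 := by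
  have h1 := (hasDerivWithinAt_iff_tendsto_slope.1 h).eventually_const_lt hg
  constructor
  · filter_upwards [h1.filter_mono (nhdsWithin_mono _
      (show S ∩ Ioi t ⊆ S \ {t} from fun x hx => ⟨hx.1, ne_of_gt hx.2⟩)),
      self_mem_nhdsWithin] with x hx hx'
    rw [slope_def_field, h0, sub_zero] at hx
    exact (div_pos_iff_of_pos_right (sub_pos.2 hx'.2)).1 hx
  · filter_upwards [h1.filter_mono (nhdsWithin_mono _
      (show S ∩ Iio t ⊆ S \ {t} from fun x hx => ⟨hx.1, ne_of_lt hx.2⟩)),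
      self_mem_nhdsWithin] with x hx hx'
    rw [slope_def_field, h0, sub_zero] at hx
    by_contra! h2
    exact absurd hx (not_lt.2 (div_nonpos_of_nonneg_of_nonpos h2 (sub_nonpos.2 (le_of_lt hx'.2))))

section curves

variable {W : ℝ → State} {k : ℝ} {S : Set ℝ} {t : ℝ}

/-- Genuine nonlinearity of the first field: along the first eigenvector the first characteristic
speed decreases. -/
theorem charSpeed_lt_of_hasDerivWithinAt (hU : W t ∈ region)
    (hW : HasDerivWithinAt W (k • eigvec 0 (W t)) S t) :
    (0 < k → ∀ᶠ x in 𝓝[S ∩ Ioi t] t, charSpeed 0 (W x) < charSpeed 0 (W t)) ∧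
      (k < 0 → ∀ᶠ x in 𝓝[S ∩ Iio t] t, charSpeed 0 (W x) < charSpeed 0 (W t)) := by
  obtain ⟨h1, h2, h3, h4, h5, h6⟩ := charFun_factorization hU
  have hd := charFun_hasDerivWithinAt hW hU (k := k) (l := charSpeed 0 (W t)) rfl
  have h0 := charFun_charSpeed hU 0
  have hU0 := hU.1
  have hnear : ∀ᶠ x in 𝓝[S] t, W x ∈ region ∧ charSpeed 0 (W t) < vel (W x) :=
    (hW.continuousWithinAt.eventually (isOpen_region.mem_nhds hU)).and
      (((continuousAt_vel hU).comp_continuousWithinAt hW.continuousWithinAt).eventually_const_lt h3)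
  set D := (charSpeed 0 (W t) - vel (W t)) *
    gnlT (param (vel (W t))) (spread (W t)) (charSpeed 0 (W t) - vel (W t)) with hD
  have hneg : D < 0 := mul_neg_of_neg_of_pos (by linarith) h6
  rw [mul_assoc, ← hD] at hd
  constructor <;> intro hk
  · have h7 := (eventually_pos_of_hasDerivWithinAt_pos hd (by
      rw [neg_pos]
      exact div_neg_of_neg_of_pos (mul_neg_of_pos_of_neg hk hneg) hU0) h0).1
    filter_upwards [h7, hnear.filter_mono (nhdsWithin_mono _ inter_subset_left)] with x h8 h9
    exact (charSpeed_lt_of_charFun_pos h9.1 h9.2 h8).1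
  · have h7 := (eventually_pos_of_hasDerivWithinAt_pos hd.neg (by
      rw [neg_neg]
      exact div_pos (mul_pos_of_neg_of_neg hk hneg) hU0) (by rw [Pi.neg_apply, h0, neg_zero])).2
    filter_upwards [h7, hnear.filter_mono (nhdsWithin_mono _ inter_subset_left)] with x h8 h9
    exact (charSpeed_lt_of_charFun_pos h9.1 h9.2 (neg_lt_zero.1 h8)).1

theorem lt_of_hasDerivWithinAt_pos {g g' : ℝ → ℝ}
    (h : ∀ t ∈ Icc (0 : ℝ) 1, HasDerivWithinAt g (g' t) (Icc 0 1) t)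
    (hg : ∀ t ∈ Icc (0 : ℝ) 1, 0 < g' t) : g 0 < g 1 := by
  refine strictMonoOn_of_deriv_pos (convex_Icc 0 1) (fun t ht => (h t ht).continuousWithinAt)
    (fun t ht => ?_) (left_mem_Icc.2 zero_le_one) (right_mem_Icc.2 zero_le_one) zero_lt_one
  rw [((h t (interior_subset ht)).hasDerivAt (mem_interior_iff_mem_nhds.1 ht)).deriv]
  exact hg t (interior_subset ht)

theorem press_hasDerivWithinAt {v : State} (hW : HasDerivWithinAt W v S t) (hU : W t ∈ region) :
    HasDerivWithinAt (fun t => press (W t))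
      (v 2 - 2 * vel (W t) * v 1 + vel (W t) ^ 2 * v 0) S t := by
  have h := hasDerivWithinAt_pi.1 hW
  have h0 := hU.1.ne'
  refine ((h 2).sub (((h 1).pow 2).div (h 0) h0)).congr_deriv ?_
  rw [vel]
  simp only [Pi.pow_apply]
  field_simp
  ring

/-- Along an integral curve of the first eigenvector field, oriented by increasing `E₀`, the
characteristic speed and the velocity decrease and the pressure increases. -/
theorem integralCurve (hU : ∀ t ∈ Icc (0 : ℝ) 1, W t ∈ region) {C : ℝ → ℝ}
    (hC : ∀ t ∈ Icc (0 : ℝ) 1, 0 < C t)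
    (hW : ∀ t ∈ Icc (0 : ℝ) 1, HasDerivWithinAt W (C t • eigvec 0 (W t)) (Icc 0 1) t) :
    charSpeed 0 (W 1) < charSpeed 0 (W 0) ∧ W 0 0 < W 1 0 ∧ vel (W 1) < vel (W 0) ∧
      press (W 0) < press (W 1) := by
  have hlt : ∀ t ∈ Icc (0 : ℝ) 1, charSpeed 0 (W t) < vel (W t) := fun t ht =>
    (charFun_factorization (hU t ht)).2.2.1
  refine ⟨?_, ?_, ?_, ?_⟩
  · have hcont : ContinuousOn (fun t => charSpeed 0 (W t)) (Icc 0 1) := fun t ht =>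
      (continuousAt_charSpeed (hU t ht)).comp_continuousWithinAt (hW t ht).continuousWithinAt
    -- no point other than `1` is a minimum of the characteristic speed
    have hdec : ∀ t ∈ Ico (0 : ℝ) 1, ∃ x ∈ Icc (0 : ℝ) 1,
        charSpeed 0 (W x) < charSpeed 0 (W t) := by
      intro t ht
      have ht' : t ∈ Icc (0 : ℝ) 1 := ⟨ht.1, ht.2.le⟩
      have h1 := (charSpeed_lt_of_hasDerivWithinAt (hU t ht') (hW t ht')).1 (hC t ht')
      have h2 : (𝓝[Icc 0 1 ∩ Ioi t] t).NeBot := by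
        refine NeBot.mono (nhdsGT_neBot t) ?_
        rw [← nhdsWithin_Ioc_eq_nhdsGT ht.2]
        exact nhdsWithin_mono _ fun x hx => ⟨⟨ht.1.trans hx.1.le, hx.2⟩, hx.1⟩
      obtain ⟨x, hx, hx'⟩ := (h1.and self_mem_nhdsWithin).exists
      exact ⟨x, hx'.1, hx⟩
    obtain ⟨c, hc, hmin⟩ := isCompact_Icc.exists_isMinOn (nonempty_Icc.2 zero_le_one) hcont
    have hc1 : c = 1 := by
      by_contra hne
      obtain ⟨x, hx, hx'⟩ := hdec c ⟨hc.1, lt_of_le_of_ne hc.2 hne⟩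
      exact absurd (hmin hx) (not_le.2 hx')
    subst hc1
    by_contra! h
    obtain ⟨x, hx, hx'⟩ := hdec 0 ⟨le_rfl, one_pos⟩
    exact absurd (hmin hx) (not_le.2 (hx'.trans_le h))
  · refine lt_of_hasDerivWithinAt_pos (g := fun t => W t 0) (g' := C)
      (fun t ht => ?_) hC
    simpa [eigvec] using hasDerivWithinAt_pi.1 (hW t ht) 0
  · have := lt_of_hasDerivWithinAt_pos (g := fun t => -vel (W t)) (g' := fun t =>
      C t * (vel (W t) - charSpeed 0 (W t)) / W t 0) (fun t ht => ?_) fun t ht => ?_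
    · exact neg_lt_neg_iff.1 this
    · refine (vel_hasDerivWithinAt (hW t ht) (hU t ht)).neg.congr_deriv ?_
      simp [eigvec]
      ring
    · have h1 := hlt t ht
      have h2 := hC t ht
      have h3 := (hU t ht).1
      exact div_pos (mul_pos h2 (by linarith)) h3
  · refine lt_of_hasDerivWithinAt_pos (g := fun t => press (W t)) (g' := fun t =>
      C t * (vel (W t) - charSpeed 0 (W t)) ^ 2) (fun t ht => ?_) fun t ht => ?_
    · refine (press_hasDerivWithinAt (hW t ht) (hU t ht)).congr_deriv ?_
      simp [eigvec]
      ring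
    · exact mul_pos (hC t ht) (pow_pos (by linarith [hlt t ht]) 2)

end curves

end
end M1P2

/-! ### Realizable states and waves -/

namespace M1P2

open Real Set Filter Topology MeasureTheory

noncomputable section

section realizable

/-- A continuous function that is positive on `(-1, 1)` except at one point has a positive integral
against a positive intensity. -/
theorem integral_mul_pos {I g : ℝ → ℝ} (hI : IntegrableOn I (Icc (-1) 1))
    (hpos : ∀ μ ∈ Icc (-1 : ℝ) 1, 0 < I μ) (hg : Continuous g) {a : ℝ}
    (hg' : ∀ μ ∈ Ioo (-1 : ℝ) 1, μ ≠ a → 0 < g μ) : 0 < ∫ μ in (-1 : ℝ)..1, g μ * I μ := by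
  have hint : IntegrableOn (fun μ => g μ * I μ) (Icc (-1) 1) :=
    hI.continuousOn_mul hg.continuousOn isCompact_Icc
  have hae : ∀ᵐ μ ∂(volume.restrict (Ioo (-1 : ℝ) 1)), 0 < g μ * I μ := by
    rw [ae_restrict_iff' measurableSet_Ioo]
    filter_upwards [compl_mem_ae_iff.2 (Real.volume_singleton (a := a))] with μ h1 h2
    exact mul_pos (hg' μ h2 h1) (hpos μ (Ioo_subset_Icc_self h2))
  rw [intervalIntegral.integral_of_le (by norm_num), ← integral_Icc_eq_integral_Ioc,
    integral_Icc_eq_integral_Ioo]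
  rw [integral_pos_iff_support_of_nonneg_ae (hae.mono fun μ h => h.le)
    (hint.mono_set Ioo_subset_Icc_self)]
  refine lt_of_lt_of_eq (b := volume.restrict (Ioo (-1 : ℝ) 1) univ) ?_
    (measure_eq_measure_of_null_sdiff (subset_univ _) ?_).symm
  · simp
  · rw [← compl_eq_univ_sdiff]
    refine measure_mono_null (fun μ hμ => ?_) hae
    simp only [Function.mem_support, mem_compl_iff, not_not] at hμ
    simp [hμ]

/-- The Cauchy-Schwarz inequality is strict because a positive intensity is not concentrated at
a point. -/
theorem realizable_subset_region : realizable ⊆ region := by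
  rintro U ⟨I, hI, hpos, hU⟩
  have h0 := hU 0
  have h1 := hU 1
  have h2 := hU 2
  simp only [moment, Fin.val_zero, pow_zero, one_mul] at h0
  simp only [moment, Fin.val_one, pow_one] at h1
  simp only [moment, Fin.val_two] at h2
  have hi : ∀ k : ℕ, IntervalIntegrable (fun μ => μ ^ k * I μ) volume (-1) 1 := fun k => by
    rw [intervalIntegrable_iff_integrableOn_Icc_of_le (by norm_num)]
    exact hI.continuousOn_mul (continuous_pow k).continuousOn isCompact_Icc
  have i0 : IntervalIntegrable I volume (-1) 1 := by simpa using hi 0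
  have i1 : IntervalIntegrable (fun μ => μ * I μ) volume (-1) 1 := by simpa using hi 1
  have p0 : 0 < U 0 := by
    rw [← h0]
    simpa using integral_mul_pos hI hpos continuous_const (g := fun _ => 1) (a := 2)
      (by simp)
  have p2 : U 2 < U 0 := by
    have := integral_mul_pos hI hpos (g := fun μ => 1 - μ ^ 2) (by fun_prop) (a := 2)
      (fun μ hμ _ => by nlinarith [hμ.1, hμ.2])
    simp only [sub_mul, one_mul] at this
    rw [intervalIntegral.integral_sub i0 (hi 2), h0, h2] at this
    linarith
  refine ⟨p0, ?_, p2⟩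
  have := integral_mul_pos hI hpos (g := fun μ => (U 0 * μ - U 1) ^ 2) (by fun_prop)
    (a := U 1 / U 0) (fun μ _ hμ => by
      refine sq_pos_iff.2 (sub_ne_zero.2 fun h => hμ ?_)
      rw [← h, mul_div_cancel_left₀ _ p0.ne'])
  have e : ∀ μ, (U 0 * μ - U 1) ^ 2 * I μ = U 0 ^ 2 * (μ ^ 2 * I μ) - 2 * U 0 * U 1 * (μ * I μ) +
      U 1 ^ 2 * I μ := fun μ => by ring
  simp only [e] at this
  rw [intervalIntegral.integral_add (((hi 2).const_mul _).sub (i1.const_mul _)) (i0.const_mul _),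
    intervalIntegral.integral_sub ((hi 2).const_mul _) (i1.const_mul _),
    intervalIntegral.integral_const_mul, intervalIntegral.integral_const_mul,
    intervalIntegral.integral_const_mul, h0, h1, h2] at this
  have h3 : 0 < U 0 * (U 0 * U 2 - U 1 ^ 2) := by linarith
  linarith [pos_of_mul_pos_right h3 p0.le]

theorem convex_region : Convex ℝ region := by
  rintro U ⟨a0, a1, a2⟩ W ⟨b0, b1, b2⟩ a b ha hb hab
  rcases ha.eq_or_lt with rfl | ha
  · obtain rfl : b = 1 := by linarith
    rw [zero_smul, zero_add, one_smul]
    exact ⟨b0, b1, b2⟩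
  -- the mixed term, by the inequality between the geometric and the arithmetic mean
  have h : 2 * (U 1 * W 1) ≤ U 0 * W 2 + W 0 * U 2 := by
    have c2 : 0 < U 2 := pos_of_mul_pos_right ((sq_nonneg _).trans_lt a1) a0.le
    have d2 : 0 < W 2 := pos_of_mul_pos_right ((sq_nonneg _).trans_lt b1) b0.le
    refine le_of_sq_le_sq ?_ (by positivity)
    nlinarith [mul_le_mul a1.le b1.le (sq_nonneg _) (by positivity),
      sq_nonneg (U 0 * W 2 - W 0 * U 2)]
  simp only [region, mem_ofPred_eq, Pi.add_apply, Pi.smul_apply, smul_eq_mul]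
  refine ⟨by positivity, ?_, by nlinarith⟩
  nlinarith [mul_nonneg (mul_nonneg ha.le hb) (sub_nonneg.2 h),
    mul_pos (pow_pos ha 2) (sub_pos.2 a1), mul_nonneg (sq_nonneg b) (sub_nonneg.2 b1.le)]

end realizable

section waves

/-- An integral curve of the first eigenvector field in the region, with a factor of constant
sign, parametrised by the interval between `0` and `z`: if the characteristic speed is larger at
`z`, then `E₀` decreases from `0` to `z`. -/
theorem integralCurve_uIcc {z : ℝ} {V : ℝ → State} {C : ℝ → ℝ}
    (hU : ∀ t ∈ uIcc 0 z, V t ∈ region)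
    (hV : ∀ t ∈ uIcc 0 z, HasDerivWithinAt V (C t • eigvec 0 (V t)) (uIcc 0 z) t)
    (hC : (∀ t ∈ uIcc 0 z, 0 < C t) ∨ ∀ t ∈ uIcc 0 z, C t < 0)
    (hs : charSpeed 0 (V 0) < charSpeed 0 (V z)) :
    V z 0 < V 0 0 ∧ vel (V 0) < vel (V z) ∧ press (V z) < press (V 0) := by
  have key : ∀ a b : ℝ, (∀ t ∈ Icc (0 : ℝ) 1, a + b * t ∈ uIcc 0 z) →
      (∀ t ∈ Icc (0 : ℝ) 1, 0 < b * C (a + b * t)) →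
      charSpeed 0 (V (a + b)) < charSpeed 0 (V a) ∧ V a 0 < V (a + b) 0 ∧
        vel (V (a + b)) < vel (V a) ∧ press (V a) < press (V (a + b)) := by
    intro a b h1 h2
    have h3 := integralCurve (W := fun t => V (a + b * t)) (fun t ht => hU _ (h1 t ht)) h2
      (fun t ht => by
        have h4 : HasDerivWithinAt (fun t : ℝ => a + b * t) b (Icc 0 1) t := by
          simpa using ((hasDerivWithinAt_id t (Icc (0 : ℝ) 1)).const_mul b).const_add a
        have h5 := (hV _ (h1 t ht)).scomp t h4 h1
        rwa [smul_smul] at h5)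
    simpa using h3
  rcases lt_trichotomy z 0 with hz | rfl | hz
  · rw [uIcc_of_ge hz.le] at hC key
    have m1 : ∀ t ∈ Icc (0 : ℝ) 1, 0 + z * t ∈ Icc z 0 := fun t ht =>
      ⟨by nlinarith [ht.1, ht.2], by nlinarith [ht.1, ht.2]⟩
    have m2 : ∀ t ∈ Icc (0 : ℝ) 1, z + -z * t ∈ Icc z 0 := fun t ht =>
      ⟨by nlinarith [ht.1, ht.2], by nlinarith [ht.1, ht.2]⟩
    rcases hC with hC | hC
    · have := key z (-z) m2 fun t ht => mul_pos (by linarith) (hC _ (m2 t ht))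
      rw [add_neg_cancel] at this
      exact this.2
    · have := key 0 z m1 fun t ht => mul_pos_of_neg_of_neg hz (hC _ (m1 t ht))
      rw [zero_add] at this
      exact absurd this.1 (lt_asymm hs)
  · exact absurd hs (lt_irrefl _)
  · rw [uIcc_of_le hz.le] at hC key
    have m1 : ∀ t ∈ Icc (0 : ℝ) 1, 0 + z * t ∈ Icc 0 z := fun t ht =>
      ⟨by nlinarith [ht.1, ht.2], by nlinarith [ht.1, ht.2]⟩
    have m2 : ∀ t ∈ Icc (0 : ℝ) 1, z + -z * t ∈ Icc 0 z := fun t ht =>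
      ⟨by nlinarith [ht.1, ht.2], by nlinarith [ht.1, ht.2]⟩
    rcases hC with hC | hC
    · have := key 0 z m1 fun t ht => mul_pos hz (hC _ (m1 t ht))
      rw [zero_add] at this
      exact absurd this.1 (lt_asymm hs)
    · have := key z (-z) m2 fun t ht => mul_pos_of_neg_of_neg (by linarith) (hC _ (m2 t ht))
      rw [add_neg_cancel] at this
      exact this.2

theorem rarefaction_zero {UL UR : State} (h : IsRarefaction 0 UL UR) :
    UR 0 < UL 0 ∧ vel UL < vel UR ∧ press UR < press UL := by
  obtain ⟨⟨z, V, C, rfl, rfl, hU, hV, hC⟩, hs⟩ := h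
  exact integralCurve_uIcc (fun t ht => realizable_subset_region (hU t ht)) hV hC hs

theorem rarefaction_two {UL UR : State} (h : IsRarefaction 2 UL UR) :
    UL 0 < UR 0 ∧ vel UL < vel UR ∧ press UL < press UR := by
  obtain ⟨⟨z, V, C, rfl, rfl, hU, hV, hC⟩, hs⟩ := h
  have hU' : ∀ t ∈ uIcc 0 z, V t ∈ region := fun t ht => realizable_subset_region (hU t ht)
  -- the reflected curve, run backwards
  have hm : MapsTo (fun t => z - t) (uIcc 0 z) (uIcc 0 z) := by
    intro t ht
    rw [mem_uIcc] at ht ⊢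
    rcases ht with ht | ht
    · exact Or.inl ⟨by linarith, by linarith⟩
    · exact Or.inr ⟨by linarith, by linarith⟩
  have h1 := integralCurve_uIcc (z := z) (V := fun t => reflect (V (z - t)))
    (C := fun t => -C (z - t)) (fun t ht => reflect_mem (hU' _ (hm ht))) (fun t ht => by
      have h2 : HasDerivWithinAt (fun t : ℝ => z - t) (-1) (uIcc 0 z) t :=
        (hasDerivWithinAt_id t _).const_sub z
      have h3 := hasDerivWithinAt_pi.1 ((hV _ (hm ht)).scomp t h2 hm)
      have h4 := charSpeed_reflect (hU' _ (hm ht))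
      have e : eigvec 0 (reflect (V (z - t))) =
          ![1, -charSpeed 2 (V (z - t)), charSpeed 2 (V (z - t)) ^ 2] := by
        rw [eigvec, h4, neg_sq]
      refine hasDerivWithinAt_pi.2 fun i => ?_
      simp only [e]
      fin_cases i
      · refine HasDerivWithinAt.congr_deriv (f := fun t => V (z - t) 0) (h3 0) ?_
        simp [eigvec]
      · refine HasDerivWithinAt.congr_deriv (f := fun t => -V (z - t) 1) (h3 1).neg ?_
        simp [eigvec]
      · refine HasDerivWithinAt.congr_deriv (f := fun t => V (z - t) 2) (h3 2) ?_
        simp [eigvec])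
    (hC.symm.imp (fun h t ht => neg_pos.2 (h _ (hm ht))) fun h t ht => neg_lt_zero.2 (h _ (hm ht)))
    (by
      simp only [sub_zero, sub_self]
      rw [charSpeed_reflect (hU' _ right_mem_uIcc), charSpeed_reflect (hU' _ left_mem_uIcc)]
      linarith)
  simp only [sub_zero, sub_self, vel_reflect, press_reflect] at h1
  refine ⟨by simpa [reflect] using h1.1, by linarith [h1.2.1], h1.2.2⟩

/-- The shock relations for the first field: on the segment between the two states, the first
characteristic speed can only cross the shock speed downwards in the direction of increasing
`E₀`. -/
theorem shock_of_sub_eq_smul {UL UR : State} (hL : UL ∈ region) (hR : UR ∈ region) {s k : ℝ}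
    (hk : UR - UL = k • ![1, s, s ^ 2]) (h1 : charSpeed 0 UR < s) (h2 : s < charSpeed 0 UL) :
    UL 0 < UR 0 ∧ vel UR < vel UL ∧ press UL < press UR := by
  have e0 : UR 0 = UL 0 + k := by
    have := congrFun hk 0
    simp at this
    linarith
  have e1 : UR 1 = UL 1 + k * s := by
    have := congrFun hk 1
    simp at this
    linarith
  have e2 : UR 2 = UL 2 + k * s ^ 2 := by
    have := congrFun hk 2
    simp at this
    linarith
  -- if `k < 0`, then at the first crossing the speed would have been below `s` before
  have hk0 : 0 < k := by
    by_contra! hk0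
    rcases hk0.eq_or_lt with rfl | hk0
    · have : UR = UL := by
        rw [zero_smul, sub_eq_zero] at hk
        exact hk
      rw [this] at h1
      exact lt_asymm h1 h2
    set W : ℝ → State := fun t => UL + t • (UR - UL) with hWdef
    have hU : ∀ t ∈ Icc (0 : ℝ) 1, W t ∈ region := fun t ht =>
      convex_region.add_smul_sub_mem hL hR ht
    have hW : ∀ t, HasDerivAt W (UR - UL) t := fun t =>
      (((hasDerivAt_id t).smul_const (UR - UL)).const_add UL).congr_deriv (one_smul _ _)
    have hcont : ContinuousOn (fun t => charSpeed 0 (W t)) (Icc 0 1) := fun t ht =>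
      (ContinuousAt.comp (f := W) (continuousAt_charSpeed (hU t ht))
        (hW t).continuousAt).continuousWithinAt
    have hW0 : W 0 = UL := by simp [hWdef]
    have hW1 : W 1 = UR := by simp [hWdef]
    -- the first point where the characteristic speed is not above the shock speed
    obtain ⟨T, ⟨hT, hTs⟩, hleast⟩ : ∃ T, IsLeast (Icc 0 1 ∩ {t | charSpeed 0 (W t) ≤ s}) T := by
      refine IsCompact.exists_isLeast ?_ ⟨1, right_mem_Icc.2 zero_le_one, ?_⟩
      · exact isCompact_Icc.of_isClosed_subset
          (hcont.preimage_isClosed_of_isClosed isClosed_Icc isClosed_Iic) inter_subset_left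
      · simpa [hW1] using h1.le
    have hT0 : 0 < T := by
      refine lt_of_le_of_ne hT.1 fun h => ?_
      rw [← h] at hTs
      simp only [mem_ofPred_eq, hW0] at hTs
      linarith
    have hbefore : ∀ t ∈ Ico 0 T, s < charSpeed 0 (W t) := fun t ht => by
      by_contra! h
      exact absurd (hleast ⟨⟨ht.1, ht.2.le.trans hT.2⟩, h⟩) (not_le.2 ht.2)
    have hne : (𝓝[Icc 0 1 ∩ Iio T] T).NeBot := by
      refine NeBot.mono (nhdsLT_neBot T) ?_
      rw [← nhdsWithin_Ico_eq_nhdsLT hT0]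
      exact nhdsWithin_mono _ fun x hx => ⟨⟨hx.1, hx.2.le.trans hT.2⟩, hx.2⟩
    have heq : charSpeed 0 (W T) = s := by
      refine le_antisymm hTs (ge_of_tendsto ((hcont T hT).mono_left
        (nhdsWithin_mono _ (inter_subset_left (t := Iio T)))) ?_)
      filter_upwards [self_mem_nhdsWithin] with t ht
      exact (hbefore t ⟨ht.1.1, ht.2⟩).le
    have hd := (charSpeed_lt_of_hasDerivWithinAt (k := k) (S := Icc 0 1) (hU T hT) (by
      rw [eigvec, heq, ← hk]
      exact (hW T).hasDerivWithinAt)).2 hk0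
    obtain ⟨x, hx, hx'⟩ := (hd.and self_mem_nhdsWithin).exists
    rw [heq] at hx
    exact lt_asymm hx (hbefore x ⟨hx'.1.1, hx'.2⟩)
  have hvel := (charFun_factorization hL).2.2.1
  have hL0 := hL.1
  have hR0 := hR.1
  have h3 : s < vel UL := h2.trans hvel
  have hx : UL 1 = vel UL * UL 0 := by
    rw [vel]
    field_simp
  refine ⟨by linarith, ?_, ?_⟩
  · rw [vel, div_lt_iff₀ hR0, e1, e0, hx]
    nlinarith
  · have : press UR - press UL = k * UL 0 * (s - vel UL) ^ 2 / UR 0 := by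
      rw [press, press, e2, e1, hx]
      field_simp
      rw [e0]
      ring
    have h4 : 0 < press UR - press UL := by
      rw [this]
      have : 0 < (s - vel UL) ^ 2 := by
        have : s - vel UL ≠ 0 := by linarith
        positivity
      positivity
    linarith

theorem sub_eq_smul_of_rankineHugoniot {UL UR : State} {s : ℝ}
    (h : flux UR - flux UL = s • (UR - UL)) : UR - UL = (UR 0 - UL 0) • ![1, s, s ^ 2] := by
  have h0 := congrFun h 0
  have h1 := congrFun h 1
  simp [flux] at h0 h1
  ext i
  fin_cases i
  · simp
  · simp
    linarith
  · simp
    rw [h1, h0]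
    ring

theorem shock_zero {UL UR : State} (h : IsShock 0 UL UR) :
    UL 0 < UR 0 ∧ vel UR < vel UL ∧ press UL < press UR := by
  obtain ⟨hL, hR, s, hs, h1, h2⟩ := h
  exact shock_of_sub_eq_smul (realizable_subset_region hL) (realizable_subset_region hR)
    (sub_eq_smul_of_rankineHugoniot hs) h1 h2

theorem shock_two {UL UR : State} (h : IsShock 2 UL UR) :
    UR 0 < UL 0 ∧ vel UR < vel UL ∧ press UR < press UL := by
  obtain ⟨hL, hR, s, hs, h1, h2⟩ := h
  have hL' := realizable_subset_region hL
  have hR' := realizable_subset_region hR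
  have hd := sub_eq_smul_of_rankineHugoniot hs
  have h3 := shock_of_sub_eq_smul (reflect_mem hR') (reflect_mem hL') (s := -s)
    (k := UL 0 - UR 0) (by
      have d1 := congrFun hd 1
      have d2 := congrFun hd 2
      simp at d1 d2
      ext i
      fin_cases i
      · simp [reflect]
      · simp [reflect]
        linarith
      · simp [reflect]
        linarith)
    (by rw [charSpeed_reflect hL']; linarith) (by rw [charSpeed_reflect hR']; linarith)
  simp only [vel_reflect, press_reflect] at h3
  exact ⟨by simpa [reflect] using h3.1, by linarith [h3.2.1], h3.2.2⟩

end waves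

end

end M1P2

theorem mainTheorem4 :
    (∀ U ∈ M1P2.realizable,
      DifferentiableAt ℝ M1P2.flux U ∧
      StrictMono (fun k : Fin 3 => M1P2.charSpeed k U) ∧
      ∀ k : Fin 3, (M1P2.jacobian U).mulVec (M1P2.eigvec k U) =
        M1P2.charSpeed k U • M1P2.eigvec k U) ∧
    ∀ UL UR : M1P2.State,
      (M1P2.IsRarefaction 0 UL UR →
        UR 0 < UL 0 ∧ M1P2.vel UL < M1P2.vel UR ∧ M1P2.press UR < M1P2.press UL) ∧
      (M1P2.IsRarefaction 2 UL UR →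
        UL 0 < UR 0 ∧ M1P2.vel UL < M1P2.vel UR ∧ M1P2.press UL < M1P2.press UR) ∧
      (M1P2.IsShock 0 UL UR →
        UL 0 < UR 0 ∧ M1P2.vel UR < M1P2.vel UL ∧ M1P2.press UL < M1P2.press UR) ∧
      (M1P2.IsShock 2 UL UR →
        UR 0 < UL 0 ∧ M1P2.vel UR < M1P2.vel UL ∧ M1P2.press UR < M1P2.press UL) := by
  refine ⟨fun U hU => ?_, fun UL UR => ⟨M1P2.rarefaction_zero, M1P2.rarefaction_two,
    M1P2.shock_zero, M1P2.shock_two⟩⟩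
  have hU' := M1P2.realizable_subset_region hU
  exact ⟨M1P2.differentiableAt_flux hU', M1P2.charSpeed_strictMono hU',
    M1P2.jacobian_mulVec_eigvec hU'⟩
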